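/- Let $\mathbf{Gray}_{icon}$ be the 2-category whose objects are small 2-categories, whose 1-cells are (strict) 2-functors, and whose 2-cells are icons. Here an icon $\alpha:F\Rightarrow G$ between 2-functors $F,G:A\to B$ with $Fa=Ga$ for all objects $a$ consists of natural transformations $F_{ab}\Rightarrow G_{ab}:A(a,b)\to B(Fa,Fb)$ with $\alpha_{1_a}=1$ and $\alpha_{f*g}=\alpha_f*\alpha_g$. Let $A\otimes B$ be the Gray tensor product: the 2-category with objects $a\otimes b$, 1-cells generated by $f\otimes 1:a\otimes b\to a'\otimes b$ and $1\otimes g:a\otimes b\to a\otimes b'$, and 2-cells generated by $\alpha\otimes 1$, $1\otimes\beta$ and invertible 2-cells $\Sigma_{f,g}:(f\otimes 1)*(1\otimes g)\Rightarrow(1\otimes g)*(f\otimes 1)$, subject to the relations that $-\otimes b$ and $a\otimes -$ are 2-functors and that $\Sigma$ is natural in, and compatible with identities and composition in, each variable. Proposition. There is a strongly monoidal structure on the 2-category $\mathbf{Gray}_{icon}$, that is, a 2-functor $\otimes:\mathbf{Gray}_{icon}\times\mathbf{Gray}_{icon}\to\mathbf{Gray}_{icon}$, a unit object, and 2-natural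 isomorphisms $(A\otimes B)\otimes C\cong A\otimes(B\otimes C)$, $I\otimes A\cong A$ and $A\otimes I\cong A$ satisfying the pentagon and triangle axioms of a monoidal category, such that: 1. on objects, $\otimes$ is the Gray tensor product, and $I$ is the terminal 2-category; 2. for 2-functors $F:A\to A'$ and $G:B\to B'$, the 2-functor $F\otimes G$ sends $a\otimes b$, $f\otimes 1$, $1\otimes g$, $\alpha\otimes 1$, $1\otimes\beta$, $\Sigma_{f,g}$ to $Fa\otimes Gb$, $Ff\otimes 1$, $1\otimes Gg$, $F\alpha\otimes 1$, $1\otimes G\beta$, $\Sigma_{Ff,Gg}$ respectively; 3. for icons $\alpha:F\Rightarrow F'$ and $\beta:G\Rightarrow G'$, the icon $\alpha\otimes\beta:F\otimes G\Rightarrow F'\otimes G'$ has components $(\alpha\otimes\beta)_{f\otimes 1}=\alpha_f\otimes 1$ and $(\alpha\otimes\beta)_{1\otimes g}=1\otimes\beta_g$ on generating 1-cells; 4. the associator is the 2-functor that re-brackets objects and generating cells: on 1-cells $(f\otimes 1)\otimes 1\mapsto f\otimes 1$, $(1\otimes g)\otimes 1\mapsto 1\otimes(g\otimes 1)$ and $1\otimes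 h\mapsto 1\otimes(1\otimes h)$, likewise for 2-cells of $A$, $B$, $C$, and $\Sigma_{f,g}\otimes 1\mapsto\Sigma_{f,g\otimes 1}$, $\Sigma_{f\otimes 1,h}\mapsto\Sigma_{f,1\otimes h}$, $\Sigma_{1\otimes g,h}\mapsto 1\otimes\Sigma_{g,h}$; the left and right unit isomorphisms are the evident projections onto $A$. -/

import Mathlib

open CategoryTheory Bicategory

universe w₁ w₂ w₃ w₄ v₁ v₂ v₃ v₄ u₁ u₂ u₃ u₄ w v u

/-! ### 2-functors

A 2-category is a Mathlib `Bicategory` that is `Bicategory.Strict`. -/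

/-- Strict 2-functors between 2-categories: they preserve vertical composition, and preserve
identity 1-cells, composition of 1-cells and whiskering up to equality. -/
abbrev TwoFunctor (A : Type u₁) [Bicategory.{w₁, v₁} A] (B : Type u₂) [Bicategory.{w₂, v₂} B] :=
  StrictPseudofunctorPreCore A B

namespace TwoFunctor

variable {A : Type u₁} [Bicategory.{w₁, v₁} A] {B : Type u₂} [Bicategory.{w₂, v₂} B]
  {C : Type u₃} [Bicategory.{w₃, v₃} C]

/-- The identity 2-functor. -/
abbrev id (A : Type u₁) [Bicategory.{w₁, v₁} A] : TwoFunctor A A where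
  obj a := a
  map f := f
  map₂ η := η
  map_id _ := rfl
  map_comp _ _ := rfl
  map₂_whisker_left f _ _ η := by simp
  map₂_whisker_right η g := by simp

/-- Composition of 2-functors, in diagrammatic order. -/
abbrev comp (F : TwoFunctor A B) (G : TwoFunctor B C) : TwoFunctor A C where
  obj a := G.obj (F.obj a)
  map f := G.map (F.map f)
  map₂ η := G.map₂ (F.map₂ η)
  map_id X := by rw [F.map_id, G.map_id]
  map_comp f g := by rw [F.map_comp, G.map_comp]
  map₂_whisker_left f _ _ η := by
    rw [F.map₂_whisker_left]
    simp [PrelaxFunctor.map₂_eqToHom, G.map₂_whisker_left]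
  map₂_whisker_right η g := by
    rw [F.map₂_whisker_right]
    simp [PrelaxFunctor.map₂_eqToHom, G.map₂_whisker_right]

end TwoFunctor

/-! ### Icons -/

section HomCast

variable {C : Type u} [Bicategory.{w, v} C]

/-- The identification `C(x, y) = C(x', y')` along equalities of objects, on 1-cells. -/
abbrev homCast {x x' y y' : C} (hx : x = x') (hy : y = y') (f : x ⟶ y) : x' ⟶ y' :=
  hx ▸ hy ▸ f

/-- The identification `C(x, y) = C(x', y')` along equalities of objects, on 2-cells. -/
abbrev homCast₂ {x x' y y' : C} (hx : x = x') (hy : y = y') {f g : x ⟶ y} (η : f ⟶ g) :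
    homCast hx hy f ⟶ homCast hx hy g :=
  match hx, hy with
  | rfl, rfl => η

theorem homCast_id {x x' : C} (hx hx' : x = x') : homCast hx hx' (𝟙 x) = 𝟙 x' := by
  cases hx; rfl

theorem homCast_comp {x x' y y' z z' : C} (hx : x = x') (hy : y = y') (hz : z = z')
    (f : x ⟶ y) (g : y ⟶ z) :
    homCast hx hz (f ≫ g) = homCast hx hy f ≫ homCast hy hz g := by
  cases hx; cases hy; cases hz; rfl

theorem homCast_trans {x x' x'' y y' y'' : C} (hx : x = x') (hx' : x' = x'')
    (hy : y = y') (hy' : y' = y'') (f : x ⟶ y) :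
    homCast hx' hy' (homCast hx hy f) = homCast (hx.trans hx') (hy.trans hy') f := by
  cases hx; cases hy; cases hx'; cases hy'; rfl

theorem homCast₂_id {x x' y y' : C} (hx : x = x') (hy : y = y') (f : x ⟶ y) :
    homCast₂ hx hy (𝟙 f) = 𝟙 (homCast hx hy f) := by
  cases hx; cases hy; rfl

theorem homCast₂_comp {x x' y y' : C} (hx : x = x') (hy : y = y') {f g h : x ⟶ y}
    (η : f ⟶ g) (θ : g ⟶ h) :
    homCast₂ hx hy (η ≫ θ) = homCast₂ hx hy η ≫ homCast₂ hx hy θ := by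
  cases hx; cases hy; rfl

theorem homCast₂_eqToHom {x x' y y' : C} (hx : x = x') (hy : y = y') {f g : x ⟶ y}
    (h : f = g) :
    homCast₂ hx hy (eqToHom h) = eqToHom (congrArg (homCast hx hy) h) := by
  cases hx; cases hy; cases h; rfl

theorem homCast₂_trans {x x' x'' y y' y'' : C} (hx : x = x') (hx' : x' = x'')
    (hy : y = y') (hy' : y' = y'') {f g : x ⟶ y} (η : f ⟶ g) :
    homCast₂ hx' hy' (homCast₂ hx hy η) = eqToHom (homCast_trans hx hx' hy hy' f) ≫
      homCast₂ (hx.trans hx') (hy.trans hy') η ≫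
        eqToHom (homCast_trans hx hx' hy hy' g).symm := by
  cases hx; cases hy; cases hx'; cases hy'; simp

theorem TwoFunctor.map_homCast {D : Type u₁} [Bicategory.{w₁, v₁} D] (H : TwoFunctor C D)
    {x x' y y' : C} (hx : x = x') (hy : y = y') (f : x ⟶ y) :
    H.map (homCast hx hy f) =
      homCast (congrArg H.obj hx) (congrArg H.obj hy) (H.map f) := by
  cases hx; cases hy; rfl

theorem TwoFunctor.map₂_homCast₂ {D : Type u₁} [Bicategory.{w₁, v₁} D] (H : TwoFunctor C D)
    {x x' y y' : C} (hx : x = x') (hy : y = y') {f g : x ⟶ y} (η : f ⟶ g) :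
    H.map₂ (homCast₂ hx hy η) = eqToHom (H.map_homCast hx hy f) ≫
      homCast₂ (congrArg H.obj hx) (congrArg H.obj hy) (H.map₂ η) ≫
        eqToHom (H.map_homCast hx hy g).symm := by
  cases hx; cases hy; simp

end HomCast

/-- An icon `F ⇒ G` between 2-functors that agree on objects: natural transformations
`F_{ab} ⇒ G_{ab} : A(a, b) ⥤ B(F a, F b)` that are compatible with the (identity) unit and
composition constraints of `F` and `G`. -/
structure Icon {A : Type u₁} [Bicategory.{w₁, v₁} A] {B : Type u₂} [Bicategory.{w₂, v₂} B]
    (F G : TwoFunctor A B) where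
  obj_eq (a : A) : F.obj a = G.obj a
  app {a b : A} (f : a ⟶ b) :
    F.map f ⟶ homCast (obj_eq a).symm (obj_eq b).symm (G.map f)
  naturality {a b : A} {f g : a ⟶ b} (η : f ⟶ g) :
    F.map₂ η ≫ app g = app f ≫ homCast₂ (obj_eq a).symm (obj_eq b).symm (G.map₂ η)
  app_id (a : A) : app (𝟙 a) =
    eqToHom (by rw [F.map_id, G.map_id, homCast_id])
  app_comp {a b c : A} (f : a ⟶ b) (g : b ⟶ c) : app (f ≫ g) =
    eqToHom (F.map_comp f g) ≫
      (app f ▷ F.map g ≫ homCast (obj_eq a).symm (obj_eq b).symm (G.map f) ◁ app g) ≫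
        eqToHom (by rw [G.map_comp, homCast_comp _ (obj_eq b).symm])

namespace Icon

variable {A : Type u₁} [Bicategory.{w₁, v₁} A] {B : Type u₂} [Bicategory.{w₂, v₂} B]
  {C : Type u₃} [Bicategory.{w₃, v₃} C]

@[ext]
theorem ext {F G : TwoFunctor A B} {α β : Icon F G}
    (h : ∀ {a b : A} (f : a ⟶ b), α.app f = β.app f) : α = β := by
  cases α; cases β
  congr
  funext a b f
  exact h f

theorem app_congr {F G : TwoFunctor A B} (α : Icon F G) {a b : A} {f g : a ⟶ b} (h : f = g) :
    α.app f = eqToHom (by rw [h]) ≫ α.app g ≫ eqToHom (by rw [h]) := by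
  cases h; simp

theorem app_homCast {F G : TwoFunctor A B} (α : Icon F G) {a a' b b' : A} (ha : a = a')
    (hb : b = b') (f : a ⟶ b) :
    α.app (homCast ha hb f) = eqToHom (F.map_homCast ha hb f) ≫
      homCast₂ (congrArg F.obj ha) (congrArg F.obj hb) (α.app f) ≫
        eqToHom (by cases ha; cases hb; rfl) := by
  cases ha; cases hb; simp

/-- The identity icon. -/
def id (F : TwoFunctor A B) : Icon F F where
  obj_eq _ := rfl
  app f := 𝟙 (F.map f)
  naturality η := by simp
  app_id a := by simp
  app_comp f g := by simp

theorem vcomp_naturality {x x' x'' y y' y'' : C} (hx : x' = x) (hx' : x'' = x')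
    (hy : y' = y) (hy' : y'' = y') {f g : x ⟶ y} {f' g' : x' ⟶ y'} {f'' g'' : x'' ⟶ y''}
    (a : f ⟶ homCast hx hy f') (b : g ⟶ homCast hx hy g')
    (a' : f' ⟶ homCast hx' hy' f'') (b' : g' ⟶ homCast hx' hy' g'')
    (η : f ⟶ g) (η' : f' ⟶ g') (η'' : f'' ⟶ g'')
    (h : η ≫ b = a ≫ homCast₂ hx hy η') (h' : η' ≫ b' = a' ≫ homCast₂ hx' hy' η'') :
    η ≫ (b ≫ homCast₂ hx hy b' ≫ eqToHom (homCast_trans hx' hx hy' hy g'')) =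
      (a ≫ homCast₂ hx hy a' ≫ eqToHom (homCast_trans hx' hx hy' hy f'')) ≫
        homCast₂ (hx'.trans hx) (hy'.trans hy) η'' := by
  cases hx; cases hx'; cases hy; cases hy'
  simp_all [reassoc_of% h]

theorem vcomp_comp {x x' x'' y y' y'' z z' z'' : C} (hx : x' = x) (hx' : x'' = x')
    (hy : y' = y) (hy' : y'' = y') (hz : z' = z) (hz' : z'' = z')
    {f : x ⟶ y} {f' : x' ⟶ y'} {f'' : x'' ⟶ y''}
    {g : y ⟶ z} {g' : y' ⟶ z'} {g'' : y'' ⟶ z''}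
    {k : x ⟶ z} {k' : x' ⟶ z'} {k'' : x'' ⟶ z''}
    (hk : k = f ≫ g) (hk' : k' = f' ≫ g') (hk'' : k'' = f'' ≫ g'')
    (a : f ⟶ homCast hx hy f') (b : g ⟶ homCast hy hz g') (c : k ⟶ homCast hx hz k')
    (a' : f' ⟶ homCast hx' hy' f'') (b' : g' ⟶ homCast hy' hz' g'')
    (c' : k' ⟶ homCast hx' hz' k'')
    (h : c = eqToHom hk ≫ (a ▷ g ≫ homCast hx hy f' ◁ b) ≫
      eqToHom (by rw [hk', homCast_comp _ hy]))
    (h' : c' = eqToHom hk' ≫ (a' ▷ g' ≫ homCast hx' hy' f'' ◁ b') ≫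
      eqToHom (by rw [hk'', homCast_comp _ hy'])) :
    c ≫ homCast₂ hx hz c' ≫ eqToHom (homCast_trans hx' hx hz' hz k'') =
      eqToHom hk ≫ ((a ≫ homCast₂ hx hy a' ≫ eqToHom (homCast_trans hx' hx hy' hy f'')) ▷ g ≫
        homCast (hx'.trans hx) (hy'.trans hy) f'' ◁
          (b ≫ homCast₂ hy hz b' ≫ eqToHom (homCast_trans hy' hy hz' hz g''))) ≫
        eqToHom (by rw [hk'', homCast_comp _ (hy'.trans hy)]) := by
  cases hx; cases hx'; cases hy; cases hy'; cases hz; cases hz'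
  subst hk hk' hk''
  simp [h, h', whisker_exchange_assoc]

/-- Vertical composition of icons, computed componentwise. -/
def vcomp {F G H : TwoFunctor A B} (α : Icon F G) (β : Icon G H) : Icon F H where
  obj_eq a := (α.obj_eq a).trans (β.obj_eq a)
  app {a b} f := α.app f ≫ homCast₂ (α.obj_eq a).symm (α.obj_eq b).symm (β.app f) ≫
    eqToHom (homCast_trans _ _ _ _ _)
  naturality {a b f g} η := by
    apply vcomp_naturality
    · exact α.naturality η
    · exact β.naturality η
  app_id a := by
    simp [α.app_id, β.app_id, homCast₂_eqToHom]
  app_comp {a b c} f g := by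
    exact vcomp_comp _ _ _ _ _ _ (F.map_comp f g) (G.map_comp f g) (H.map_comp f g)
      _ _ _ _ _ _ (α.app_comp f g) (β.app_comp f g)

/-- Whiskering of an icon by a 2-functor on the side of the source. -/
def whiskerLeft (F : TwoFunctor A B) {G H : TwoFunctor B C} (β : Icon G H) :
    Icon (F.comp G) (F.comp H) where
  obj_eq a := β.obj_eq (F.obj a)
  app f := β.app (F.map f)
  naturality η := β.naturality (F.map₂ η)
  app_id a := by
    rw [β.app_congr (F.map_id a), β.app_id]
    simp
  app_comp f g := by
    rw [β.app_congr (F.map_comp f g), β.app_comp]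
    simp

theorem whiskerRight_naturality (H : TwoFunctor B C) {x x' y y' : B} (hx : x' = x) (hy : y' = y)
    {f g : x ⟶ y} {f' g' : x' ⟶ y'} (a : f ⟶ homCast hx hy f') (b : g ⟶ homCast hx hy g')
    (η : f ⟶ g) (η' : f' ⟶ g') (h : η ≫ b = a ≫ homCast₂ hx hy η') :
    H.map₂ η ≫ (H.map₂ b ≫ eqToHom (H.map_homCast hx hy g')) =
      (H.map₂ a ≫ eqToHom (H.map_homCast hx hy f')) ≫
        homCast₂ (congrArg H.obj hx) (congrArg H.obj hy) (H.map₂ η') := by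
  cases hx; cases hy
  simp only [eqToHom_refl, Category.comp_id] at h ⊢
  rw [← PrelaxFunctor.map₂_comp, h, PrelaxFunctor.map₂_comp]

theorem whiskerRight_comp (H : TwoFunctor B C) {x x' y y' z z' : B} (hx : x' = x) (hy : y' = y)
    (hz : z' = z) {f : x ⟶ y} {f' : x' ⟶ y'} {g : y ⟶ z} {g' : y' ⟶ z'}
    {k : x ⟶ z} {k' : x' ⟶ z'} (hk : k = f ≫ g) (hk' : k' = f' ≫ g')
    (a : f ⟶ homCast hx hy f') (b : g ⟶ homCast hy hz g') (c : k ⟶ homCast hx hz k')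
    (h : c = eqToHom hk ≫ (a ▷ g ≫ homCast hx hy f' ◁ b) ≫
      eqToHom (by rw [hk', homCast_comp _ hy])) :
    H.map₂ c ≫ eqToHom (H.map_homCast hx hz k') =
      eqToHom (by rw [hk, H.map_comp]) ≫
        ((H.map₂ a ≫ eqToHom (H.map_homCast hx hy f')) ▷ H.map g ≫
          homCast (congrArg H.obj hx) (congrArg H.obj hy) (H.map f') ◁
            (H.map₂ b ≫ eqToHom (H.map_homCast hy hz g'))) ≫
        eqToHom (by rw [hk', H.map_comp, homCast_comp _ (congrArg H.obj hy)]) := by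
  cases hx; cases hy; cases hz
  subst hk hk'
  simp [h, H.map₂_whisker_left, H.map₂_whisker_right]

/-- Whiskering of an icon by a 2-functor on the side of the target. -/
def whiskerRight {F G : TwoFunctor A B} (α : Icon F G) (H : TwoFunctor B C) :
    Icon (F.comp H) (G.comp H) where
  obj_eq a := congrArg H.obj (α.obj_eq a)
  app f := H.map₂ (α.app f) ≫ eqToHom (H.map_homCast _ _ _)
  naturality η := by
    exact whiskerRight_naturality H _ _ _ _ _ _ (α.naturality η)
  app_id a := by
    rw [α.app_id, PrelaxFunctor.map₂_eqToHom, eqToHom_trans]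
  app_comp f g := by
    exact whiskerRight_comp H _ _ _ (F.map_comp f g) (G.map_comp f g) _ _ _ (α.app_comp f g)

theorem whiskerLeft_id (F : TwoFunctor A B) (G : TwoFunctor B C) :
    whiskerLeft F (Icon.id G) = Icon.id (F.comp G) := rfl

theorem id_whiskerRight (F : TwoFunctor A B) (G : TwoFunctor B C) :
    (Icon.id F).whiskerRight G = Icon.id (F.comp G) := by
  apply Icon.ext; intro a b f
  exact (Category.comp_id _).trans (G.map₂_id (F.map f))

theorem id_vcomp {F G : TwoFunctor A B} (α : Icon F G) : (Icon.id F).vcomp α = α := by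
  apply Icon.ext; intro a b f
  simp [vcomp, id]

theorem vcomp_whiskerRight {F G K : TwoFunctor A B} (α : Icon F G) (β : Icon G K)
    (H : TwoFunctor B C) :
    (α.vcomp β).whiskerRight H = (α.whiskerRight H).vcomp (β.whiskerRight H) := by
  apply Icon.ext; intro a b f
  simp [vcomp, whiskerRight, PrelaxFunctor.map₂_eqToHom, TwoFunctor.map₂_homCast₂,
    homCast₂_comp, homCast₂_eqToHom]

theorem whiskerRight_comp' {D : Type u₄} [Bicategory.{w₄, v₄} D] {F G : TwoFunctor A B}
    (α : Icon F G) (H : TwoFunctor B C) (K : TwoFunctor C D) :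
    α.whiskerRight (H.comp K) = (α.whiskerRight H).whiskerRight K := by
  apply Icon.ext; intro a b f
  simp [whiskerRight, PrelaxFunctor.map₂_eqToHom]

theorem whisker_exchange {F G : TwoFunctor A B} {H K : TwoFunctor B C} (α : Icon F G)
    (β : Icon H K) :
    (whiskerLeft F β).vcomp (α.whiskerRight K) =
      (α.whiskerRight H).vcomp (whiskerLeft G β) := by
  apply Icon.ext; intro a b f
  have h := β.naturality (α.app f)
  rw [β.app_homCast (α.obj_eq a).symm (α.obj_eq b).symm (G.map f)] at h
  have h' := h =≫ eqToHom (by rw [K.map_homCast, homCast_trans] :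
    homCast (β.obj_eq (F.obj a)).symm (β.obj_eq (F.obj b)).symm
      (K.map (homCast (α.obj_eq a).symm (α.obj_eq b).symm (G.map f))) =
    homCast ((congrArg H.obj (α.obj_eq a)).trans (β.obj_eq (G.obj a))).symm
      ((congrArg H.obj (α.obj_eq b)).trans (β.obj_eq (G.obj b))).symm (K.map (G.map f)))
  simp only [Category.assoc, eqToHom_trans] at h'
  simp only [whiskerRight, whiskerLeft, vcomp, homCast₂_comp, homCast₂_eqToHom, Category.assoc,
    eqToHom_trans]
  exact h'.symm

end Icon

/-! ### The 2-category of 2-categories, 2-functors and icons -/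

/-- The objects of `Gray_icon`: small 2-categories. -/
structure GrayIcon : Type (u + 1) where
  carrier : Type u
  [bicategory : Bicategory.{u, u} carrier]
  [strict : Strict carrier]

namespace GrayIcon

attribute [instance] bicategory strict

instance : CategoryStruct GrayIcon.{u} where
  Hom A B := TwoFunctor A.carrier B.carrier
  id A := TwoFunctor.id A.carrier
  comp F G := F.comp G

instance homCategory (A B : GrayIcon.{u}) : Category (A ⟶ B) where
  Hom F G := Icon F G
  id F := Icon.id F
  comp α β := α.vcomp β
  id_comp α := by
    apply Icon.ext; intro a b f
    simp [Icon.vcomp, Icon.id]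
  comp_id α := by
    apply Icon.ext; intro a b f
    simp [Icon.vcomp, Icon.id, homCast₂_id]
  assoc α β γ := by
    apply Icon.ext; intro a b f
    simp [Icon.vcomp, homCast₂_comp, homCast₂_trans, homCast₂_eqToHom]

theorem conj_refl {C : Type u} [Category.{v} C] {X Y : C} (f : X ⟶ Y) :
    f = (eqToIso (rfl : X = X)).hom ≫ f ≫ (eqToIso (rfl : Y = Y)).inv := by simp

theorem conj_refl' {C : Type u} [Category.{v} C] {X Y : C} (f : X ⟶ Y) :
    f = (eqToIso (rfl : X = X)).inv ≫ f ≫ (eqToIso (rfl : Y = Y)).hom := by simp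

/-- `Gray_icon` as a 2-category: 2-categories, 2-functors and icons. -/
instance : Bicategory GrayIcon.{u} where
  homCategory := homCategory
  whiskerLeft F _ _ α := Icon.whiskerLeft F α
  whiskerRight α H := Icon.whiskerRight α H
  associator F G H := eqToIso rfl
  leftUnitor F := eqToIso rfl
  rightUnitor F := eqToIso rfl
  whiskerLeft_id F G := Icon.whiskerLeft_id F G
  whiskerLeft_comp F _ _ _ α β := rfl
  id_whiskerLeft α := conj_refl (C := _ ⟶ _) α
  comp_whiskerLeft F G H H' α :=
    conj_refl (X := F ≫ G ≫ H) (Y := F ≫ G ≫ H') (Icon.whiskerLeft F (Icon.whiskerLeft G α))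
  id_whiskerRight F G := Icon.id_whiskerRight F G
  comp_whiskerRight α β H := Icon.vcomp_whiskerRight α β H
  whiskerRight_id {F G f g} α := by
    refine Eq.trans ?_ (conj_refl (C := _ ⟶ _) α)
    apply Icon.ext; intro a b f
    exact Category.comp_id _
  whiskerRight_comp {_ _ _ _ F F'} α G H :=
    (Icon.whiskerRight_comp' α G H).trans
      (conj_refl' (X := F ≫ G ≫ H) (Y := F' ≫ G ≫ H) ((Icon.whiskerRight α G).whiskerRight H))
  whisker_assoc F G G' α H :=
    conj_refl (X := F ≫ G ≫ H) (Y := F ≫ G' ≫ H) (Icon.whiskerLeft F (Icon.whiskerRight α H))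
  whisker_exchange α β := Icon.whisker_exchange α β
  pentagon F G H K := by
    change ((Icon.id ((F ≫ G) ≫ H)).whiskerRight K).vcomp ((Icon.id (F ≫ (G ≫ H) ≫ K)).vcomp
      (Icon.whiskerLeft F (Icon.id (G ≫ H ≫ K)))) =
        (Icon.id (F ≫ G ≫ H ≫ K)).vcomp (Icon.id (F ≫ G ≫ H ≫ K))
    rw [Icon.id_whiskerRight]
    exact Icon.id_vcomp _
  triangle F G := by
    change (Icon.id _).vcomp (Icon.whiskerLeft F (Icon.id _)) = (Icon.id F).whiskerRight G
    rw [Icon.id_whiskerRight, Icon.whiskerLeft_id, Icon.id_vcomp]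

instance : Strict GrayIcon.{u} where
  id_comp _ := rfl
  comp_id _ := rfl
  assoc _ _ _ := rfl
  leftUnitor_eqToIso _ := by rfl
  rightUnitor_eqToIso _ := by rfl
  associator_eqToIso _ _ _ := by rfl

end GrayIcon

/-! ### The Gray tensor product of 2-categories -/

/-- The objects `a ⊗ b` of the Gray tensor product `A ⊗ B`. -/
@[ext]
structure GrayTensor (A : Type u₁) (B : Type u₂) where
  fst : A
  snd : B

namespace GrayTensor

variable {A : Type u₁} [Bicategory.{w₁, v₁} A] {B : Type u₂} [Bicategory.{w₂, v₂} B]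

/-- Formal composites of the generating 1-cells `f ⊗ 1` (`left f b`) and `1 ⊗ g` (`right a g`). -/
inductive Word : GrayTensor A B → GrayTensor A B → Type max u₁ u₂ v₁ v₂
  | left {a a' : A} (f : a ⟶ a') (b : B) : Word ⟨a, b⟩ ⟨a', b⟩
  | right (a : A) {b b' : B} (g : b ⟶ b') : Word ⟨a, b⟩ ⟨a, b'⟩
  | id (x : GrayTensor A B) : Word x x
  | comp {x y z : GrayTensor A B} (p : Word x y) (q : Word y z) : Word x z

/-- The relations between 1-cells: the axioms of a category, and functoriality of `- ⊗ 1` and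
`1 ⊗ -`. -/
inductive WordRel : ∀ {x y : GrayTensor A B}, Word x y → Word x y → Prop
  | comp_right {x y z} (p : Word x y) {q q' : Word y z} :
      WordRel q q' → WordRel (p.comp q) (p.comp q')
  | comp_left {x y z} {p p' : Word x y} (q : Word y z) :
      WordRel p p' → WordRel (p.comp q) (p'.comp q)
  | id_comp {x y} (p : Word x y) : WordRel ((Word.id x).comp p) p
  | comp_id {x y} (p : Word x y) : WordRel (p.comp (Word.id y)) p
  | assoc {x y z t} (p : Word x y) (q : Word y z) (r : Word z t) :
      WordRel ((p.comp q).comp r) (p.comp (q.comp r))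
  | left_id (a : A) (b : B) : WordRel (Word.left (𝟙 a) b) (Word.id ⟨a, b⟩)
  | left_comp {a a' a'' : A} (f : a ⟶ a') (f' : a' ⟶ a'') (b : B) :
      WordRel (Word.left (f ≫ f') b) ((Word.left f b).comp (Word.left f' b))
  | right_id (a : A) (b : B) : WordRel (Word.right a (𝟙 b)) (Word.id ⟨a, b⟩)
  | right_comp (a : A) {b b' b'' : B} (g : b ⟶ b') (g' : b' ⟶ b'') :
      WordRel (Word.right a (g ≫ g')) ((Word.right a g).comp (Word.right a g'))

instance : CategoryStruct.{max u₁ u₂ v₁ v₂} (GrayTensor A B) where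
  Hom x y := Quot (WordRel (x := x) (y := y))
  id x := Quot.mk _ (Word.id x)
  comp := Quot.map₂ Word.comp (fun p _ _ h => WordRel.comp_right p h)
    (fun _ _ q h => WordRel.comp_left q h)

/-- The generating 1-cell `f ⊗ 1 : a ⊗ b ⟶ a' ⊗ b`. -/
def left {a a' : A} (f : a ⟶ a') (b : B) : (⟨a, b⟩ : GrayTensor A B) ⟶ ⟨a', b⟩ :=
  Quot.mk _ (Word.left f b)

/-- The generating 1-cell `1 ⊗ g : a ⊗ b ⟶ a ⊗ b'`. -/
def right (a : A) {b b' : B} (g : b ⟶ b') : (⟨a, b⟩ : GrayTensor A B) ⟶ ⟨a, b'⟩ :=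
  Quot.mk _ (Word.right a g)

theorem id_comp' {x y : GrayTensor A B} (p : x ⟶ y) : 𝟙 x ≫ p = p := by
  induction p using Quot.ind with
  | mk p => exact Quot.sound (WordRel.id_comp p)

theorem comp_id' {x y : GrayTensor A B} (p : x ⟶ y) : p ≫ 𝟙 y = p := by
  induction p using Quot.ind with
  | mk p => exact Quot.sound (WordRel.comp_id p)

theorem assoc' {x y z t : GrayTensor A B} (p : x ⟶ y) (q : y ⟶ z) (r : z ⟶ t) :
    (p ≫ q) ≫ r = p ≫ q ≫ r := by
  induction p using Quot.ind with
  | mk p =>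
  induction q using Quot.ind with
  | mk q =>
  induction r using Quot.ind with
  | mk r => exact Quot.sound (WordRel.assoc p q r)

theorem left_id (a : A) (b : B) : left (𝟙 a) b = 𝟙 _ := Quot.sound (WordRel.left_id a b)

theorem left_comp {a a' a'' : A} (f : a ⟶ a') (f' : a' ⟶ a'') (b : B) :
    left (f ≫ f') b = left f b ≫ left f' b := Quot.sound (WordRel.left_comp f f' b)

theorem right_id (a : A) (b : B) : right a (𝟙 b) = 𝟙 _ := Quot.sound (WordRel.right_id a b)

theorem right_comp (a : A) {b b' b'' : B} (g : b ⟶ b') (g' : b' ⟶ b'') :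
    right a (g ≫ g') = right a g ≫ right a g' := Quot.sound (WordRel.right_comp a g g')

/-- Formal composites (vertical composites and whiskerings) of the generating 2-cells
`α ⊗ 1`, `1 ⊗ β`, `Σ_{f,g} : (1 ⊗ g) ≫ (f ⊗ 1) ⟶ (f ⊗ 1) ≫ (1 ⊗ g)` and `Σ_{f,g}⁻¹`. -/
inductive Cell : ∀ {x y : GrayTensor A B}, (x ⟶ y) → (x ⟶ y) → Type max u₁ u₂ v₁ v₂ w₁ w₂
  | left₂ {a a' : A} {f f' : a ⟶ a'} (α : f ⟶ f') (b : B) : Cell (left f b) (left f' b)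
  | right₂ (a : A) {b b' : B} {g g' : b ⟶ b'} (β : g ⟶ g') : Cell (right a g) (right a g')
  | sigma {a a' : A} {b b' : B} (f : a ⟶ a') (g : b ⟶ b') :
      Cell (right a g ≫ left f b') (left f b ≫ right a' g)
  | sigmaInv {a a' : A} {b b' : B} (f : a ⟶ a') (g : b ⟶ b') :
      Cell (left f b ≫ right a' g) (right a g ≫ left f b')
  | id {x y : GrayTensor A B} (p : x ⟶ y) : Cell p p
  | vcomp {x y : GrayTensor A B} {p q r : x ⟶ y} (η : Cell p q) (θ : Cell q r) : Cell p r
  | whiskerLeft {x y z : GrayTensor A B} (p : x ⟶ y) {q q' : y ⟶ z} (η : Cell q q') :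
      Cell (p ≫ q) (p ≫ q')
  | whiskerRight {x y z : GrayTensor A B} {p p' : x ⟶ y} (η : Cell p p') (q : y ⟶ z) :
      Cell (p ≫ q) (p' ≫ q)

/-- The identity 2-cell between equal 1-cells. -/
def Cell.ofEq {x y : GrayTensor A B} {p q : x ⟶ y} (h : p = q) : Cell p q :=
  match h with
  | rfl => Cell.id p

/-- The relations between 2-cells: the axioms of a 2-category; 2-functoriality of `- ⊗ 1` and
`1 ⊗ -`; invertibility and naturality of `Σ`; and compatibility of `Σ` with identities and
composition of 1-cells in each variable. -/
inductive CellRel : ∀ {x y : GrayTensor A B} {p q : x ⟶ y}, Cell p q → Cell p q → Prop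
  -- congruence
  | vcomp_right {x y : GrayTensor A B} {p q r : x ⟶ y} (η : Cell p q) {θ θ' : Cell q r} :
      CellRel θ θ' → CellRel (η.vcomp θ) (η.vcomp θ')
  | vcomp_left {x y : GrayTensor A B} {p q r : x ⟶ y} {η η' : Cell p q} (θ : Cell q r) :
      CellRel η η' → CellRel (η.vcomp θ) (η'.vcomp θ)
  | whiskerLeft {x y z : GrayTensor A B} (p : x ⟶ y) {q q' : y ⟶ z} {η η' : Cell q q'} :
      CellRel η η' → CellRel (Cell.whiskerLeft p η) (Cell.whiskerLeft p η')
  | whiskerRight {x y z : GrayTensor A B} {p p' : x ⟶ y} {η η' : Cell p p'} (q : y ⟶ z) :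
      CellRel η η' → CellRel (η.whiskerRight q) (η'.whiskerRight q)
  -- the axioms of a 2-category
  | id_vcomp {x y : GrayTensor A B} {p q : x ⟶ y} (η : Cell p q) :
      CellRel ((Cell.id p).vcomp η) η
  | vcomp_id {x y : GrayTensor A B} {p q : x ⟶ y} (η : Cell p q) :
      CellRel (η.vcomp (Cell.id q)) η
  | vcomp_assoc {x y : GrayTensor A B} {p q r s : x ⟶ y} (η : Cell p q) (θ : Cell q r)
      (κ : Cell r s) : CellRel ((η.vcomp θ).vcomp κ) (η.vcomp (θ.vcomp κ))
  | whiskerLeft_id {x y z : GrayTensor A B} (p : x ⟶ y) (q : y ⟶ z) :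
      CellRel (Cell.whiskerLeft p (Cell.id q)) (Cell.id (p ≫ q))
  | whiskerLeft_vcomp {x y z : GrayTensor A B} (p : x ⟶ y) {q r s : y ⟶ z} (η : Cell q r)
      (θ : Cell r s) : CellRel (Cell.whiskerLeft p (η.vcomp θ))
        ((Cell.whiskerLeft p η).vcomp (Cell.whiskerLeft p θ))
  | id_whiskerRight {x y z : GrayTensor A B} (p : x ⟶ y) (q : y ⟶ z) :
      CellRel ((Cell.id p).whiskerRight q) (Cell.id (p ≫ q))
  | vcomp_whiskerRight {x y z : GrayTensor A B} {p q r : x ⟶ y} (η : Cell p q) (θ : Cell q r)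
      (s : y ⟶ z) : CellRel ((η.vcomp θ).whiskerRight s)
        ((η.whiskerRight s).vcomp (θ.whiskerRight s))
  | id_whiskerLeft {x y : GrayTensor A B} {p q : x ⟶ y} (η : Cell p q) :
      CellRel (Cell.whiskerLeft (𝟙 x) η)
        ((Cell.ofEq (id_comp' p)).vcomp (η.vcomp (Cell.ofEq (id_comp' q).symm)))
  | whiskerRight_id {x y : GrayTensor A B} {p q : x ⟶ y} (η : Cell p q) :
      CellRel (η.whiskerRight (𝟙 y))
        ((Cell.ofEq (comp_id' p)).vcomp (η.vcomp (Cell.ofEq (comp_id' q).symm)))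
  | comp_whiskerLeft {x y z t : GrayTensor A B} (p : x ⟶ y) (q : y ⟶ z) {r s : z ⟶ t}
      (η : Cell r s) : CellRel (Cell.whiskerLeft (p ≫ q) η)
        ((Cell.ofEq (assoc' p q r)).vcomp
          ((Cell.whiskerLeft p (Cell.whiskerLeft q η)).vcomp (Cell.ofEq (assoc' p q s).symm)))
  | whiskerRight_comp {x y z t : GrayTensor A B} {p q : x ⟶ y} (η : Cell p q) (r : y ⟶ z)
      (s : z ⟶ t) : CellRel (η.whiskerRight (r ≫ s))
        ((Cell.ofEq (assoc' p r s).symm).vcomp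
          (((η.whiskerRight r).whiskerRight s).vcomp (Cell.ofEq (assoc' q r s))))
  | whisker_assoc {x y z t : GrayTensor A B} (p : x ⟶ y) {q r : y ⟶ z} (η : Cell q r)
      (s : z ⟶ t) : CellRel ((Cell.whiskerLeft p η).whiskerRight s)
        ((Cell.ofEq (assoc' p q s)).vcomp
          ((Cell.whiskerLeft p (η.whiskerRight s)).vcomp (Cell.ofEq (assoc' p r s).symm)))
  | whisker_exchange {x y z : GrayTensor A B} {p q : x ⟶ y} {r s : y ⟶ z} (η : Cell p q)
      (θ : Cell r s) : CellRel ((Cell.whiskerLeft p θ).vcomp (η.whiskerRight s))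
        ((η.whiskerRight r).vcomp (Cell.whiskerLeft q θ))
  -- `- ⊗ b` is a 2-functor
  | left₂_id {a a' : A} (f : a ⟶ a') (b : B) : CellRel (Cell.left₂ (𝟙 f) b) (Cell.id (left f b))
  | left₂_comp {a a' : A} {f f' f'' : a ⟶ a'} (α : f ⟶ f') (α' : f' ⟶ f'') (b : B) :
      CellRel (Cell.left₂ (α ≫ α') b) ((Cell.left₂ α b).vcomp (Cell.left₂ α' b))
  | left₂_whiskerLeft {a a' a'' : A} (f : a ⟶ a') {h h' : a' ⟶ a''} (α : h ⟶ h') (b : B) :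
      CellRel (Cell.left₂ (f ◁ α) b) ((Cell.ofEq (left_comp f h b)).vcomp
        ((Cell.whiskerLeft (left f b) (Cell.left₂ α b)).vcomp
          (Cell.ofEq (left_comp f h' b).symm)))
  | left₂_whiskerRight {a a' a'' : A} {f f' : a ⟶ a'} (α : f ⟶ f') (h : a' ⟶ a'') (b : B) :
      CellRel (Cell.left₂ (α ▷ h) b) ((Cell.ofEq (left_comp f h b)).vcomp
        (((Cell.left₂ α b).whiskerRight (left h b)).vcomp
          (Cell.ofEq (left_comp f' h b).symm)))
  -- `a ⊗ -` is a 2-functor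
  | right₂_id (a : A) {b b' : B} (g : b ⟶ b') :
      CellRel (Cell.right₂ a (𝟙 g)) (Cell.id (right a g))
  | right₂_comp (a : A) {b b' : B} {g g' g'' : b ⟶ b'} (β : g ⟶ g') (β' : g' ⟶ g'') :
      CellRel (Cell.right₂ a (β ≫ β')) ((Cell.right₂ a β).vcomp (Cell.right₂ a β'))
  | right₂_whiskerLeft (a : A) {b b' b'' : B} (g : b ⟶ b') {h h' : b' ⟶ b''} (β : h ⟶ h') :
      CellRel (Cell.right₂ a (g ◁ β)) ((Cell.ofEq (right_comp a g h)).vcomp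
        ((Cell.whiskerLeft (right a g) (Cell.right₂ a β)).vcomp
          (Cell.ofEq (right_comp a g h').symm)))
  | right₂_whiskerRight (a : A) {b b' b'' : B} {g g' : b ⟶ b'} (β : g ⟶ g') (h : b' ⟶ b'') :
      CellRel (Cell.right₂ a (β ▷ h)) ((Cell.ofEq (right_comp a g h)).vcomp
        (((Cell.right₂ a β).whiskerRight (right a h)).vcomp
          (Cell.ofEq (right_comp a g' h).symm)))
  -- `Σ` is invertible
  | sigma_sigmaInv {a a' : A} {b b' : B} (f : a ⟶ a') (g : b ⟶ b') :
      CellRel ((Cell.sigma f g).vcomp (Cell.sigmaInv f g)) (Cell.id (right a g ≫ left f b'))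
  | sigmaInv_sigma {a a' : A} {b b' : B} (f : a ⟶ a') (g : b ⟶ b') :
      CellRel ((Cell.sigmaInv f g).vcomp (Cell.sigma f g)) (Cell.id (left f b ≫ right a' g))
  -- `Σ` is natural in each variable
  | sigma_natural_left {a a' : A} {b b' : B} {f f' : a ⟶ a'} (α : f ⟶ f') (g : b ⟶ b') :
      CellRel ((Cell.whiskerLeft (right a g) (Cell.left₂ α b')).vcomp (Cell.sigma f' g))
        ((Cell.sigma f g).vcomp ((Cell.left₂ α b).whiskerRight (right a' g)))
  | sigma_natural_right {a a' : A} {b b' : B} (f : a ⟶ a') {g g' : b ⟶ b'} (β : g ⟶ g') :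
      CellRel (((Cell.right₂ a β).whiskerRight (left f b')).vcomp (Cell.sigma f g'))
        ((Cell.sigma f g).vcomp (Cell.whiskerLeft (left f b) (Cell.right₂ a' β)))
  -- `Σ` is compatible with identities and composition in each variable
  | sigma_id_left (a : A) {b b' : B} (g : b ⟶ b') :
      CellRel (Cell.sigma (𝟙 a) g)
        (Cell.ofEq (by rw [left_id, left_id, comp_id', id_comp']))
  | sigma_id_right {a a' : A} (f : a ⟶ a') (b : B) :
      CellRel (Cell.sigma f (𝟙 b))
        (Cell.ofEq (by rw [right_id, right_id, comp_id', id_comp']))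
  | sigma_comp_left {a a' a'' : A} {b b' : B} (f : a ⟶ a') (f' : a' ⟶ a'') (g : b ⟶ b') :
      CellRel (Cell.sigma (f ≫ f') g)
        ((Cell.ofEq (by rw [left_comp, assoc'])).vcomp
          (((Cell.sigma f g).whiskerRight (left f' b')).vcomp
            ((Cell.ofEq (assoc' _ _ _)).vcomp
              ((Cell.whiskerLeft (left f b) (Cell.sigma f' g)).vcomp
                (Cell.ofEq (by rw [left_comp, assoc']))))))
  | sigma_comp_right {a a' : A} {b b' b'' : B} (f : a ⟶ a') (g : b ⟶ b') (g' : b' ⟶ b'') :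
      CellRel (Cell.sigma f (g ≫ g'))
        ((Cell.ofEq (by rw [right_comp, assoc'])).vcomp
          ((Cell.whiskerLeft (right a g) (Cell.sigma f g')).vcomp
            ((Cell.ofEq (assoc' _ _ _).symm).vcomp
              (((Cell.sigma f g).whiskerRight (right a' g')).vcomp
                (Cell.ofEq (by rw [right_comp, assoc']))))))

/-- The hom-categories of `A ⊗ B`: 2-cells are formal composites modulo the relations. -/
instance homCategory (x y : GrayTensor A B) : Category (x ⟶ y) where
  Hom p q := Quot (CellRel (p := p) (q := q))
  id p := Quot.mk _ (Cell.id p)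
  comp := Quot.map₂ Cell.vcomp (fun η _ _ h => CellRel.vcomp_right η h)
    (fun _ _ θ h => CellRel.vcomp_left θ h)
  id_comp := by rintro p q ⟨η⟩; exact Quot.sound (CellRel.id_vcomp η)
  comp_id := by rintro p q ⟨η⟩; exact Quot.sound (CellRel.vcomp_id η)
  assoc := by rintro p q r s ⟨η⟩ ⟨θ⟩ ⟨κ⟩; exact Quot.sound (CellRel.vcomp_assoc η θ κ)

theorem eqToHom_eq_ofEq {x y : GrayTensor A B} {p q : x ⟶ y} (h : p = q) :
    eqToHom h = (Quot.mk _ (Cell.ofEq h) : p ⟶ q) := by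
  cases h; rfl

theorem whiskerLeft_eqToHom' {x y z : GrayTensor A B} (p : x ⟶ y) {q q' : y ⟶ z} (h : q = q') :
    Quot.map (Cell.whiskerLeft p) (fun _ _ h => CellRel.whiskerLeft p h) (eqToHom h) =
      eqToHom (congrArg (p ≫ ·) h) := by
  cases h; exact Quot.sound (CellRel.whiskerLeft_id p q)

theorem eqToHom_whiskerRight' {x y z : GrayTensor A B} {p p' : x ⟶ y} (h : p = p') (q : y ⟶ z) :
    Quot.map (fun η => Cell.whiskerRight η q) (fun _ _ h => CellRel.whiskerRight q h)
      (eqToHom h) = eqToHom (congrArg (· ≫ q) h) := by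
  cases h; exact Quot.sound (CellRel.id_whiskerRight p q)

/-- The Gray tensor product `A ⊗ B`. -/
instance : Bicategory (GrayTensor A B) where
  homCategory := homCategory
  whiskerLeft p _ _ := Quot.map (Cell.whiskerLeft p) (fun _ _ h => CellRel.whiskerLeft p h)
  whiskerRight η q :=
    Quot.map (fun η => Cell.whiskerRight η q) (fun _ _ h => CellRel.whiskerRight q h) η
  associator p q r := eqToIso (assoc' p q r)
  leftUnitor p := eqToIso (id_comp' p)
  rightUnitor p := eqToIso (comp_id' p)
  whiskerLeft_id p q := Quot.sound (CellRel.whiskerLeft_id p q)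
  whiskerLeft_comp := by
    rintro x y z p q r s ⟨η⟩ ⟨θ⟩; exact Quot.sound (CellRel.whiskerLeft_vcomp p η θ)
  id_whiskerLeft := by
    rintro x y p q ⟨η⟩
    rw [eqToIso.hom, eqToIso.inv, eqToHom_eq_ofEq, eqToHom_eq_ofEq]
    exact Quot.sound (CellRel.id_whiskerLeft η)
  comp_whiskerLeft := by
    rintro x y z t p q r s ⟨η⟩
    rw [eqToIso.hom, eqToIso.inv, eqToHom_eq_ofEq, eqToHom_eq_ofEq]
    exact Quot.sound (CellRel.comp_whiskerLeft p q η)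
  id_whiskerRight p q := Quot.sound (CellRel.id_whiskerRight p q)
  comp_whiskerRight := by
    rintro x y z p q r ⟨η⟩ ⟨θ⟩ s; exact Quot.sound (CellRel.vcomp_whiskerRight η θ s)
  whiskerRight_id := by
    rintro x y p q ⟨η⟩
    rw [eqToIso.hom, eqToIso.inv, eqToHom_eq_ofEq, eqToHom_eq_ofEq]
    exact Quot.sound (CellRel.whiskerRight_id η)
  whiskerRight_comp := by
    rintro x y z t p q ⟨η⟩ r s
    rw [eqToIso.hom, eqToIso.inv, eqToHom_eq_ofEq, eqToHom_eq_ofEq]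
    exact Quot.sound (CellRel.whiskerRight_comp η r s)
  whisker_assoc := by
    rintro x y z t p q r ⟨η⟩ s
    rw [eqToIso.hom, eqToIso.inv, eqToHom_eq_ofEq, eqToHom_eq_ofEq]
    exact Quot.sound (CellRel.whisker_assoc p η s)
  whisker_exchange := by
    rintro x y z p q r s ⟨η⟩ ⟨θ⟩; exact Quot.sound (CellRel.whisker_exchange η θ)
  pentagon p q r s := by
    simp only [eqToIso.hom]
    rw [whiskerLeft_eqToHom', eqToHom_whiskerRight']
    simp
  triangle p q := by
    simp only [eqToIso.hom]
    rw [whiskerLeft_eqToHom', eqToHom_whiskerRight']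
    simp

instance : Strict (GrayTensor A B) where
  id_comp := id_comp'
  comp_id := comp_id'
  assoc := assoc'
  leftUnitor_eqToIso _ := rfl
  rightUnitor_eqToIso _ := rfl
  associator_eqToIso _ _ _ := rfl

/-- The generating 2-cell `α ⊗ 1 : f ⊗ 1 ⟶ f' ⊗ 1`. -/
def left₂ {a a' : A} {f f' : a ⟶ a'} (α : f ⟶ f') (b : B) : left f b ⟶ left f' b :=
  Quot.mk _ (Cell.left₂ α b)

/-- The generating 2-cell `1 ⊗ β : 1 ⊗ g ⟶ 1 ⊗ g'`. -/
def right₂ (a : A) {b b' : B} {g g' : b ⟶ b'} (β : g ⟶ g') : right a g ⟶ right a g' :=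
  Quot.mk _ (Cell.right₂ a β)

/-- The generating 2-cell `Σ_{f,g}`. -/
def sigma {a a' : A} {b b' : B} (f : a ⟶ a') (g : b ⟶ b') :
    right a g ≫ left f b' ⟶ left f b ≫ right a' g :=
  Quot.mk _ (Cell.sigma f g)

end GrayTensor

/-! ### Strongly monoidal 2-categories -/

/-- A strongly monoidal structure on a 2-category `K` (that is, a monoidal structure in the
`Cat`-enriched sense), whose tensor product is given on objects by `T` and whose unit object
is `I`. -/
structure StronglyMonoidal (K : Type u) [Bicategory.{w, v} K] [Strict K] (T : K → K → K)
    (I : K) where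
  /-- The tensor product on 1-cells. -/
  tensorHom {X X' Y Y' : K} (f : X ⟶ X') (g : Y ⟶ Y') : T X Y ⟶ T X' Y'
  /-- The tensor product on 2-cells. -/
  tensorHom₂ {X X' Y Y' : K} {f f' : X ⟶ X'} {g g' : Y ⟶ Y'} (η : f ⟶ f') (θ : g ⟶ g') :
    tensorHom f g ⟶ tensorHom f' g'
  -- the tensor product is a 2-functor `K × K ⥤ K`
  tensorHom_id (X Y : K) : tensorHom (𝟙 X) (𝟙 Y) = 𝟙 (T X Y)
  tensorHom_comp {X X' X'' Y Y' Y'' : K} (f : X ⟶ X') (f' : X' ⟶ X'') (g : Y ⟶ Y')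
    (g' : Y' ⟶ Y'') : tensorHom (f ≫ f') (g ≫ g') = tensorHom f g ≫ tensorHom f' g'
  tensorHom₂_id {X X' Y Y' : K} (f : X ⟶ X') (g : Y ⟶ Y') :
    tensorHom₂ (𝟙 f) (𝟙 g) = 𝟙 (tensorHom f g)
  tensorHom₂_comp {X X' Y Y' : K} {f f' f'' : X ⟶ X'} {g g' g'' : Y ⟶ Y'} (η : f ⟶ f')
    (η' : f' ⟶ f'') (θ : g ⟶ g') (θ' : g' ⟶ g'') :
    tensorHom₂ (η ≫ η') (θ ≫ θ') = tensorHom₂ η θ ≫ tensorHom₂ η' θ'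
  tensorHom₂_whiskerLeft {X X' X'' Y Y' Y'' : K} (f : X ⟶ X') (g : Y ⟶ Y') {h h' : X' ⟶ X''}
    {k k' : Y' ⟶ Y''} (η : h ⟶ h') (θ : k ⟶ k') :
    tensorHom₂ (f ◁ η) (g ◁ θ) = eqToHom (tensorHom_comp f h g k) ≫
      tensorHom f g ◁ tensorHom₂ η θ ≫ eqToHom (tensorHom_comp f h' g k').symm
  tensorHom₂_whiskerRight {X X' X'' Y Y' Y'' : K} {f f' : X ⟶ X'} {g g' : Y ⟶ Y'} (η : f ⟶ f')
    (θ : g ⟶ g') (h : X' ⟶ X'') (k : Y' ⟶ Y'') :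
    tensorHom₂ (η ▷ h) (θ ▷ k) = eqToHom (tensorHom_comp f h g k) ≫
      tensorHom₂ η θ ▷ tensorHom h k ≫ eqToHom (tensorHom_comp f' h g' k).symm
  -- the associator, a 2-natural isomorphism
  assoc (X Y Z : K) : T (T X Y) Z ⟶ T X (T Y Z)
  assocInv (X Y Z : K) : T X (T Y Z) ⟶ T (T X Y) Z
  assoc_assocInv (X Y Z : K) : assoc X Y Z ≫ assocInv X Y Z = 𝟙 _
  assocInv_assoc (X Y Z : K) : assocInv X Y Z ≫ assoc X Y Z = 𝟙 _
  assoc_naturality {X X' Y Y' Z Z' : K} (f : X ⟶ X') (g : Y ⟶ Y') (h : Z ⟶ Z') :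
    tensorHom (tensorHom f g) h ≫ assoc X' Y' Z' = assoc X Y Z ≫ tensorHom f (tensorHom g h)
  assoc_naturality₂ {X X' Y Y' Z Z' : K} {f f' : X ⟶ X'} {g g' : Y ⟶ Y'} {h h' : Z ⟶ Z'}
    (η : f ⟶ f') (θ : g ⟶ g') (κ : h ⟶ h') :
    tensorHom₂ (tensorHom₂ η θ) κ ▷ assoc X' Y' Z' = eqToHom (assoc_naturality f g h) ≫
      assoc X Y Z ◁ tensorHom₂ η (tensorHom₂ θ κ) ≫ eqToHom (assoc_naturality f' g' h').symm
  -- the unitors, 2-natural isomorphisms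
  leftUnit (X : K) : T I X ⟶ X
  leftUnitInv (X : K) : X ⟶ T I X
  leftUnit_leftUnitInv (X : K) : leftUnit X ≫ leftUnitInv X = 𝟙 _
  leftUnitInv_leftUnit (X : K) : leftUnitInv X ≫ leftUnit X = 𝟙 _
  leftUnit_naturality {X X' : K} (f : X ⟶ X') :
    tensorHom (𝟙 I) f ≫ leftUnit X' = leftUnit X ≫ f
  leftUnit_naturality₂ {X X' : K} {f f' : X ⟶ X'} (η : f ⟶ f') :
    tensorHom₂ (𝟙 (𝟙 I)) η ▷ leftUnit X' = eqToHom (leftUnit_naturality f) ≫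
      leftUnit X ◁ η ≫ eqToHom (leftUnit_naturality f').symm
  rightUnit (X : K) : T X I ⟶ X
  rightUnitInv (X : K) : X ⟶ T X I
  rightUnit_rightUnitInv (X : K) : rightUnit X ≫ rightUnitInv X = 𝟙 _
  rightUnitInv_rightUnit (X : K) : rightUnitInv X ≫ rightUnit X = 𝟙 _
  rightUnit_naturality {X X' : K} (f : X ⟶ X') :
    tensorHom f (𝟙 I) ≫ rightUnit X' = rightUnit X ≫ f
  rightUnit_naturality₂ {X X' : K} {f f' : X ⟶ X'} (η : f ⟶ f') :
    tensorHom₂ η (𝟙 (𝟙 I)) ▷ rightUnit X' = eqToHom (rightUnit_naturality f) ≫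
      rightUnit X ◁ η ≫ eqToHom (rightUnit_naturality f').symm
  -- the axioms of a monoidal category
  pentagon (W X Y Z : K) :
    tensorHom (assoc W X Y) (𝟙 Z) ≫ assoc W (T X Y) Z ≫ tensorHom (𝟙 W) (assoc X Y Z) =
      assoc (T W X) Y Z ≫ assoc W X (T Y Z)
  triangle (X Y : K) :
    assoc X I Y ≫ tensorHom (𝟙 X) (leftUnit Y) = tensorHom (rightUnit X) (𝟙 Y)

/-- The tensor product of a strongly monoidal structure, as a 2-functor `K × K ⥤ K`. -/
def StronglyMonoidal.tensor {K : Type u} [Bicategory.{w, v} K] [Strict K] {T : K → K → K} {I : K}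
    (M : StronglyMonoidal K T I) : TwoFunctor (K × K) K where
  obj X := T X.1 X.2
  map f := M.tensorHom f.1 f.2
  map₂ η := M.tensorHom₂ η.1 η.2
  map₂_id f := M.tensorHom₂_id f.1 f.2
  map₂_comp η θ := M.tensorHom₂_comp η.1 θ.1 η.2 θ.2
  map_id X := M.tensorHom_id X.1 X.2
  map_comp f g := M.tensorHom_comp f.1 g.1 f.2 g.2
  map₂_whisker_left f _ _ η := M.tensorHom₂_whiskerLeft f.1 f.2 η.1 η.2
  map₂_whisker_right η g := M.tensorHom₂_whiskerRight η.1 η.2 g.1 g.2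

/-! ### The data of the Gray monoidal structure

In the following descriptions `HEq` is equality of cells whose boundaries are equal, but not by
definition. -/

namespace GrayIcon

/-- The Gray tensor product of two objects of `Gray_icon`. -/
def tensor (A B : GrayIcon.{u}) : GrayIcon.{u} := ⟨GrayTensor A.carrier B.carrier⟩

/-- The terminal 2-category: one object, one 1-cell, one 2-cell. -/
def unit : GrayIcon.{u} := ⟨LocallyDiscrete (Discrete PUnit.{u + 1})⟩

end GrayIcon

namespace GrayTensor

variable {A : Type u₁} [Bicategory.{w₁, v₁} A] {B : Type u₂} [Bicategory.{w₂, v₂} B]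
  {A' : Type u₃} [Bicategory.{w₃, v₃} A'] {B' : Type u₄} [Bicategory.{w₄, v₄} B']

/-- The 2-functor `H : A ⊗ B ⥤ A' ⊗ B'` is `F ⊗ G`: it is given by `F` and `G` on the generating
cells. -/
structure IsMap (F : TwoFunctor A A') (G : TwoFunctor B B')
    (H : TwoFunctor (GrayTensor A B) (GrayTensor A' B')) : Prop where
  obj (a : A) (b : B) : H.obj ⟨a, b⟩ = ⟨F.obj a, G.obj b⟩
  map_left {a a' : A} (f : a ⟶ a') (b : B) : HEq (H.map (left f b)) (left (F.map f) (G.obj b))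
  map_right (a : A) {b b' : B} (g : b ⟶ b') :
    HEq (H.map (right a g)) (right (F.obj a) (G.map g))
  map₂_left₂ {a a' : A} {f f' : a ⟶ a'} (α : f ⟶ f') (b : B) :
    HEq (H.map₂ (left₂ α b)) (left₂ (F.map₂ α) (G.obj b))
  map₂_right₂ (a : A) {b b' : B} {g g' : b ⟶ b'} (β : g ⟶ g') :
    HEq (H.map₂ (right₂ a β)) (right₂ (F.obj a) (G.map₂ β))
  map₂_sigma {a a' : A} {b b' : B} (f : a ⟶ a') (g : b ⟶ b') :
    HEq (H.map₂ (sigma f g)) (sigma (F.map f) (G.map g))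

/-- The icon `γ` is `α ⊗ β`: its components at the generating 1-cells `f ⊗ 1` and `1 ⊗ g` are
`α_f ⊗ 1` and `1 ⊗ β_g`. -/
structure IsIconMap {F F' : TwoFunctor A A'} {G G' : TwoFunctor B B'}
    {H H' : TwoFunctor (GrayTensor A B) (GrayTensor A' B')} (α : Icon F F') (β : Icon G G')
    (γ : Icon H H') : Prop where
  app_left {a a' : A} (f : a ⟶ a') (b : B) :
    HEq (γ.app (left f b)) (left₂ (α.app f) (G.obj b))
  app_right (a : A) {b b' : B} (g : b ⟶ b') :
    HEq (γ.app (right a g)) (right₂ (F.obj a) (β.app g))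

/-- The 2-functor `H` is the associator `(A ⊗ B) ⊗ C ⥤ A ⊗ (B ⊗ C)`, described on generating
cells. -/
structure IsAssociator {C : Type u₃} [Bicategory.{w₃, v₃} C]
    (H : TwoFunctor (GrayTensor (GrayTensor A B) C) (GrayTensor A (GrayTensor B C))) :
    Prop where
  obj (a : A) (b : B) (c : C) : H.obj ⟨⟨a, b⟩, c⟩ = ⟨a, ⟨b, c⟩⟩
  map_left_left {a a' : A} (f : a ⟶ a') (b : B) (c : C) :
    HEq (H.map (left (left f b) c)) (left f (⟨b, c⟩ : GrayTensor B C))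
  map_left_right (a : A) {b b' : B} (g : b ⟶ b') (c : C) :
    HEq (H.map (left (right a g) c)) (right a (left g c))
  map_right (a : A) (b : B) {c c' : C} (h : c ⟶ c') :
    HEq (H.map (right (⟨a, b⟩ : GrayTensor A B) h)) (right a (right b h))
  map₂_left₂_left₂ {a a' : A} {f f' : a ⟶ a'} (α : f ⟶ f') (b : B) (c : C) :
    HEq (H.map₂ (left₂ (left₂ α b) c)) (left₂ α (⟨b, c⟩ : GrayTensor B C))
  map₂_left₂_right₂ (a : A) {b b' : B} {g g' : b ⟶ b'} (β : g ⟶ g') (c : C) :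
    HEq (H.map₂ (left₂ (right₂ a β) c)) (right₂ a (left₂ β c))
  map₂_right₂ (a : A) (b : B) {c c' : C} {h h' : c ⟶ c'} (γ : h ⟶ h') :
    HEq (H.map₂ (right₂ (⟨a, b⟩ : GrayTensor A B) γ)) (right₂ a (right₂ b γ))
  map₂_left₂_sigma {a a' : A} {b b' : B} (f : a ⟶ a') (g : b ⟶ b') (c : C) :
    HEq (H.map₂ (left₂ (sigma f g) c)) (sigma f (left g c))
  map₂_sigma_left {a a' : A} (f : a ⟶ a') (b : B) {c c' : C} (h : c ⟶ c') :
    HEq (H.map₂ (sigma (left f b) h)) (sigma f (right b h))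
  map₂_sigma_right (a : A) {b b' : B} (g : b ⟶ b') {c c' : C} (h : c ⟶ c') :
    HEq (H.map₂ (sigma (right a g) h)) (right₂ a (sigma g h))

/-- The 2-functor `H : A ⊗ B ⥤ B` is the second projection on generating cells. -/
structure IsLeftUnitor (H : TwoFunctor (GrayTensor A B) B) : Prop where
  obj (a : A) (b : B) : H.obj ⟨a, b⟩ = b
  map_left {a a' : A} (f : a ⟶ a') (b : B) : HEq (H.map (left f b)) (𝟙 b)
  map_right (a : A) {b b' : B} (g : b ⟶ b') : HEq (H.map (right a g)) g
  map₂_right₂ (a : A) {b b' : B} {g g' : b ⟶ b'} (β : g ⟶ g') :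
    HEq (H.map₂ (right₂ a β)) β

/-- The 2-functor `H : A ⊗ B ⥤ A` is the first projection on generating cells. -/
structure IsRightUnitor (H : TwoFunctor (GrayTensor A B) A) : Prop where
  obj (a : A) (b : B) : H.obj ⟨a, b⟩ = a
  map_left {a a' : A} (f : a ⟶ a') (b : B) : HEq (H.map (left f b)) f
  map_right (a : A) {b b' : B} (g : b ⟶ b') : HEq (H.map (right a g)) (𝟙 a)
  map₂_left₂ {a a' : A} {f f' : a ⟶ a'} (α : f ⟶ f') (b : B) :
    HEq (H.map₂ (left₂ α b)) α

end GrayTensor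

-- The Gray tensor product is presented by generators and relations. Hence a 2-functor out of `A ⊗
-- B` amounts to images of the generating cells that respect the relations (`GrayData.lift`), and
-- two such 2-functors coincide once they agree on generators (`functor_ext`). Icons obey the same
-- two principles (`exists_icon`, `icon_ext`). All the data are built by the first principle and all
-- the axioms are checked by the second. For `F ⊗ G`, the symmetry and the projections this is
-- immediate.
--
-- The substance is the associator. To map out of `(A ⊗ B) ⊗ C` one needs an image of `Σ_{p,h}` for
-- every 1-cell `p` of `A ⊗ B`, while the description only prescribes it for `p = f ⊗ 1` (as
-- `Σ_{f,1⊗h}`) and `p = 1 ⊗ g` (as `1 ⊗ Σ_{g,h}`). For fixed `h` the required family is a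
-- pseudonatural transformation from `A ⊗ (- ⊗ c)` to `A ⊗ (- ⊗ c')`. By
-- `PseudoNat.exists_of_generators`, such a transformation can be assembled from its restrictions to
-- `A` and to `B`, extended to composites by pasting squares; the one remaining condition is
-- naturality at `Σ_{f,g}`. That condition is a hexagon of Yang–Baxter type (`sigma_pasteH_sigma`),
-- and it is exactly naturality of `Σ_{f,-}` with respect to the 2-cell `Σ_{g,h}`. Functoriality and
-- naturality in `h` are again checked on generating `p`.
--
-- The inverse of the associator needs no second construction. The symmetry `A ⊗ B ≅ B ⊗ A`, which
-- inverts `Σ`, reverses the order of three factors, and conjugating the associator by this reversal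
-- gives its inverse (`assoc_reverse_assoc_reverse`). Naturality, pentagon and triangle are compared
-- on the generators of iterated tensor products by `functor_ext₃` and `functor_ext₄`.
--
-- For icons `α` and `β`, the components `α_f ⊗ 1` and `1 ⊗ β_g` extend multiplicatively to all
-- 1-cells; compatibility with `Σ` is its naturality in both variables together with interchange
-- (`sigma_mulCell`).
--
-- Many boundaries agree only propositionally, so cells are compared by `HEq`, and `eqToHom`
-- conjugates are reinstated only where a statement requires them.

universe w₅ w₆ v₅ v₆ u₅ u₆

/-! ### Heterogeneous equality of cells -/

section HEqCells

variable {C : Type u} [Bicategory.{w, v} C]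

theorem comp_heq_comp {x x' y y' z z' : C} (hx : x = x') (hy : y = y') (hz : z = z')
    {f : x ⟶ y} {f' : x' ⟶ y'} {g : y ⟶ z} {g' : y' ⟶ z'} (hf : HEq f f') (hg : HEq g g') :
    HEq (f ≫ g) (f' ≫ g') := by
  subst hx hy hz; cases hf; cases hg; rfl

theorem id_heq_id {x x' : C} (hx : x = x') : HEq (𝟙 x) (𝟙 x') := by
  subst hx; rfl

theorem id₂_heq_id₂ {x x' y y' : C} (hx : x = x') (hy : y = y') {f : x ⟶ y} {f' : x' ⟶ y'}
    (hf : HEq f f') : HEq (𝟙 f) (𝟙 f') := by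
  subst hx hy; cases hf; rfl

theorem vcomp_heq_vcomp {x x' y y' : C} (hx : x = x') (hy : y = y') {f g h : x ⟶ y}
    {f' g' h' : x' ⟶ y'} (hf : HEq f f') (hg : HEq g g') (hh : HEq h h') {η : f ⟶ g}
    {η' : f' ⟶ g'} {θ : g ⟶ h} {θ' : g' ⟶ h'} (hη : HEq η η') (hθ : HEq θ θ') :
    HEq (η ≫ θ) (η' ≫ θ') := by
  subst hx hy; cases hf; cases hg; cases hh; cases hη; cases hθ; rfl

theorem whiskerLeft_heq_whiskerLeft {x x' y y' z z' : C} (hx : x = x') (hy : y = y')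
    (hz : z = z') {f : x ⟶ y} {f' : x' ⟶ y'} {g h : y ⟶ z} {g' h' : y' ⟶ z'} (hf : HEq f f')
    (hg : HEq g g') (hh : HEq h h') {η : g ⟶ h} {η' : g' ⟶ h'} (hη : HEq η η') :
    HEq (f ◁ η) (f' ◁ η') := by
  subst hx hy hz; cases hf; cases hg; cases hh; cases hη; rfl

theorem whiskerRight_heq_whiskerRight {x x' y y' z z' : C} (hx : x = x') (hy : y = y')
    (hz : z = z') {f g : x ⟶ y} {f' g' : x' ⟶ y'} {h : y ⟶ z} {h' : y' ⟶ z'} (hf : HEq f f')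
    (hg : HEq g g') (hh : HEq h h') {η : f ⟶ g} {η' : f' ⟶ g'} (hη : HEq η η') :
    HEq (η ▷ h) (η' ▷ h') := by
  subst hx hy hz; cases hf; cases hg; cases hh; cases hη; rfl

/-- Uniqueness of inverses, across a change of boundary. It spares a separate check at `Σ⁻¹`
whenever two assignments are known to agree at `Σ`. -/
theorem inverse_heq_inverse {x x' y y' : C} (hx : x = x') (hy : y = y') {f g : x ⟶ y}
    {f' g' : x' ⟶ y'} (hf : HEq f f') (hg : HEq g g') {η : f ⟶ g} {η' : f' ⟶ g'}
    {θ : g ⟶ f} {θ' : g' ⟶ f'} (h : θ ≫ η = 𝟙 g) (h' : η' ≫ θ' = 𝟙 f') (hη : HEq η η') :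
    HEq θ θ' := by
  subst hx hy; cases hf; cases hg; cases hη
  exact heq_of_eq (eq_of_comp_right_eq_id h h')
where
  eq_of_comp_right_eq_id {x y : C} {f g : x ⟶ y} {η : f ⟶ g} {θ θ' : g ⟶ f}
      (h : θ ≫ η = 𝟙 g) (h' : η ≫ θ' = 𝟙 f) : θ = θ' := by
    rw [← Category.comp_id θ, ← h', ← Category.assoc, h, Category.id_comp]

theorem eqToHom_conj_heq {K : Type u} [Category.{v} K] {X X' Y Y' : K} (h : X = X') (f : X' ⟶ Y')
    (h' : Y' = Y) : HEq (eqToHom h ≫ f ≫ eqToHom h') f := by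
  subst h h'; simp

/-- The passage back from `HEq` to the `eqToHom`-conjugated equations in which the monoidal axioms
and the relations of `⊗` are phrased. -/
theorem eq_eqToHom_conj_of_heq {K : Type u} [Category.{v} K] {X X' Y Y' : K} (h : X = X')
    (h' : Y' = Y) {f : X ⟶ Y} {g : X' ⟶ Y'} (hfg : HEq f g) :
    f = eqToHom h ≫ g ≫ eqToHom h' := by
  subst h h'; simpa using hfg

theorem eqToHom_heq_eqToHom {x x' y y' : C} (hx : x = x') (hy : y = y') {f g : x ⟶ y}
    {f' g' : x' ⟶ y'} (h : f = g) (h' : f' = g') (hf : HEq f f') :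
    HEq (eqToHom h) (eqToHom h') := by
  subst hx hy h h'; cases hf; rfl

end HEqCells

namespace TwoFunctor

variable {A : Type u₁} [Bicategory.{w₁, v₁} A] {B : Type u₂} [Bicategory.{w₂, v₂} B]

/-- The three layers are replaced in order: only after the object maps are identified do the two
1-cell maps have the same type, and likewise for 2-cells. -/
theorem ext_heq {F G : TwoFunctor A B} (hobj : ∀ a, F.obj a = G.obj a)
    (hmap : ∀ {a b : A} (f : a ⟶ b), HEq (F.map f) (G.map f))
    (hmap₂ : ∀ {a b : A} {f g : a ⟶ b} (η : f ⟶ g), HEq (F.map₂ η) (G.map₂ η)) : F = G := by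
  obtain ⟨⟨⟨⟨o, m⟩, m₂⟩, _, _⟩, _, _, _, _⟩ := F
  obtain ⟨⟨⟨⟨o', m'⟩, m₂'⟩, _, _⟩, _, _, _, _⟩ := G
  obtain rfl : o = o' := funext hobj
  obtain rfl : @m = @m' := by
    funext a b f; exact eq_of_heq (hmap f)
  obtain rfl : @m₂ = @m₂' := by
    funext a b f g η; exact eq_of_heq (hmap₂ η)
  rfl

theorem congr_obj {F G : TwoFunctor A B} (h : F = G) (a : A) : F.obj a = G.obj a := by
  rw [h]

theorem congr_map {F G : TwoFunctor A B} (h : F = G) {a b : A} (f : a ⟶ b) :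
    HEq (F.map f) (G.map f) := by
  rw [h]

theorem congr_map₂ {F G : TwoFunctor A B} (h : F = G) {a b : A} {f g : a ⟶ b} (η : f ⟶ g) :
    HEq (F.map₂ η) (G.map₂ η) := by
  rw [h]

theorem map₂_heq (F : TwoFunctor A B) {a a' b b' : A} (ha : a = a') (hb : b = b') {f g : a ⟶ b}
    {f' g' : a' ⟶ b'} (hf : HEq f f') (hg : HEq g g') {η : f ⟶ g} {η' : f' ⟶ g'}
    (hη : HEq η η') : HEq (F.map₂ η) (F.map₂ η') := by
  subst ha hb; cases hf; cases hg; cases hη; rfl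

theorem map₂_whiskerLeft_heq (F : TwoFunctor A B) {a b c : A} (f : a ⟶ b) {g g' : b ⟶ c}
    (η : g ⟶ g') : HEq (F.map₂ (f ◁ η)) (F.map f ◁ F.map₂ η) := by
  rw [F.map₂_whisker_left]; exact eqToHom_conj_heq _ _ _

theorem map₂_whiskerRight_heq (F : TwoFunctor A B) {a b c : A} {f f' : a ⟶ b} (η : f ⟶ f')
    (g : b ⟶ c) : HEq (F.map₂ (η ▷ g)) (F.map₂ η ▷ F.map g) := by
  rw [F.map₂_whisker_right]; exact eqToHom_conj_heq _ _ _

end TwoFunctor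

namespace GrayTensor

variable {A : Type u₁} [Bicategory.{w₁, v₁} A] {B : Type u₂} [Bicategory.{w₂, v₂} B]
  {D : Type u₃} [Bicategory.{w₃, v₃} D]

/-! ### Induction on 1-cells and 2-cells of the Gray tensor product -/

/-- The inverse of the generating 2-cell `Σ_{f,g}`. -/
def sigmaInv {a a' : A} {b b' : B} (f : a ⟶ a') (g : b ⟶ b') :
    left f b ≫ right a' g ⟶ right a g ≫ left f b' :=
  Quot.mk _ (Cell.sigmaInv f g)

theorem sigma_sigmaInv {a a' : A} {b b' : B} (f : a ⟶ a') (g : b ⟶ b') :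
    sigma f g ≫ sigmaInv f g = 𝟙 _ := Quot.sound (CellRel.sigma_sigmaInv f g)

theorem sigmaInv_sigma {a a' : A} {b b' : B} (f : a ⟶ a') (g : b ⟶ b') :
    sigmaInv f g ≫ sigma f g = 𝟙 _ := Quot.sound (CellRel.sigmaInv_sigma f g)

/-- The generating 2-cell `Σ_{f,g}`, as an isomorphism. -/
@[simps]
def sigmaIso {a a' : A} {b b' : B} (f : a ⟶ a') (g : b ⟶ b') :
    right a g ≫ left f b' ≅ left f b ≫ right a' g where
  hom := sigma f g
  inv := sigmaInv f g
  hom_inv_id := sigma_sigmaInv f g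
  inv_hom_id := sigmaInv_sigma f g

theorem hom_induction {motive : ∀ {x y : GrayTensor A B}, (x ⟶ y) → Prop}
    (left : ∀ {a a' : A} (f : a ⟶ a') (b : B), motive (left f b))
    (right : ∀ (a : A) {b b' : B} (g : b ⟶ b'), motive (right a g))
    (id : ∀ x : GrayTensor A B, motive (𝟙 x))
    (comp : ∀ {x y z : GrayTensor A B} (p : x ⟶ y) (q : y ⟶ z), motive p → motive q →
      motive (p ≫ q)) {x y : GrayTensor A B} (p : x ⟶ y) : motive p := by
  induction p using Quot.ind with
  | mk p =>
    induction p with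
    | left f b => exact left f b
    | right a g => exact right a g
    | id x => exact id x
    | comp p q hp hq => exact comp _ _ hp hq

theorem hom₂_induction
    {motive : ∀ {x y : GrayTensor A B} {p q : x ⟶ y}, (p ⟶ q) → Prop}
    (left₂ : ∀ {a a' : A} {f f' : a ⟶ a'} (α : f ⟶ f') (b : B), motive (left₂ α b))
    (right₂ : ∀ (a : A) {b b' : B} {g g' : b ⟶ b'} (β : g ⟶ g'), motive (right₂ a β))
    (sigma : ∀ {a a' : A} {b b' : B} (f : a ⟶ a') (g : b ⟶ b'), motive (sigma f g))
    (sigmaInv : ∀ {a a' : A} {b b' : B} (f : a ⟶ a') (g : b ⟶ b'), motive (sigmaInv f g))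
    (id : ∀ {x y : GrayTensor A B} (p : x ⟶ y), motive (𝟙 p))
    (vcomp : ∀ {x y : GrayTensor A B} {p q r : x ⟶ y} (η : p ⟶ q) (θ : q ⟶ r), motive η →
      motive θ → motive (η ≫ θ))
    (whiskerLeft : ∀ {x y z : GrayTensor A B} (p : x ⟶ y) {q q' : y ⟶ z} (η : q ⟶ q'),
      motive η → motive (p ◁ η))
    (whiskerRight : ∀ {x y z : GrayTensor A B} {p p' : x ⟶ y} (η : p ⟶ p') (q : y ⟶ z),
      motive η → motive (η ▷ q)) {x y : GrayTensor A B} {p q : x ⟶ y} (η : p ⟶ q) :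
    motive η := by
  induction η using Quot.ind with
  | mk η =>
    induction η with
    | left₂ α b => exact left₂ α b
    | right₂ a β => exact right₂ a β
    | sigma f g => exact sigma f g
    | sigmaInv f g => exact sigmaInv f g
    | id p => exact id p
    | vcomp η θ hη hθ => exact vcomp _ _ hη hθ
    | whiskerLeft p η h => exact whiskerLeft p _ h
    | whiskerRight η q h => exact whiskerRight _ q h

/-- A choice of elements `s p : M p` for all 1-cells `p` of `A ⊗ B`, compatible with identities
and composition, is determined by its values on generators. -/
theorem exists_section {M : ∀ {x y : GrayTensor A B}, (x ⟶ y) → Type w}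
    (one : ∀ x, M (𝟙 x))
    (mul : ∀ {x y z : GrayTensor A B} {p : x ⟶ y} {q : y ⟶ z}, M p → M q → M (p ≫ q))
    (one_mul : ∀ {x y : GrayTensor A B} {p : x ⟶ y} (m : M p), HEq (mul (one x) m) m)
    (mul_one : ∀ {x y : GrayTensor A B} {p : x ⟶ y} (m : M p), HEq (mul m (one y)) m)
    (mul_assoc : ∀ {x y z t : GrayTensor A B} {p : x ⟶ y} {q : y ⟶ z} {r : z ⟶ t}
      (m : M p) (n : M q) (o : M r), HEq (mul (mul m n) o) (mul m (mul n o)))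
    (l : ∀ {a a' : A} (f : a ⟶ a') (b : B), M (left f b))
    (r : ∀ (a : A) {b b' : B} (g : b ⟶ b'), M (right a g))
    (l_id : ∀ (a : A) (b : B), HEq (l (𝟙 a) b) (one ⟨a, b⟩))
    (l_comp : ∀ {a a' a'' : A} (f : a ⟶ a') (f' : a' ⟶ a'') (b : B),
      HEq (l (f ≫ f') b) (mul (l f b) (l f' b)))
    (r_id : ∀ (a : A) (b : B), HEq (r a (𝟙 b)) (one ⟨a, b⟩))
    (r_comp : ∀ (a : A) {b b' b'' : B} (g : b ⟶ b') (g' : b' ⟶ b''),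
      HEq (r a (g ≫ g')) (mul (r a g) (r a g'))) :
    ∃ s : ∀ {x y : GrayTensor A B} (p : x ⟶ y), M p, (∀ x, s (𝟙 x) = one x) ∧
      (∀ {x y z : GrayTensor A B} (p : x ⟶ y) (q : y ⟶ z), s (p ≫ q) = mul (s p) (s q)) ∧
      (∀ {a a' : A} (f : a ⟶ a') (b : B), s (left f b) = l f b) ∧
      (∀ (a : A) {b b' : B} (g : b ⟶ b'), s (right a g) = r a g) := by
  -- The section is first defined on formal words by recursion. Related words give values in
  -- different types `M (Quot.mk _ p)`, so compatibility with the relations is a heterogeneous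
  -- equality, and `Quot.hrecOn` performs the descent.
  let t : ∀ {x y : GrayTensor A B} (p : Word x y), M (Quot.mk _ p : x ⟶ y) := fun p =>
    Word.rec (motive := fun x y p => M (Quot.mk _ p : x ⟶ y)) (fun f b => l f b)
      (fun a _ _ g => r a g) (fun x => one x) (fun _ _ m n => mul m n) p
  have mul_congr {x y z : GrayTensor A B} {p p' : x ⟶ y} {q q' : y ⟶ z} (hp : p = p')
      (hq : q = q') {m : M p} {m' : M p'} {n : M q} {n' : M q'} (hm : HEq m m')
      (hn : HEq n n') : HEq (mul m n) (mul m' n') := by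
    subst hp hq; cases hm; cases hn; rfl
  have ht {x y : GrayTensor A B} {p q : Word x y} (h : WordRel p q) : HEq (t p) (t q) := by
    induction h with
    | comp_right p h ih => exact mul_congr rfl (Quot.sound h) HEq.rfl ih
    | comp_left q h ih => exact mul_congr (Quot.sound h) rfl ih HEq.rfl
    | id_comp p => exact one_mul _
    | comp_id p => exact mul_one _
    | assoc p q r => exact mul_assoc _ _ _
    | left_id a b => exact l_id a b
    | left_comp f f' b => exact l_comp f f' b
    | right_id a b => exact r_id a b
    | right_comp a g g' => exact r_comp a g g'
  refine ⟨fun p => Quot.hrecOn p (fun p => t p) fun p q h => ht h, fun x => rfl, ?_,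
    fun f b => rfl, fun a _ _ g => rfl⟩
  intro x y z p q
  induction p using Quot.ind with
  | mk p =>
  induction q using Quot.ind with
  | mk q => rfl

/-! ### Equality of 2-functors out of the Gray tensor product -/

theorem map_heq_of_generators {H H' : TwoFunctor (GrayTensor A B) D}
    (hobj : ∀ x, H.obj x = H'.obj x)
    (hl : ∀ {a a' : A} (f : a ⟶ a') (b : B), HEq (H.map (left f b)) (H'.map (left f b)))
    (hr : ∀ (a : A) {b b' : B} (g : b ⟶ b'), HEq (H.map (right a g)) (H'.map (right a g)))
    {x y : GrayTensor A B} (p : x ⟶ y) : HEq (H.map p) (H'.map p) := by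
  induction p using hom_induction with
  | left f b => exact hl f b
  | right a g => exact hr a g
  | id x => rw [H.map_id, H'.map_id]; exact id_heq_id (hobj x)
  | comp p q hp hq =>
    rw [H.map_comp, H'.map_comp]
    exact comp_heq_comp (hobj _) (hobj _) (hobj _) hp hq

theorem map₂_heq_of_generators {H H' : TwoFunctor (GrayTensor A B) D}
    (hobj : ∀ x, H.obj x = H'.obj x)
    (hmap : ∀ {x y : GrayTensor A B} (p : x ⟶ y), HEq (H.map p) (H'.map p))
    (hl : ∀ {a a' : A} {f f' : a ⟶ a'} (α : f ⟶ f') (b : B),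
      HEq (H.map₂ (left₂ α b)) (H'.map₂ (left₂ α b)))
    (hr : ∀ (a : A) {b b' : B} {g g' : b ⟶ b'} (β : g ⟶ g'),
      HEq (H.map₂ (right₂ a β)) (H'.map₂ (right₂ a β)))
    (hs : ∀ {a a' : A} {b b' : B} (f : a ⟶ a') (g : b ⟶ b'),
      HEq (H.map₂ (sigma f g)) (H'.map₂ (sigma f g)))
    {x y : GrayTensor A B} {p q : x ⟶ y} (η : p ⟶ q) : HEq (H.map₂ η) (H'.map₂ η) := by
  induction η using hom₂_induction with
  | left₂ α b => exact hl α b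
  | right₂ a β => exact hr a β
  | sigma f g => exact hs f g
  | sigmaInv f g =>
    -- 2-functors preserve inverses, so agreement at `Σ` forces agreement at `Σ⁻¹`.
    refine inverse_heq_inverse (hobj _) (hobj _) (hmap _) (hmap _) ?_ ?_ (hs f g)
    · rw [← H.map₂_comp, sigmaInv_sigma, H.map₂_id]
    · rw [← H'.map₂_comp, sigma_sigmaInv, H'.map₂_id]
  | id p => rw [H.map₂_id, H'.map₂_id]; exact id₂_heq_id₂ (hobj _) (hobj _) (hmap _)
  | vcomp η θ hη hθ =>
    rw [H.map₂_comp, H'.map₂_comp]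
    exact vcomp_heq_vcomp (hobj _) (hobj _) (hmap _) (hmap _) (hmap _) hη hθ
  | whiskerLeft p η h =>
    exact (H.map₂_whiskerLeft_heq p η).trans ((whiskerLeft_heq_whiskerLeft (hobj _) (hobj _)
      (hobj _) (hmap _) (hmap _) (hmap _) h).trans (H'.map₂_whiskerLeft_heq p η).symm)
  | whiskerRight η q h =>
    exact (H.map₂_whiskerRight_heq η q).trans ((whiskerRight_heq_whiskerRight (hobj _) (hobj _)
      (hobj _) (hmap _) (hmap _) (hmap _) h).trans (H'.map₂_whiskerRight_heq η q).symm)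

/-- The 2-functor `- ⊗ b`. -/
def leftFunctor (A : Type u₁) [Bicategory.{w₁, v₁} A] (b : B) :
    TwoFunctor A (GrayTensor A B) where
  obj a := ⟨a, b⟩
  map f := left f b
  map₂ α := left₂ α b
  map₂_id f := Quot.sound (CellRel.left₂_id f b)
  map₂_comp α α' := Quot.sound (CellRel.left₂_comp α α' b)
  map_id a := left_id a b
  map_comp f f' := left_comp f f' b
  map₂_whisker_left f _ _ α := by
    rw [eqToHom_eq_ofEq, eqToHom_eq_ofEq]; exact Quot.sound (CellRel.left₂_whiskerLeft f α b)
  map₂_whisker_right α h := by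
    rw [eqToHom_eq_ofEq, eqToHom_eq_ofEq]; exact Quot.sound (CellRel.left₂_whiskerRight α h b)

/-- The 2-functor `a ⊗ -`. -/
def rightFunctor (a : A) (B : Type u₂) [Bicategory.{w₂, v₂} B] :
    TwoFunctor B (GrayTensor A B) where
  obj b := ⟨a, b⟩
  map g := right a g
  map₂ β := right₂ a β
  map₂_id g := Quot.sound (CellRel.right₂_id a g)
  map₂_comp β β' := Quot.sound (CellRel.right₂_comp a β β')
  map_id b := right_id a b
  map_comp g g' := right_comp a g g'
  map₂_whisker_left g _ _ β := by
    rw [eqToHom_eq_ofEq, eqToHom_eq_ofEq]; exact Quot.sound (CellRel.right₂_whiskerLeft a g β)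
  map₂_whisker_right β h := by
    rw [eqToHom_eq_ofEq, eqToHom_eq_ofEq]; exact Quot.sound (CellRel.right₂_whiskerRight a β h)

/-- Restricting along `- ⊗ b` and `a ⊗ -` packages agreement on objects and on all generators other
than `Σ`. In most applications the two restrictions are definitionally equal, because
`GrayData.lift` computes on generators. -/
theorem functor_ext {H H' : TwoFunctor (GrayTensor A B) D}
    (hl : ∀ b, (leftFunctor A b).comp H = (leftFunctor A b).comp H')
    (hr : ∀ a, (rightFunctor a B).comp H = (rightFunctor a B).comp H')
    (hs : ∀ {a a' : A} {b b' : B} (f : a ⟶ a') (g : b ⟶ b'),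
      HEq (H.map₂ (sigma f g)) (H'.map₂ (sigma f g))) : H = H' := by
  have hobj (x : GrayTensor A B) : H.obj x = H'.obj x := TwoFunctor.congr_obj (hl x.2) x.1
  have hmap {x y : GrayTensor A B} (p : x ⟶ y) : HEq (H.map p) (H'.map p) :=
    map_heq_of_generators hobj (fun f b => TwoFunctor.congr_map (hl b) f)
      (fun a _ _ g => TwoFunctor.congr_map (hr a) g) p
  exact TwoFunctor.ext_heq hobj hmap (map₂_heq_of_generators hobj hmap
    (fun α b => TwoFunctor.congr_map₂ (hl b) α) (fun a _ _ _ _ β => TwoFunctor.congr_map₂ (hr a) β)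
    hs)

/-! ### The relations satisfied by `Σ` -/

theorem sigma_natural_left {a a' : A} {b b' : B} {f f' : a ⟶ a'} (α : f ⟶ f') (g : b ⟶ b') :
    right a g ◁ left₂ α b' ≫ sigma f' g = sigma f g ≫ left₂ α b ▷ right a' g :=
  Quot.sound (CellRel.sigma_natural_left α g)

theorem sigma_natural_right {a a' : A} {b b' : B} (f : a ⟶ a') {g g' : b ⟶ b'} (β : g ⟶ g') :
    right₂ a β ▷ left f b' ≫ sigma f g' = sigma f g ≫ left f b ◁ right₂ a' β :=
  Quot.sound (CellRel.sigma_natural_right f β)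

theorem sigma_id_left (a : A) {b b' : B} (g : b ⟶ b') :
    sigma (𝟙 a) g = eqToHom (by rw [left_id, left_id, comp_id', id_comp']) := by
  rw [eqToHom_eq_ofEq]; exact Quot.sound (CellRel.sigma_id_left a g)

theorem sigma_id_right {a a' : A} (f : a ⟶ a') (b : B) :
    sigma f (𝟙 b) = eqToHom (by rw [right_id, right_id, comp_id', id_comp']) := by
  rw [eqToHom_eq_ofEq]; exact Quot.sound (CellRel.sigma_id_right f b)

theorem sigma_comp_left {a a' a'' : A} {b b' : B} (f : a ⟶ a') (f' : a' ⟶ a'') (g : b ⟶ b') :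
    sigma (f ≫ f') g = eqToHom (by rw [left_comp, assoc']) ≫ sigma f g ▷ left f' b' ≫
      eqToHom (assoc' _ _ _) ≫ left f b ◁ sigma f' g ≫
        eqToHom (by rw [left_comp, assoc']) := by
  rw [eqToHom_eq_ofEq, eqToHom_eq_ofEq, eqToHom_eq_ofEq]
  exact Quot.sound (CellRel.sigma_comp_left f f' g)

theorem sigma_comp_right {a a' : A} {b b' b'' : B} (f : a ⟶ a') (g : b ⟶ b') (g' : b' ⟶ b'') :
    sigma f (g ≫ g') = eqToHom (by rw [right_comp, assoc']) ≫ right a g ◁ sigma f g' ≫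
      eqToHom (assoc' _ _ _).symm ≫ sigma f g ▷ right a' g' ≫
        eqToHom (by rw [right_comp, assoc']) := by
  rw [eqToHom_eq_ofEq, eqToHom_eq_ofEq, eqToHom_eq_ofEq]
  exact Quot.sound (CellRel.sigma_comp_right f g g')

end GrayTensor

/-! ### Whiskering in a strict 2-category, up to heterogeneous equality -/

section StrictHEq

variable {C : Type u} [Bicategory.{w, v} C] [Strict C]

/-- In a strict 2-category the unitors and associators are `eqToHom`s, so the whiskering laws lose
their coherence cells up to `HEq`. This and the next four lemmas record that. -/
theorem id_whiskerLeft_heq {x y : C} {f g : x ⟶ y} (η : f ⟶ g) : HEq (𝟙 x ◁ η) η := by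
  rw [id_whiskerLeft, Strict.leftUnitor_eqToIso, Strict.leftUnitor_eqToIso]
  simp only [eqToIso.hom, eqToIso.inv]
  exact eqToHom_conj_heq _ _ _

theorem whiskerRight_id_heq {x y : C} {f g : x ⟶ y} (η : f ⟶ g) : HEq (η ▷ 𝟙 y) η := by
  rw [whiskerRight_id, Strict.rightUnitor_eqToIso, Strict.rightUnitor_eqToIso]
  simp only [eqToIso.hom, eqToIso.inv]
  exact eqToHom_conj_heq _ _ _

theorem comp_whiskerLeft_heq {x y z t : C} (f : x ⟶ y) (g : y ⟶ z) {h k : z ⟶ t} (η : h ⟶ k) :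
    HEq ((f ≫ g) ◁ η) (f ◁ g ◁ η) := by
  rw [comp_whiskerLeft, Strict.associator_eqToIso, Strict.associator_eqToIso]
  simp only [eqToIso.hom, eqToIso.inv]
  exact eqToHom_conj_heq _ _ _

theorem whiskerRight_comp_heq {x y z t : C} {f g : x ⟶ y} (η : f ⟶ g) (h : y ⟶ z) (k : z ⟶ t) :
    HEq (η ▷ (h ≫ k)) ((η ▷ h) ▷ k) := by
  rw [whiskerRight_comp, Strict.associator_eqToIso, Strict.associator_eqToIso]
  simp only [eqToIso.hom, eqToIso.inv]
  exact eqToHom_conj_heq _ _ _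

theorem whisker_assoc_heq {x y z t : C} (f : x ⟶ y) {g h : y ⟶ z} (η : g ⟶ h) (k : z ⟶ t) :
    HEq ((f ◁ η) ▷ k) (f ◁ η ▷ k) := by
  rw [whisker_assoc, Strict.associator_eqToIso, Strict.associator_eqToIso]
  simp only [eqToIso.hom, eqToIso.inv]
  exact eqToHom_conj_heq _ _ _

end StrictHEq

section CastComp

variable {K : Type u} [Category.{v} K]

theorem comp_eqToHom_heq_self {X Y Z : K} (f : X ⟶ Y) (h : Y = Z) : HEq (f ≫ eqToHom h) f := by
  subst h; simp

end CastComp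

/-! ### The universal property of the Gray tensor product -/

/-- The data of a 2-functor `A ⊗ B ⥤ D` on generating cells. -/
structure GrayData (A : Type u₁) [Bicategory.{w₁, v₁} A] (B : Type u₂) [Bicategory.{w₂, v₂} B]
    (D : Type u₃) [Bicategory.{w₃, v₃} D] where
  obj : A → B → D
  left {a a' : A} (f : a ⟶ a') (b : B) : obj a b ⟶ obj a' b
  right (a : A) {b b' : B} (g : b ⟶ b') : obj a b ⟶ obj a b'
  left₂ {a a' : A} {f f' : a ⟶ a'} (α : f ⟶ f') (b : B) : left f b ⟶ left f' b
  right₂ (a : A) {b b' : B} {g g' : b ⟶ b'} (β : g ⟶ g') : right a g ⟶ right a g'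
  sigma {a a' : A} {b b' : B} (f : a ⟶ a') (g : b ⟶ b') :
    right a g ≫ left f b' ≅ left f b ≫ right a' g
  left_id (a : A) (b : B) : left (𝟙 a) b = 𝟙 (obj a b)
  left_comp {a a' a'' : A} (f : a ⟶ a') (f' : a' ⟶ a'') (b : B) :
    left (f ≫ f') b = left f b ≫ left f' b
  right_id (a : A) (b : B) : right a (𝟙 b) = 𝟙 (obj a b)
  right_comp (a : A) {b b' b'' : B} (g : b ⟶ b') (g' : b' ⟶ b'') :
    right a (g ≫ g') = right a g ≫ right a g'
  left₂_id {a a' : A} (f : a ⟶ a') (b : B) : left₂ (𝟙 f) b = 𝟙 (left f b)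
  left₂_comp {a a' : A} {f f' f'' : a ⟶ a'} (α : f ⟶ f') (α' : f' ⟶ f'') (b : B) :
    left₂ (α ≫ α') b = left₂ α b ≫ left₂ α' b
  left₂_whiskerLeft {a a' a'' : A} (f : a ⟶ a') {h h' : a' ⟶ a''} (α : h ⟶ h') (b : B) :
    HEq (left₂ (f ◁ α) b) (left f b ◁ left₂ α b)
  left₂_whiskerRight {a a' a'' : A} {f f' : a ⟶ a'} (α : f ⟶ f') (h : a' ⟶ a'') (b : B) :
    HEq (left₂ (α ▷ h) b) (left₂ α b ▷ left h b)
  right₂_id (a : A) {b b' : B} (g : b ⟶ b') : right₂ a (𝟙 g) = 𝟙 (right a g)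
  right₂_comp (a : A) {b b' : B} {g g' g'' : b ⟶ b'} (β : g ⟶ g') (β' : g' ⟶ g'') :
    right₂ a (β ≫ β') = right₂ a β ≫ right₂ a β'
  right₂_whiskerLeft (a : A) {b b' b'' : B} (g : b ⟶ b') {h h' : b' ⟶ b''} (β : h ⟶ h') :
    HEq (right₂ a (g ◁ β)) (right a g ◁ right₂ a β)
  right₂_whiskerRight (a : A) {b b' b'' : B} {g g' : b ⟶ b'} (β : g ⟶ g') (h : b' ⟶ b'') :
    HEq (right₂ a (β ▷ h)) (right₂ a β ▷ right a h)
  sigma_natural_left {a a' : A} {b b' : B} {f f' : a ⟶ a'} (α : f ⟶ f') (g : b ⟶ b') :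
    right a g ◁ left₂ α b' ≫ (sigma f' g).hom = (sigma f g).hom ≫ left₂ α b ▷ right a' g
  sigma_natural_right {a a' : A} {b b' : B} (f : a ⟶ a') {g g' : b ⟶ b'} (β : g ⟶ g') :
    right₂ a β ▷ left f b' ≫ (sigma f g').hom = (sigma f g).hom ≫ left f b ◁ right₂ a' β
  sigma_id_left (a : A) {b b' : B} (g : b ⟶ b') :
    HEq (sigma (𝟙 a) g).hom (𝟙 (right a g))
  sigma_id_right {a a' : A} (f : a ⟶ a') (b : B) :
    HEq (sigma f (𝟙 b)).hom (𝟙 (left f b))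
  sigma_comp_left {a a' a'' : A} {b b' : B} (f : a ⟶ a') (f' : a' ⟶ a'') (g : b ⟶ b') :
    HEq (sigma (f ≫ f') g).hom
      ((sigma f g).hom ▷ left f' b' ≫ (α_ _ _ _).hom ≫ left f b ◁ (sigma f' g).hom)
  sigma_comp_right {a a' : A} {b b' b'' : B} (f : a ⟶ a') (g : b ⟶ b') (g' : b' ⟶ b'') :
    HEq (sigma f (g ≫ g')).hom
      (right a g ◁ (sigma f g').hom ≫ (α_ _ _ _).inv ≫ (sigma f g).hom ▷ right a' g')

namespace GrayData

variable {A : Type u₁} [Bicategory.{w₁, v₁} A] {B : Type u₂} [Bicategory.{w₂, v₂} B]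
  {D : Type u₃} [Bicategory.{w₃, v₃} D] [Strict D] (E : GrayData A B D)

open GrayTensor

/-- The image of a formal composite of generating 1-cells. -/
def mapWord : ∀ {x y : GrayTensor A B}, Word x y → (E.obj x.1 x.2 ⟶ E.obj y.1 y.2)
  | _, _, .left f b => E.left f b
  | _, _, .right a g => E.right a g
  | _, _, .id _ => 𝟙 _
  | _, _, .comp p q => mapWord p ≫ mapWord q

theorem mapWord_eq {x y : GrayTensor A B} {p q : Word x y} (h : WordRel p q) :
    E.mapWord p = E.mapWord q := by
  induction h with
  | comp_right p h ih => exact congrArg (E.mapWord p ≫ ·) ih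
  | comp_left q h ih => exact congrArg (· ≫ E.mapWord q) ih
  | id_comp p => exact Strict.id_comp _
  | comp_id p => exact Strict.comp_id _
  | assoc p q r => exact Strict.assoc _ _ _
  | left_id a b => exact E.left_id a b
  | left_comp f f' b => exact E.left_comp f f' b
  | right_id a b => exact E.right_id a b
  | right_comp a g g' => exact E.right_comp a g g'

/-- The image of a 1-cell of `A ⊗ B`. -/
def map {x y : GrayTensor A B} (p : x ⟶ y) : E.obj x.1 x.2 ⟶ E.obj y.1 y.2 :=
  Quot.lift E.mapWord (fun _ _ h => E.mapWord_eq h) p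

theorem map_comp {x y z : GrayTensor A B} (p : x ⟶ y) (q : y ⟶ z) :
    E.map (p ≫ q) = E.map p ≫ E.map q := by
  induction p using Quot.ind with
  | mk p =>
  induction q using Quot.ind with
  | mk q => rfl

/-- The image of a formal composite of generating 2-cells. -/
def mapCell : ∀ {x y : GrayTensor A B} {p q : x ⟶ y}, Cell p q → (E.map p ⟶ E.map q)
  | _, _, _, _, .left₂ α b => E.left₂ α b
  | _, _, _, _, .right₂ a β => E.right₂ a β
  | _, _, _, _, .sigma f g => (E.sigma f g).hom
  | _, _, _, _, .sigmaInv f g => (E.sigma f g).inv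
  | _, _, _, _, .id _ => 𝟙 _
  | _, _, _, _, .vcomp η θ => mapCell η ≫ mapCell θ
  | _, _, _, _, .whiskerLeft p η =>
    eqToHom (E.map_comp p _) ≫ E.map p ◁ mapCell η ≫ eqToHom (E.map_comp p _).symm
  | _, _, _, _, .whiskerRight η q =>
    eqToHom (E.map_comp _ q) ≫ mapCell η ▷ E.map q ≫ eqToHom (E.map_comp _ q).symm

theorem mapCell_ofEq {x y : GrayTensor A B} {p q : x ⟶ y} (h : p = q) :
    E.mapCell (Cell.ofEq h) = eqToHom (congrArg E.map h) := by
  cases h; rfl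

theorem mapCell_whiskerLeft_heq {x y z : GrayTensor A B} (p : x ⟶ y) {q q' : y ⟶ z}
    (η : Cell q q') : HEq (E.mapCell (Cell.whiskerLeft p η)) (E.map p ◁ E.mapCell η) :=
  eqToHom_conj_heq _ _ _

theorem mapCell_whiskerRight_heq {x y z : GrayTensor A B} {p p' : x ⟶ y} (η : Cell p p')
    (q : y ⟶ z) : HEq (E.mapCell (η.whiskerRight q)) (E.mapCell η ▷ E.map q) :=
  eqToHom_conj_heq _ _ _

/-- The relations of `⊗` insert identity cells `Cell.ofEq` to make boundaries match; up to `HEq`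
their images disappear. -/
theorem mapCell_ofEq_conj_heq {x y : GrayTensor A B} {p p' q q' : x ⟶ y} (h : p = p')
    (η : Cell p' q') (h' : q' = q) :
    HEq (E.mapCell ((Cell.ofEq h).vcomp (η.vcomp (Cell.ofEq h')))) (E.mapCell η) := by
  subst h h'
  exact heq_of_eq ((Category.id_comp _).trans (Category.comp_id _))

/-- Each relation is either a law of the strict 2-category `D` or a field of `E`. The fields are
stated with `HEq` and bare whiskerings, so the work lies in removing the `eqToHom`s that `mapCell`
and `Cell.ofEq` introduce. -/
theorem mapCell_eq {x y : GrayTensor A B} {p q : x ⟶ y} {η θ : Cell p q} (h : CellRel η θ) :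
    E.mapCell η = E.mapCell θ := by
  induction h with
  | vcomp_right η h ih => exact congrArg (E.mapCell η ≫ ·) ih
  | vcomp_left θ h ih => exact congrArg (· ≫ E.mapCell θ) ih
  | whiskerLeft p h ih => simp only [mapCell, ih]
  | whiskerRight q h ih => simp only [mapCell, ih]
  | id_vcomp η => exact Category.id_comp _
  | vcomp_id η => exact Category.comp_id _
  | vcomp_assoc η θ κ => exact Category.assoc _ _ _
  | whiskerLeft_id p q => simp [mapCell]
  | whiskerLeft_vcomp p η θ => simp [mapCell]
  | id_whiskerRight p q => simp [mapCell]
  | vcomp_whiskerRight η θ s => simp [mapCell]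
  | id_whiskerLeft η =>
    exact eq_of_heq ((E.mapCell_whiskerLeft_heq _ η).trans
      ((id_whiskerLeft_heq _).trans (E.mapCell_ofEq_conj_heq _ η _).symm))
  | whiskerRight_id η =>
    exact eq_of_heq ((E.mapCell_whiskerRight_heq η _).trans
      ((whiskerRight_id_heq _).trans (E.mapCell_ofEq_conj_heq _ η _).symm))
  | comp_whiskerLeft p q η =>
    refine eq_of_heq (HEq.trans ?_ (E.mapCell_ofEq_conj_heq _ _ _).symm)
    refine (E.mapCell_whiskerLeft_heq _ η).trans ?_
    refine (whiskerLeft_heq_whiskerLeft rfl rfl rfl (heq_of_eq (E.map_comp p q)) HEq.rfl HEq.rfl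
      HEq.rfl).trans ?_
    refine (comp_whiskerLeft_heq _ _ _).trans (HEq.symm ?_)
    exact (E.mapCell_whiskerLeft_heq _ _).trans (whiskerLeft_heq_whiskerLeft rfl rfl rfl HEq.rfl
      (heq_of_eq (E.map_comp _ _)) (heq_of_eq (E.map_comp _ _)) (E.mapCell_whiskerLeft_heq _ η))
  | whiskerRight_comp η r s =>
    refine eq_of_heq (HEq.trans ?_ (E.mapCell_ofEq_conj_heq _ _ _).symm)
    refine (E.mapCell_whiskerRight_heq η _).trans ?_
    refine (whiskerRight_heq_whiskerRight rfl rfl rfl HEq.rfl HEq.rfl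
      (heq_of_eq (E.map_comp r s)) HEq.rfl).trans ?_
    refine (whiskerRight_comp_heq _ _ _).trans (HEq.symm ?_)
    exact (E.mapCell_whiskerRight_heq _ _).trans (whiskerRight_heq_whiskerRight rfl rfl rfl
      (heq_of_eq (E.map_comp _ _)) (heq_of_eq (E.map_comp _ _)) HEq.rfl
      (E.mapCell_whiskerRight_heq η _))
  | whisker_assoc p η s =>
    refine eq_of_heq (HEq.trans ?_ (E.mapCell_ofEq_conj_heq _ _ _).symm)
    refine (E.mapCell_whiskerRight_heq _ s).trans ?_
    refine (whiskerRight_heq_whiskerRight rfl rfl rfl (heq_of_eq (E.map_comp _ _))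
      (heq_of_eq (E.map_comp _ _)) HEq.rfl (E.mapCell_whiskerLeft_heq p η)).trans ?_
    refine (whisker_assoc_heq _ _ _).trans (HEq.symm ?_)
    exact (E.mapCell_whiskerLeft_heq _ _).trans (whiskerLeft_heq_whiskerLeft rfl rfl rfl HEq.rfl
      (heq_of_eq (E.map_comp _ _)) (heq_of_eq (E.map_comp _ _)) (E.mapCell_whiskerRight_heq η s))
  | whisker_exchange η θ => simp [mapCell, whisker_exchange_assoc]
  | left₂_id f b => exact E.left₂_id f b
  | left₂_comp α α' b => exact E.left₂_comp α α' b
  | left₂_whiskerLeft f α b =>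
    exact eq_of_heq ((E.left₂_whiskerLeft f α b).trans
      ((E.mapCell_whiskerLeft_heq (GrayTensor.left f b) (Cell.left₂ α b)).symm.trans
        (E.mapCell_ofEq_conj_heq _ _ _).symm))
  | left₂_whiskerRight α h b =>
    exact eq_of_heq ((E.left₂_whiskerRight α h b).trans
      ((E.mapCell_whiskerRight_heq (Cell.left₂ α b) (GrayTensor.left h b)).symm.trans
        (E.mapCell_ofEq_conj_heq _ _ _).symm))
  | right₂_id a g => exact E.right₂_id a g
  | right₂_comp a β β' => exact E.right₂_comp a β β'
  | right₂_whiskerLeft a g β =>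
    exact eq_of_heq ((E.right₂_whiskerLeft a g β).trans
      ((E.mapCell_whiskerLeft_heq (GrayTensor.right a g) (Cell.right₂ a β)).symm.trans
        (E.mapCell_ofEq_conj_heq _ _ _).symm))
  | right₂_whiskerRight a β h =>
    exact eq_of_heq ((E.right₂_whiskerRight a β h).trans
      ((E.mapCell_whiskerRight_heq (Cell.right₂ a β) (GrayTensor.right a h)).symm.trans
        (E.mapCell_ofEq_conj_heq _ _ _).symm))
  | sigma_sigmaInv f g => exact (E.sigma f g).hom_inv_id
  | sigmaInv_sigma f g => exact (E.sigma f g).inv_hom_id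
  | @sigma_natural_left a a' b b' f f' α g =>
    exact (congrArg (· ≫ (E.sigma f' g).hom)
      (eq_of_heq (E.mapCell_whiskerLeft_heq (GrayTensor.right a g) (Cell.left₂ α b')))).trans
      ((E.sigma_natural_left α g).trans (congrArg ((E.sigma f g).hom ≫ ·)
        (eq_of_heq (E.mapCell_whiskerRight_heq (Cell.left₂ α b) (GrayTensor.right a' g)).symm)))
  | @sigma_natural_right a a' b b' f g g' β =>
    exact (congrArg (· ≫ (E.sigma f g').hom)
      (eq_of_heq (E.mapCell_whiskerRight_heq (Cell.right₂ a β) (GrayTensor.left f b')))).trans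
      ((E.sigma_natural_right f β).trans (congrArg ((E.sigma f g).hom ≫ ·)
        (eq_of_heq (E.mapCell_whiskerLeft_heq (GrayTensor.left f b) (Cell.right₂ a' β)).symm)))
  | sigma_id_left a g =>
    rw [mapCell_ofEq]
    exact eq_of_heq ((E.sigma_id_left a g).trans (HEq.symm <| (eqToHom_heq_id_dom _ _ _).trans <|
      id₂_heq_id₂ rfl rfl <| heq_of_eq <| (E.map_comp _ _).trans <| by
        change E.right a g ≫ E.left (𝟙 a) _ = _
        rw [E.left_id, Strict.comp_id]))
  | sigma_id_right f b =>
    rw [mapCell_ofEq]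
    exact eq_of_heq ((E.sigma_id_right f b).trans (HEq.symm <| (eqToHom_heq_id_dom _ _ _).trans <|
      id₂_heq_id₂ rfl rfl <| heq_of_eq <| (E.map_comp _ _).trans <| by
        change E.right _ (𝟙 b) ≫ E.left f _ = _
        rw [E.right_id, Strict.id_comp]))
  | sigma_comp_left f f' g =>
    -- The compatibility field is turned into an equation with explicit `eqToHom`s. In strict `D`
    -- the associator is one as well, so simplification merges all of them.
    refine (eq_eqToHom_conj_of_heq ?_ ?_ (E.sigma_comp_left f f' g)).trans ?_
    · rw [E.left_comp, Strict.assoc]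
    · rw [E.left_comp, Strict.assoc]
    · simp [mapCell, mapCell_ofEq, Strict.associator_eqToIso]; rfl
  | sigma_comp_right f g g' =>
    refine (eq_eqToHom_conj_of_heq ?_ ?_ (E.sigma_comp_right f g g')).trans ?_
    · rw [E.right_comp, Strict.assoc]
    · rw [E.right_comp, Strict.assoc]
    · simp [mapCell, mapCell_ofEq, Strict.associator_eqToIso]; rfl

/-- The 2-functor `A ⊗ B ⥤ D` with prescribed values on generating cells. -/
def lift : TwoFunctor (GrayTensor A B) D where
  obj x := E.obj x.1 x.2
  map p := E.map p
  map₂ η := Quot.lift E.mapCell (fun _ _ h => E.mapCell_eq h) η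
  map₂_id _ := rfl
  map₂_comp η θ := by
    induction η using Quot.ind with
    | mk η =>
    induction θ using Quot.ind with
    | mk θ => rfl
  map_id _ := rfl
  map_comp p q := E.map_comp p q
  map₂_whisker_left p _ _ η := by
    induction η using Quot.ind with
    | mk η => rfl
  map₂_whisker_right η q := by
    induction η using Quot.ind with
    | mk η => rfl

end GrayData

/-- Used to read each law for `Σ` as a law for `Σ⁻¹`, as the symmetry requires. -/
theorem iso_inv_heq_iso_inv {C : Type u} [Bicategory.{w, v} C] {x x' y y' : C} {f g : x ⟶ y}
    {f' g' : x' ⟶ y'} {e : f ≅ g} {e' : f' ≅ g'} (hx : x = x') (hy : y = y') (hf : HEq f f')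
    (hg : HEq g g') (h : HEq e.hom e'.hom) : HEq e.inv e'.inv :=
  inverse_heq_inverse hx hy hf hg e.inv_hom_id e'.hom_inv_id h

theorem inv_comp_eq_comp_inv {K : Type u} [Category.{v} K] {X X' Y Y' : K} (e : X ≅ Y)
    (e' : X' ≅ Y') {f : X ⟶ X'} {g : Y ⟶ Y'} (h : e.hom ≫ g = f ≫ e'.hom) :
    g ≫ e'.inv = e.inv ≫ f := by
  rw [Iso.comp_inv_eq, Category.assoc, ← h, Iso.inv_hom_id_assoc]

namespace GrayTensor

section

variable {A : Type u₁} [Bicategory.{w₁, v₁} A] {B : Type u₂} [Bicategory.{w₂, v₂} B]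

/-! ### `Σ`, up to heterogeneous equality -/

theorem sigma_id_left_heq (a : A) {b b' : B} (g : b ⟶ b') :
    HEq (sigma (𝟙 a) g) (𝟙 (right a g)) := by
  rw [sigma_id_left]
  refine (eqToHom_heq_id_dom _ _ _).trans (id₂_heq_id₂ rfl rfl (heq_of_eq ?_))
  rw [left_id, Strict.comp_id]

theorem sigma_id_right_heq {a a' : A} (f : a ⟶ a') (b : B) :
    HEq (sigma f (𝟙 b)) (𝟙 (left f b)) := by
  rw [sigma_id_right]
  refine (eqToHom_heq_id_dom _ _ _).trans (id₂_heq_id₂ rfl rfl (heq_of_eq ?_))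
  rw [right_id, Strict.id_comp]

theorem sigma_comp_left_heq {a a' a'' : A} {b b' : B} (f : a ⟶ a') (f' : a' ⟶ a'')
    (g : b ⟶ b') : HEq (sigma (f ≫ f') g)
      (sigma f g ▷ left f' b' ≫ (α_ _ _ _).hom ≫ left f b ◁ sigma f' g) := by
  rw [sigma_comp_left, Strict.associator_eqToIso]
  refine HEq.trans (heq_of_eq ?_) (eqToHom_conj_heq ?_ _ ?_)
  rotate_left
  · rw [left_comp, Strict.assoc]
  · rw [left_comp, Strict.assoc]
  · simp

theorem sigma_comp_right_heq {a a' : A} {b b' b'' : B} (f : a ⟶ a') (g : b ⟶ b')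
    (g' : b' ⟶ b'') : HEq (sigma f (g ≫ g'))
      (right a g ◁ sigma f g' ≫ (α_ _ _ _).inv ≫ sigma f g ▷ right a' g') := by
  rw [sigma_comp_right, Strict.associator_eqToIso]
  refine HEq.trans (heq_of_eq ?_) (eqToHom_conj_heq ?_ _ ?_)
  rotate_left
  · rw [right_comp, Strict.assoc]
  · rw [right_comp, Strict.assoc]
  · simp

end

/-! ### Functoriality of the Gray tensor product -/

section Map

variable {A : Type u₁} [Bicategory.{w₁, v₁} A] {B : Type u₂} [Bicategory.{w₂, v₂} B]
  {A' : Type u₃} [Bicategory.{w₃, v₃} A'] {B' : Type u₄} [Bicategory.{w₄, v₄} B']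

/-- The 2-functor `F ⊗ G` on generating cells. -/
def mapData (F : TwoFunctor A A') (G : TwoFunctor B B') : GrayData A B (GrayTensor A' B') where
  obj a b := ⟨F.obj a, G.obj b⟩
  left f b := left (F.map f) (G.obj b)
  right a _ _ g := right (F.obj a) (G.map g)
  left₂ α b := left₂ (F.map₂ α) (G.obj b)
  right₂ a _ _ _ _ β := right₂ (F.obj a) (G.map₂ β)
  sigma f g := sigmaIso (F.map f) (G.map g)
  left_id a b := (F.comp (leftFunctor A' (G.obj b))).map_id a
  left_comp f f' b := (F.comp (leftFunctor A' (G.obj b))).map_comp f f'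
  right_id a b := (G.comp (rightFunctor (F.obj a) B')).map_id b
  right_comp a _ _ _ g g' := (G.comp (rightFunctor (F.obj a) B')).map_comp g g'
  left₂_id f b := (F.comp (leftFunctor A' (G.obj b))).map₂_id f
  left₂_comp α α' b := (F.comp (leftFunctor A' (G.obj b))).map₂_comp α α'
  left₂_whiskerLeft f _ _ α b := (F.comp (leftFunctor A' (G.obj b))).map₂_whiskerLeft_heq f α
  left₂_whiskerRight α h b := (F.comp (leftFunctor A' (G.obj b))).map₂_whiskerRight_heq α h
  right₂_id a _ _ g := (G.comp (rightFunctor (F.obj a) B')).map₂_id g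
  right₂_comp a _ _ _ _ _ β β' := (G.comp (rightFunctor (F.obj a) B')).map₂_comp β β'
  right₂_whiskerLeft a _ _ _ g _ _ β :=
    (G.comp (rightFunctor (F.obj a) B')).map₂_whiskerLeft_heq g β
  right₂_whiskerRight a _ _ _ _ _ β h :=
    (G.comp (rightFunctor (F.obj a) B')).map₂_whiskerRight_heq β h
  sigma_natural_left α g := sigma_natural_left (F.map₂ α) (G.map g)
  sigma_natural_right f _ _ β := sigma_natural_right (F.map f) (G.map₂ β)
  sigma_id_left a _ _ g := by
    simp only [sigmaIso_hom]; rw [F.map_id]; exact sigma_id_left_heq _ _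
  sigma_id_right f b := by
    simp only [sigmaIso_hom]; rw [G.map_id]; exact sigma_id_right_heq _ _
  sigma_comp_left f f' g := by
    simp only [sigmaIso_hom]; rw [F.map_comp]; exact sigma_comp_left_heq _ _ _
  sigma_comp_right f g g' := by
    simp only [sigmaIso_hom]; rw [G.map_comp]; exact sigma_comp_right_heq _ _ _

/-- The 2-functor `F ⊗ G`. -/
def map (F : TwoFunctor A A') (G : TwoFunctor B B') :
    TwoFunctor (GrayTensor A B) (GrayTensor A' B') :=
  (mapData F G).lift

theorem isMap_map (F : TwoFunctor A A') (G : TwoFunctor B B') : IsMap F G (map F G) where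
  obj _ _ := rfl
  map_left _ _ := HEq.rfl
  map_right _ _ _ _ := HEq.rfl
  map₂_left₂ _ _ := HEq.rfl
  map₂_right₂ _ _ _ _ _ _ := HEq.rfl
  map₂_sigma _ _ := HEq.rfl

/-- Both sides send every generator to the same cell by definition, so all three conditions of
`functor_ext` hold by reflexivity. -/
theorem map_id (A : Type u₁) [Bicategory.{w₁, v₁} A] (B : Type u₂) [Bicategory.{w₂, v₂} B] :
    map (TwoFunctor.id A) (TwoFunctor.id B) = TwoFunctor.id (GrayTensor A B) :=
  functor_ext (fun _ => rfl) (fun _ => rfl) (fun _ _ => HEq.rfl)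

end Map

theorem map_comp {A : Type u₁} [Bicategory.{w₁, v₁} A] {B : Type u₂} [Bicategory.{w₂, v₂} B]
    {A' : Type u₃} [Bicategory.{w₃, v₃} A'] {B' : Type u₄} [Bicategory.{w₄, v₄} B']
    {A'' : Type u₅} [Bicategory.{w₅, v₅} A''] {B'' : Type u₆} [Bicategory.{w₆, v₆} B'']
    (F : TwoFunctor A A') (F' : TwoFunctor A' A'') (G : TwoFunctor B B')
    (G' : TwoFunctor B' B'') :
    map (F.comp F') (G.comp G') = (map F G).comp (map F' G') :=
  functor_ext (fun _ => rfl) (fun _ => rfl) (fun _ _ => HEq.rfl)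

/-! ### The symmetry of the Gray tensor product -/

section Symm

variable (A : Type u₁) [Bicategory.{w₁, v₁} A] (B : Type u₂) [Bicategory.{w₂, v₂} B]

/-- The symmetry `A ⊗ B ⥤ B ⊗ A` on generating cells; it sends `Σ_{f,g}` to the inverse of
`Σ_{g,f}`. -/
def symmData : GrayData A B (GrayTensor B A) where
  obj a b := ⟨b, a⟩
  left f b := right b f
  right a _ _ g := left g a
  left₂ α b := right₂ b α
  right₂ a _ _ _ _ β := left₂ β a
  sigma f g := (sigmaIso g f).symm
  left_id a b := right_id b a
  left_comp f f' b := right_comp b f f'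
  right_id a b := left_id b a
  right_comp a _ _ _ g g' := left_comp g g' a
  left₂_id f b := (rightFunctor b A).map₂_id f
  left₂_comp α α' b := (rightFunctor b A).map₂_comp α α'
  left₂_whiskerLeft f _ _ α b := (rightFunctor b A).map₂_whiskerLeft_heq f α
  left₂_whiskerRight α h b := (rightFunctor b A).map₂_whiskerRight_heq α h
  right₂_id a _ _ g := (leftFunctor B a).map₂_id g
  right₂_comp a _ _ _ _ _ β β' := (leftFunctor B a).map₂_comp β β'
  right₂_whiskerLeft a _ _ _ g _ _ β := (leftFunctor B a).map₂_whiskerLeft_heq g β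
  right₂_whiskerRight a _ _ _ _ _ β h := (leftFunctor B a).map₂_whiskerRight_heq β h
  -- The symmetry exchanges the variables: naturality of `Σ⁻¹` in one of them is the inverted
  -- naturality of `Σ` in the other.
  sigma_natural_left α g :=
    inv_comp_eq_comp_inv (sigmaIso g _) (sigmaIso g _) (sigma_natural_right g α).symm
  sigma_natural_right f _ _ β :=
    inv_comp_eq_comp_inv (sigmaIso _ f) (sigmaIso _ f) (sigma_natural_left β f).symm
  sigma_id_left a _ _ g :=
    iso_inv_heq_iso_inv (e := sigmaIso g (𝟙 a)) (e' := Iso.refl _) rfl rfl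
      (heq_of_eq (by rw [right_id, Strict.id_comp])) (heq_of_eq (by rw [right_id, Strict.comp_id]))
      (sigma_id_right_heq g a)
  sigma_id_right f b :=
    iso_inv_heq_iso_inv (e := sigmaIso (𝟙 b) f) (e' := Iso.refl _) rfl rfl
      (heq_of_eq (by rw [left_id, Strict.comp_id])) (heq_of_eq (by rw [left_id, Strict.id_comp]))
      (sigma_id_left_heq b f)
  sigma_comp_left f f' g := by
    -- The composition law of `Σ` in the second variable is written as a composite of isomorphisms;
    -- inverting it reverses the order of the factors and yields the law needed in the first
    -- variable.
    refine (iso_inv_heq_iso_inv (e := sigmaIso g (f ≫ f'))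
      (e' := whiskerLeftIso _ (sigmaIso g f') ≪≫ (α_ _ _ _).symm ≪≫
        whiskerRightIso (sigmaIso g f) _) rfl rfl
      (heq_of_eq (by rw [right_comp, Strict.assoc])) (heq_of_eq (by rw [right_comp, Strict.assoc]))
      (sigma_comp_right_heq g f f')).trans (heq_of_eq ?_)
    simp
  sigma_comp_right f g g' := by
    refine (iso_inv_heq_iso_inv (e := sigmaIso (g ≫ g') f)
      (e' := whiskerRightIso (sigmaIso g f) _ ≪≫ (α_ _ _ _) ≪≫
        whiskerLeftIso _ (sigmaIso g' f)) rfl rfl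
      (heq_of_eq (by rw [left_comp, Strict.assoc])) (heq_of_eq (by rw [left_comp, Strict.assoc]))
      (sigma_comp_left_heq g g' f)).trans (heq_of_eq ?_)
    simp

/-- The symmetry `A ⊗ B ⥤ B ⊗ A`. -/
def symm : TwoFunctor (GrayTensor A B) (GrayTensor B A) := (symmData A B).lift

theorem symm_comp_symm : (symm A B).comp (symm B A) = TwoFunctor.id (GrayTensor A B) :=
  functor_ext (fun _ => rfl) (fun _ => rfl) (fun _ _ => HEq.rfl)

end Symm

theorem map_comp_symm {A : Type u₁} [Bicategory.{w₁, v₁} A] {B : Type u₂} [Bicategory.{w₂, v₂} B]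
    {A' : Type u₃} [Bicategory.{w₃, v₃} A'] {B' : Type u₄} [Bicategory.{w₄, v₄} B']
    (F : TwoFunctor A A') (G : TwoFunctor B B') :
    (map F G).comp (symm A' B') = (symm A B).comp (map G F) :=
  functor_ext (fun _ => rfl) (fun _ => rfl) (fun _ _ => HEq.rfl)

/-! ### The second projection -/

section Snd

variable (A : Type u₁) [Bicategory.{w₁, v₁} A] (B : Type u₂) [Bicategory.{w₂, v₂} B] [Strict B]

/-- The second projection `A ⊗ B ⥤ B` on generating cells. -/
def sndData : GrayData A B B where
  obj _ b := b
  left _ b := 𝟙 b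
  right _ _ _ g := g
  left₂ _ b := 𝟙 (𝟙 b)
  right₂ _ _ _ _ _ β := β
  -- Both composites around the square equal `g` once `f` is sent to an identity, so `Σ_{f,g}` has
  -- to become an identity 2-cell.
  sigma f g := eqToIso ((Strict.comp_id g).trans (Strict.id_comp g).symm)
  left_id _ _ := rfl
  left_comp _ _ _ := (Strict.id_comp _).symm
  right_id _ _ := rfl
  right_comp _ _ _ _ _ _ := rfl
  left₂_id _ _ := rfl
  left₂_comp _ _ _ := (Category.id_comp _).symm
  left₂_whiskerLeft _ _ _ _ b := by
    rw [whiskerLeft_id]; exact id₂_heq_id₂ rfl rfl (heq_of_eq (Strict.id_comp _).symm)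
  left₂_whiskerRight _ _ b := by
    rw [id_whiskerRight]; exact id₂_heq_id₂ rfl rfl (heq_of_eq (Strict.id_comp _).symm)
  right₂_id _ _ _ _ := rfl
  right₂_comp _ _ _ _ _ _ _ _ := rfl
  right₂_whiskerLeft _ _ _ _ _ _ _ _ := HEq.rfl
  right₂_whiskerRight _ _ _ _ _ _ _ _ := HEq.rfl
  sigma_natural_left _ _ := by simp
  sigma_natural_right _ _ _ β := by
    simp [Strict.leftUnitor_eqToIso, Strict.rightUnitor_eqToIso]
  sigma_id_left _ _ _ g := by
    simp only [eqToIso.hom]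
    exact (eqToHom_heq_id_dom _ _ _).trans (id₂_heq_id₂ rfl rfl (heq_of_eq (Strict.comp_id g)))
  sigma_id_right _ b := by
    simp only [eqToIso.hom]
    exact (eqToHom_heq_id_dom _ _ _).trans (id₂_heq_id₂ rfl rfl (heq_of_eq (Strict.comp_id _)))
  sigma_comp_left _ _ g := by
    simp only [Strict.associator_eqToIso, eqToIso.hom, eqToHom_whiskerRight, whiskerLeft_eqToHom,
      eqToHom_trans]
    exact eqToHom_heq_eqToHom rfl rfl _ _ (by simp)
  sigma_comp_right _ g g' := by
    simp only [Strict.associator_eqToIso, eqToIso.hom, eqToIso.inv, eqToHom_whiskerRight,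
      whiskerLeft_eqToHom, eqToHom_trans]
    exact eqToHom_heq_eqToHom rfl rfl _ _ (by simp)

/-- The second projection `A ⊗ B ⥤ B`. -/
def projSnd : TwoFunctor (GrayTensor A B) B := (sndData A B).lift

end Snd

end GrayTensor

/-! ### Pasting of invertible squares -/

section Squares

variable {C : Type u} [Bicategory.{w, v} C]

theorem iso_heq {K : Type u} [Category.{v} K] {X X' Y Y' : K} (hX : X = X') (hY : Y = Y')
    {e : X ≅ Y} {e' : X' ≅ Y'} (h : HEq e.hom e'.hom) : HEq e e' := by
  subst hX hY; exact heq_of_eq (Iso.ext (eq_of_heq h))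

theorem iso_hom_heq {K : Type u} [Category.{v} K] {X X' Y Y' : K} (hX : X = X') (hY : Y = Y')
    {e : X ≅ Y} {e' : X' ≅ Y'} (h : HEq e e') : HEq e.hom e'.hom := by
  subst hX hY; cases h; rfl

theorem eqToIso_conj_heq {K : Type u} [Category.{v} K] {X X' Y Y' : K} (h : X = X')
    (e : X' ≅ Y') (h' : Y' = Y) : HEq (eqToIso h ≪≫ e ≪≫ eqToIso h') e := by
  subst h h'; exact heq_of_eq (Iso.ext (by simp))

/-- Horizontal pasting of invertible squares. -/
def pasteH {x x' x'' y y' y'' : C} {u : x ⟶ y} {u' : x' ⟶ y'} {u'' : x'' ⟶ y''} {f : x ⟶ x'}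
    {f' : x' ⟶ x''} {g : y ⟶ y'} {g' : y' ⟶ y''} (s : u ≫ g ≅ f ≫ u') (t : u' ≫ g' ≅ f' ≫ u'') :
    u ≫ g ≫ g' ≅ (f ≫ f') ≫ u'' :=
  (α_ _ _ _).symm ≪≫ whiskerRightIso s g' ≪≫ α_ _ _ _ ≪≫ whiskerLeftIso f t ≪≫ (α_ _ _ _).symm

/-- Vertical pasting of invertible squares. -/
def pasteV {x x' y y' z z' : C} {u : x ⟶ y} {u' : x' ⟶ y'} {k : y ⟶ z} {k' : y' ⟶ z'}
    {f : x ⟶ x'} {g : y ⟶ y'} {h : z ⟶ z'} (s : u ≫ g ≅ f ≫ u') (t : k ≫ h ≅ g ≫ k') :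
    (u ≫ k) ≫ h ≅ f ≫ u' ≫ k' :=
  α_ _ _ _ ≪≫ whiskerLeftIso u t ≪≫ (α_ _ _ _).symm ≪≫ whiskerRightIso s k' ≪≫ α_ _ _ _

theorem pasteH_heq_pasteH {x x' x'' y y' y'' : C} {u v : x ⟶ y} {u' v' : x' ⟶ y'}
    {u'' v'' : x'' ⟶ y''} {f k : x ⟶ x'} {f' k' : x' ⟶ x''} {g l : y ⟶ y'} {g' l' : y' ⟶ y''}
    (hu : u = v) (hu' : u' = v') (hu'' : u'' = v'') (hf : f = k) (hf' : f' = k') (hg : g = l)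
    (hg' : g' = l') {s : u ≫ g ≅ f ≫ u'} {t : u' ≫ g' ≅ f' ≫ u''} {s' : v ≫ l ≅ k ≫ v'}
    {t' : v' ≫ l' ≅ k' ≫ v''} (hs : HEq s s') (ht : HEq t t') :
    HEq (pasteH s t) (pasteH s' t') := by
  subst hu hu' hu'' hf hf' hg hg'; cases hs; cases ht; rfl

theorem pasteV_heq_pasteV {x x' y y' z z' : C} {u : x ⟶ y} {u' : x' ⟶ y'} {k : y ⟶ z}
    {k' : y' ⟶ z'} {f f₁ : x ⟶ x'} {g g₁ : y ⟶ y'} {h h₁ : z ⟶ z'} (hf : f = f₁) (hg : g = g₁)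
    (hh : h = h₁) {s : u ≫ g ≅ f ≫ u'} {t : k ≫ h ≅ g ≫ k'} {s₁ : u ≫ g₁ ≅ f₁ ≫ u'}
    {t₁ : k ≫ h₁ ≅ g₁ ≫ k'} (hs : HEq s s₁) (ht : HEq t t₁) :
    HEq (pasteV s t) (pasteV s₁ t₁) := by
  subst hf hg hh; cases hs; cases ht; rfl

/-- If the right-hand square is natural in a 2-cell, so is the pasted square, since the left-hand
square slides past by interchange. With its mirror image `pasteH_whiskerRight`, this extends
naturality of a pseudonatural transformation to whiskered 2-cells. -/
theorem pasteH_whiskerLeft {x x' x'' y y' y'' : C} {u : x ⟶ y} {u' : x' ⟶ y'} {u'' : x'' ⟶ y''}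
    {f : x ⟶ x'} {f' k' : x' ⟶ x''} {g : y ⟶ y'} {g' l' : y' ⟶ y''} (s : u ≫ g ≅ f ≫ u')
    {t : u' ≫ g' ≅ f' ≫ u''} {t' : u' ≫ l' ≅ k' ≫ u''} {η : g' ⟶ l'} {ζ : f' ⟶ k'}
    (h : u' ◁ η ≫ t'.hom = t.hom ≫ ζ ▷ u'') :
    u ◁ g ◁ η ≫ (pasteH s t').hom = (pasteH s t).hom ≫ (f ◁ ζ) ▷ u'' := by
  have h' := congrArg (f ◁ ·) h
  simp only [whiskerLeft_comp] at h'
  have e : u ◁ g ◁ η ≫ (α_ u g l').inv ≫ s.hom ▷ l' ≫ (α_ f u' l').hom =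
      (α_ u g g').inv ≫ s.hom ▷ g' ≫ (α_ f u' g').hom ≫ f ◁ u' ◁ η := by
    rw [associator_inv_naturality_right_assoc, whisker_exchange_assoc]; simp
  simp [pasteH, reassoc_of% e, reassoc_of% h']

theorem pasteH_whiskerRight {x x' x'' y y' y'' : C} {u : x ⟶ y} {u' : x' ⟶ y'} {u'' : x'' ⟶ y''}
    {f k : x ⟶ x'} {f' : x' ⟶ x''} {g l : y ⟶ y'} {g' : y' ⟶ y''} {s : u ≫ g ≅ f ≫ u'}
    {s' : u ≫ l ≅ k ≫ u'} (t : u' ≫ g' ≅ f' ≫ u'') {η : g ⟶ l} {ζ : f ⟶ k}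
    (h : u ◁ η ≫ s'.hom = s.hom ≫ ζ ▷ u') :
    u ◁ η ▷ g' ≫ (pasteH s' t).hom = (pasteH s t).hom ≫ (ζ ▷ f') ▷ u'' := by
  have h' := congrArg (· ▷ g') h
  simp only [comp_whiskerRight] at h'
  have e : ζ ▷ u' ▷ g' ≫ (α_ k u' g').hom ≫ k ◁ t.hom =
      (α_ f u' g').hom ≫ f ◁ t.hom ≫ ζ ▷ (f' ≫ u'') := by
    rw [associator_naturality_left_assoc, whisker_exchange]
  simp only [pasteH, Iso.trans_hom, Iso.symm_hom, whiskerLeftIso_hom, whiskerRightIso_hom,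
    Category.assoc]
  rw [associator_inv_naturality_middle_assoc, reassoc_of% h', reassoc_of% e]
  simp

/-- Here the vertical edges vary instead of the horizontal ones: the modification condition on two
adjacent squares passes to their pasting. -/
theorem pasteH_whisker {x x' x'' y y' y'' : C} {u k : x ⟶ y} {u' k' : x' ⟶ y'}
    {u'' k'' : x'' ⟶ y''} {f : x ⟶ x'} {f' : x' ⟶ x''} {g : y ⟶ y'} {g' : y' ⟶ y''}
    {s : u ≫ g ≅ f ≫ u'} {t : u' ≫ g' ≅ f' ≫ u''} {s' : k ≫ g ≅ f ≫ k'}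
    {t' : k' ≫ g' ≅ f' ≫ k''} {m : u ⟶ k} {m' : u' ⟶ k'} {m'' : u'' ⟶ k''}
    (h : m ▷ g ≫ s'.hom = s.hom ≫ f ◁ m') (h' : m' ▷ g' ≫ t'.hom = t.hom ≫ f' ◁ m'') :
    m ▷ (g ≫ g') ≫ (pasteH s' t').hom = (pasteH s t).hom ≫ (f ≫ f') ◁ m'' := by
  have e := congrArg (· ▷ g') h
  have e' := congrArg (f ◁ ·) h'
  simp only [comp_whiskerRight, whiskerLeft_comp] at e e'
  simp [pasteH, reassoc_of% e, reassoc_of% e']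

theorem pasteH_pasteV {x x' x'' y y' y'' z z' z'' : C} {u : x ⟶ y} {u' : x' ⟶ y'}
    {u'' : x'' ⟶ y''} {k : y ⟶ z} {k' : y' ⟶ z'} {k'' : y'' ⟶ z''} {f : x ⟶ x'} {f' : x' ⟶ x''}
    {g : y ⟶ y'} {g' : y' ⟶ y''} {h : z ⟶ z'} {h' : z' ⟶ z''} (s : u ≫ g ≅ f ≫ u')
    (t : u' ≫ g' ≅ f' ≫ u'') (s' : k ≫ h ≅ g ≫ k') (t' : k' ≫ h' ≅ g' ≫ k'') :
    pasteH (pasteV s s') (pasteV t t') = pasteV (pasteH s t) (pasteH s' t') := by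
  ext
  simp only [pasteH, pasteV, Iso.trans_hom, Iso.symm_hom, whiskerLeftIso_hom, whiskerRightIso_hom]
  calc
    _ = 𝟙 _ ⊗≫ u ◁ s'.hom ▷ h' ⊗≫ (s.hom ▷ (k' ≫ h') ≫ (f ≫ u') ◁ t'.hom) ⊗≫
        f ◁ t.hom ▷ k'' ⊗≫ 𝟙 _ := by bicategory
    -- In a two-by-two grid the two orders of pasting differ only in the order in which the opposite
    -- corners `s` and `t'` are applied, and these commute by interchange.
    _ = _ := by rw [← whisker_exchange]; bicategory

variable [Strict C]

/-- This makes an identity square explicit, so that the unit laws for pasting reduce to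
simplification of `eqToHom`s. -/
theorem square_eq_eqToIso {x y : C} {u : x ⟶ y} {s : u ≫ 𝟙 y ≅ 𝟙 x ≫ u} (hs : HEq s.hom (𝟙 u)) :
    s = eqToIso ((Strict.comp_id u).trans (Strict.id_comp u).symm) :=
  Iso.ext (eq_of_heq (hs.trans (HEq.symm <| (eqToHom_heq_id_dom _ _
    ((Strict.comp_id u).trans (Strict.id_comp u).symm)).trans <|
      id₂_heq_id₂ rfl rfl (heq_of_eq (Strict.comp_id u)))))

/-- The horizontal edges are variables with equations to identities because they will be
instantiated by images of identities under 2-functors, which are identities only propositionally. -/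
theorem pasteH_id_left {x x' y y' : C} {u : x ⟶ y} {u' : x' ⟶ y'} {f₀ : x ⟶ x} {g₀ : y ⟶ y}
    (hf₀ : f₀ = 𝟙 x) (hg₀ : g₀ = 𝟙 y) {f : x ⟶ x'} {g : y ⟶ y'}
    {s : u ≫ g₀ ≅ f₀ ≫ u} (hs : HEq s.hom (𝟙 u)) (t : u ≫ g ≅ f ≫ u') :
    HEq (pasteH s t) t := by
  subst hf₀ hg₀
  refine iso_heq (by rw [Strict.id_comp]) (by rw [Strict.id_comp]) ?_
  obtain rfl := square_eq_eqToIso hs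
  simp [pasteH, Strict.associator_eqToIso, Strict.leftUnitor_eqToIso]

theorem pasteH_id_right {x x' y y' : C} {u : x ⟶ y} {u' : x' ⟶ y'} {f₀ : x' ⟶ x'} {g₀ : y' ⟶ y'}
    (hf₀ : f₀ = 𝟙 x') (hg₀ : g₀ = 𝟙 y') {f : x ⟶ x'} {g : y ⟶ y'} (t : u ≫ g ≅ f ≫ u')
    {s : u' ≫ g₀ ≅ f₀ ≫ u'} (hs : HEq s.hom (𝟙 u')) : HEq (pasteH t s) t := by
  subst hf₀ hg₀
  refine iso_heq (by rw [Strict.comp_id]) (by rw [Strict.comp_id]) ?_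
  obtain rfl := square_eq_eqToIso hs
  simp [pasteH, Strict.associator_eqToIso, Strict.rightUnitor_eqToIso]

theorem square_id_whisker {x y : C} {u u' : x ⟶ y} {f₀ : x ⟶ x} {g₀ : y ⟶ y} (hf₀ : f₀ = 𝟙 x)
    (hg₀ : g₀ = 𝟙 y) {s : u ≫ g₀ ≅ f₀ ≫ u} (hs : HEq s.hom (𝟙 u)) {s' : u' ≫ g₀ ≅ f₀ ≫ u'}
    (hs' : HEq s'.hom (𝟙 u')) (m : u ⟶ u') : m ▷ g₀ ≫ s'.hom = s.hom ≫ f₀ ◁ m := by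
  subst hf₀ hg₀
  obtain rfl := square_eq_eqToIso hs
  obtain rfl := square_eq_eqToIso hs'
  simp [Strict.leftUnitor_eqToIso, Strict.rightUnitor_eqToIso]

theorem pasteV_id {x y z : C} {u : x ⟶ y} {k : y ⟶ z} {f₀ : x ⟶ x} {g₀ : y ⟶ y} {h₀ : z ⟶ z}
    (hf₀ : f₀ = 𝟙 x) (hg₀ : g₀ = 𝟙 y) (hh₀ : h₀ = 𝟙 z) {s : u ≫ g₀ ≅ f₀ ≫ u}
    (hs : HEq s.hom (𝟙 u)) {t : k ≫ h₀ ≅ g₀ ≫ k} (ht : HEq t.hom (𝟙 k)) :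
    HEq (pasteV s t).hom (𝟙 (u ≫ k)) := by
  subst hf₀ hg₀ hh₀
  obtain rfl := square_eq_eqToIso hs
  obtain rfl := square_eq_eqToIso ht
  simp only [pasteV, Strict.associator_eqToIso, Iso.trans_hom, Iso.symm_hom, whiskerLeftIso_hom,
    whiskerRightIso_hom, eqToIso.hom, eqToIso.inv, whiskerLeft_eqToHom, eqToHom_whiskerRight,
    eqToHom_trans]
  exact (eqToHom_heq_id_dom _ _ _).trans (id₂_heq_id₂ rfl rfl (heq_of_eq (Strict.comp_id _)))

theorem pasteH_hom_heq_id {x x' x'' : C} {u : x ⟶ x} {u' : x' ⟶ x'} {u'' : x'' ⟶ x''}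
    (hu : u = 𝟙 x) (hu' : u' = 𝟙 x') (hu'' : u'' = 𝟙 x'') {f : x ⟶ x'} {f' : x' ⟶ x''}
    {s : u ≫ f ≅ f ≫ u'} {t : u' ≫ f' ≅ f' ≫ u''} (hs : HEq s.hom (𝟙 f)) (ht : HEq t.hom (𝟙 f')) :
    HEq (pasteH s t).hom (𝟙 (f ≫ f')) := by
  subst hu hu' hu''
  have hs' : s.hom = eqToHom ((Strict.id_comp f).trans (Strict.comp_id f).symm) :=
    eq_of_heq (hs.trans (HEq.symm <| (eqToHom_heq_id_dom _ _ _).trans <|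
      id₂_heq_id₂ rfl rfl (heq_of_eq (Strict.id_comp f))))
  have ht' : t.hom = eqToHom ((Strict.id_comp f').trans (Strict.comp_id f').symm) :=
    eq_of_heq (ht.trans (HEq.symm <| (eqToHom_heq_id_dom _ _ _).trans <|
      id₂_heq_id₂ rfl rfl (heq_of_eq (Strict.id_comp f'))))
  simp only [pasteH, Strict.associator_eqToIso, Iso.trans_hom, Iso.symm_hom, whiskerLeftIso_hom,
    whiskerRightIso_hom, eqToIso.hom, eqToIso.inv, hs', ht', whiskerLeft_eqToHom,
    eqToHom_whiskerRight, eqToHom_trans]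
  exact (eqToHom_heq_id_dom _ _ _).trans (id₂_heq_id₂ rfl rfl (heq_of_eq (Strict.id_comp _)))

theorem square_whisker_congr {x x' y y' : C} {u v : x ⟶ y} {u' v' : x' ⟶ y'} {f k : x ⟶ x'}
    {g l : y ⟶ y'} (hf : f = k) (hg : g = l) {s : u ≫ g ≅ f ≫ u'} {t : v ≫ g ≅ f ≫ v'}
    {s' : u ≫ l ≅ k ≫ u'} {t' : v ≫ l ≅ k ≫ v'} (hs : HEq s s') (ht : HEq t t') {m : u ⟶ v}
    {m' : u' ⟶ v'} (h : m ▷ l ≫ t'.hom = s'.hom ≫ k ◁ m') :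
    m ▷ g ≫ t.hom = s.hom ≫ f ◁ m' := by
  subst hf hg; cases hs; cases ht; exact h

theorem pasteH_assoc {x x' x'' x''' y y' y'' y''' : C} {u : x ⟶ y} {u' : x' ⟶ y'}
    {u'' : x'' ⟶ y''} {u''' : x''' ⟶ y'''} {f : x ⟶ x'} {f' : x' ⟶ x''} {f'' : x'' ⟶ x'''}
    {g : y ⟶ y'} {g' : y' ⟶ y''} {g'' : y'' ⟶ y'''} (s : u ≫ g ≅ f ≫ u')
    (t : u' ≫ g' ≅ f' ≫ u'') (r : u'' ≫ g'' ≅ f'' ≫ u''') :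
    HEq (pasteH (pasteH s t) r) (pasteH s (pasteH t r)) := by
  refine iso_heq (by rw [Strict.assoc g]) (by rw [Strict.assoc f]) ?_
  refine (heq_of_eq ?_).trans (eqToHom_conj_heq (by simp only [Strict.assoc]) _
    (by simp only [Strict.assoc]))
  -- In any bicategory the two bracketings differ by associators on the boundary; strictness then
  -- turns these into `eqToHom`s.
  have e : (pasteH (pasteH s t) r).hom = u ◁ (α_ g g' g'').hom ≫ (pasteH s (pasteH t r)).hom ≫
      (α_ f f' f'').inv ▷ u''' := by
    simp only [pasteH, Iso.trans_hom, Iso.symm_hom, whiskerLeftIso_hom, whiskerRightIso_hom]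
    bicategory
  rw [e]
  simp [Strict.associator_eqToIso]

/-- Translates pasting into the shape of `GrayData.sigma_comp_left`; `pasteV_hom_heq` does the same
for `GrayData.sigma_comp_right`. -/
theorem pasteH_hom_heq {x x' x'' y y' y'' : C} {u : x ⟶ y} {u' : x' ⟶ y'} {u'' : x'' ⟶ y''}
    {f : x ⟶ x'} {f' : x' ⟶ x''} {g : y ⟶ y'} {g' : y' ⟶ y''} (s : u ≫ g ≅ f ≫ u')
    (t : u' ≫ g' ≅ f' ≫ u'') :
    HEq (pasteH s t).hom (s.hom ▷ g' ≫ (α_ _ _ _).hom ≫ f ◁ t.hom) := by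
  refine HEq.trans (heq_of_eq ?_)
    (eqToHom_conj_heq (Strict.assoc u g g').symm _ (Strict.assoc f f' u'').symm)
  simp [pasteH, Strict.associator_eqToIso]

theorem pasteV_hom_heq {x x' y y' z z' : C} {u : x ⟶ y} {u' : x' ⟶ y'} {k : y ⟶ z} {k' : y' ⟶ z'}
    {f : x ⟶ x'} {g : y ⟶ y'} {h : z ⟶ z'} (s : u ≫ g ≅ f ≫ u') (t : k ≫ h ≅ g ≫ k') :
    HEq (pasteV s t).hom (u ◁ t.hom ≫ (α_ _ _ _).inv ≫ s.hom ▷ k') := by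
  refine HEq.trans (heq_of_eq ?_)
    (eqToHom_conj_heq (Strict.assoc u k h) _ (Strict.assoc f u' k'))
  simp [pasteV, Strict.associator_eqToIso]

end Squares

/-! ### Images of invertible squares under 2-functors -/

section MapSquare

variable {C : Type u₁} [Bicategory.{w₁, v₁} C] {D : Type u₂} [Bicategory.{w₂, v₂} D]

/-- The image of an invertible square under a 2-functor. -/
def TwoFunctor.mapSquare (F : TwoFunctor C D) {x x' y y' : C} {u : x ⟶ y} {u' : x' ⟶ y'}
    {f : x ⟶ x'} {g : y ⟶ y'} (s : u ≫ g ≅ f ≫ u') :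
    F.map u ≫ F.map g ≅ F.map f ≫ F.map u' :=
  eqToIso (F.map_comp u g).symm ≪≫ F.map₂Iso s ≪≫ eqToIso (F.map_comp f u')

theorem TwoFunctor.mapSquare_hom_heq (F : TwoFunctor C D) {x x' y y' : C} {u : x ⟶ y}
    {u' : x' ⟶ y'} {f : x ⟶ x'} {g : y ⟶ y'} (s : u ≫ g ≅ f ≫ u') :
    HEq (F.mapSquare s).hom (F.map₂ s.hom) := by
  simp only [mapSquare, Iso.trans_hom, eqToIso.hom, PrelaxFunctor.map₂Iso_hom]
  exact eqToHom_conj_heq _ _ _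

theorem TwoFunctor.mapSquare_heq (F : TwoFunctor C D) {x x' y y' : C} {u v : x ⟶ y}
    {u' v' : x' ⟶ y'} {f k : x ⟶ x'} {g l : y ⟶ y'} (hu : u = v) (hu' : u' = v') (hf : f = k)
    (hg : g = l) {s : u ≫ g ≅ f ≫ u'} {t : v ≫ l ≅ k ≫ v'} (h : HEq s t) :
    HEq (F.mapSquare s) (F.mapSquare t) := by
  subst hu hu' hf hg; cases h; rfl

theorem TwoFunctor.mapSquare_pasteH [Strict C] [Strict D] (F : TwoFunctor C D)
    {x x' x'' y y' y'' : C} {u : x ⟶ y} {u' : x' ⟶ y'} {u'' : x'' ⟶ y''}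
    {f : x ⟶ x'} {f' : x' ⟶ x''} {g : y ⟶ y'} {g' : y' ⟶ y''} (s : u ≫ g ≅ f ≫ u')
    (t : u' ≫ g' ≅ f' ≫ u'') :
    HEq (F.mapSquare (pasteH s t)) (pasteH (F.mapSquare s) (F.mapSquare t)) := by
  refine iso_heq (by rw [F.map_comp g]) (by rw [F.map_comp f]) ?_
  refine HEq.trans (heq_of_eq ?_) (eqToHom_conj_heq (by rw [F.map_comp g]) _
    (by rw [F.map_comp f]))
  simp only [mapSquare, Iso.trans_hom, eqToIso.hom, PrelaxFunctor.map₂Iso_hom]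
  simp [pasteH, Strict.associator_eqToIso, PrelaxFunctor.map₂_eqToHom,
    F.map₂_whisker_left, F.map₂_whisker_right]

theorem TwoFunctor.mapSquare_pasteV [Strict C] [Strict D] (F : TwoFunctor C D)
    {x x' y y' z z' : C} {u : x ⟶ y} {u' : x' ⟶ y'} {k : y ⟶ z} {k' : y' ⟶ z'}
    {f : x ⟶ x'} {g : y ⟶ y'} {h : z ⟶ z'} (s : u ≫ g ≅ f ≫ u') (t : k ≫ h ≅ g ≫ k') :
    HEq (F.mapSquare (pasteV s t)) (pasteV (F.mapSquare s) (F.mapSquare t)) := by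
  refine iso_heq (by rw [F.map_comp u]) (by rw [F.map_comp u']) ?_
  refine HEq.trans (heq_of_eq ?_) (eqToHom_conj_heq (by rw [F.map_comp u]) _
    (by rw [F.map_comp u']))
  simp only [mapSquare, Iso.trans_hom, eqToIso.hom, PrelaxFunctor.map₂Iso_hom]
  simp [pasteV, Strict.associator_eqToIso, PrelaxFunctor.map₂_eqToHom,
    F.map₂_whisker_left, F.map₂_whisker_right]

end MapSquare

/-- Transfers a naturality square from an invertible 2-cell to its inverse. It settles the `Σ⁻¹`
case for pseudonatural transformations and for icons. -/
theorem comp_eq_comp_of_inverse {K : Type u} [Category.{v} K] {X X' Y Y' : K} {s : X ⟶ Y}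
    {s' : X' ⟶ Y'} {a : X ⟶ X'} {a' : X' ⟶ X} {b : Y ⟶ Y'} {b' : Y' ⟶ Y} (ha : a' ≫ a = 𝟙 X')
    (hb : b ≫ b' = 𝟙 Y) (h : a ≫ s' = s ≫ b) : a' ≫ s = s' ≫ b' := by
  rw [← Category.comp_id (a' ≫ s), ← hb, Category.assoc, ← Category.assoc s, ← h,
    Category.assoc, reassoc_of% ha]

/-! ### Pseudonatural transformations -/

/-- The structure of a pseudonatural transformation `P ⟶ Q` with components `u`. -/
structure PseudoNat {X : Type u₁} [Bicategory.{w₁, v₁} X] {D : Type u₂} [Bicategory.{w₂, v₂} D]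
    (P Q : TwoFunctor X D) (u : ∀ x, P.obj x ⟶ Q.obj x) where
  iso {x y : X} (p : x ⟶ y) : u x ≫ Q.map p ≅ P.map p ≫ u y
  iso_id (x : X) : HEq (iso (𝟙 x)).hom (𝟙 (u x))
  iso_comp {x y z : X} (p : x ⟶ y) (q : y ⟶ z) : HEq (iso (p ≫ q)) (pasteH (iso p) (iso q))
  natural {x y : X} {p q : x ⟶ y} (η : p ⟶ q) :
    u x ◁ Q.map₂ η ≫ (iso q).hom = (iso p).hom ≫ P.map₂ η ▷ u y

namespace PseudoNat

section Basic

variable {X : Type u₁} [Bicategory.{w₁, v₁} X] {D : Type u₂} [Bicategory.{w₂, v₂} D]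

/-- The invertible square on a composite 1-cell obtained by horizontal pasting. -/
def mulSquare (P Q : TwoFunctor X D) {x y z : X} {p : x ⟶ y} {q : y ⟶ z}
    {u : P.obj x ⟶ Q.obj x} {u' : P.obj y ⟶ Q.obj y} {u'' : P.obj z ⟶ Q.obj z}
    (s : u ≫ Q.map p ≅ P.map p ≫ u') (t : u' ≫ Q.map q ≅ P.map q ≫ u'') :
    u ≫ Q.map (p ≫ q) ≅ P.map (p ≫ q) ≫ u'' :=
  eqToIso (by rw [Q.map_comp]) ≪≫ pasteH s t ≪≫ eqToIso (by rw [P.map_comp])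

theorem mulSquare_heq (P Q : TwoFunctor X D) {x y z : X} {p : x ⟶ y} {q : y ⟶ z}
    {u : P.obj x ⟶ Q.obj x} {u' : P.obj y ⟶ Q.obj y} {u'' : P.obj z ⟶ Q.obj z}
    (s : u ≫ Q.map p ≅ P.map p ≫ u') (t : u' ≫ Q.map q ≅ P.map q ≫ u'') :
    HEq (mulSquare P Q s t) (pasteH s t) :=
  eqToIso_conj_heq _ _ _

theorem mulSquare_whiskerLeft {P Q : TwoFunctor X D} {x y z : X} {p : x ⟶ y} {q q' : y ⟶ z}
    {u : P.obj x ⟶ Q.obj x} {u' : P.obj y ⟶ Q.obj y} {u'' : P.obj z ⟶ Q.obj z}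
    (s : u ≫ Q.map p ≅ P.map p ≫ u') {t : u' ≫ Q.map q ≅ P.map q ≫ u''}
    {t' : u' ≫ Q.map q' ≅ P.map q' ≫ u''} {η : q ⟶ q'}
    (h : u' ◁ Q.map₂ η ≫ t'.hom = t.hom ≫ P.map₂ η ▷ u'') :
    u ◁ Q.map₂ (p ◁ η) ≫ (mulSquare P Q s t').hom =
      (mulSquare P Q s t).hom ≫ P.map₂ (p ◁ η) ▷ u'' := by
  have e := pasteH_whiskerLeft s h
  simp [mulSquare, P.map₂_whisker_left, Q.map₂_whisker_left, reassoc_of% e]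

theorem mulSquare_whiskerRight {P Q : TwoFunctor X D} {x y z : X} {p p' : x ⟶ y} {q : y ⟶ z}
    {u : P.obj x ⟶ Q.obj x} {u' : P.obj y ⟶ Q.obj y} {u'' : P.obj z ⟶ Q.obj z}
    {s : u ≫ Q.map p ≅ P.map p ≫ u'} {s' : u ≫ Q.map p' ≅ P.map p' ≫ u'}
    (t : u' ≫ Q.map q ≅ P.map q ≫ u'') {η : p ⟶ p'}
    (h : u ◁ Q.map₂ η ≫ s'.hom = s.hom ≫ P.map₂ η ▷ u') :
    u ◁ Q.map₂ (η ▷ q) ≫ (mulSquare P Q s' t).hom =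
      (mulSquare P Q s t).hom ≫ P.map₂ (η ▷ q) ▷ u'' := by
  have e := pasteH_whiskerRight t h
  simp only [mulSquare, P.map₂_whisker_right, Q.map₂_whisker_right, Iso.trans_hom, eqToIso.hom,
    Bicategory.whiskerLeft_comp, comp_whiskerRight, whiskerLeft_eqToHom, eqToHom_whiskerRight,
    Category.assoc, eqToHom_trans_assoc, eqToHom_refl, Category.id_comp, reassoc_of% e]

/-- The image of a pseudonatural transformation under a 2-functor. -/
def map {D' : Type u₃} [Bicategory.{w₃, v₃} D'] [Strict D] [Strict D'] {P Q : TwoFunctor X D}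
    {u : ∀ x, P.obj x ⟶ Q.obj x} (T : PseudoNat P Q u) (F : TwoFunctor D D') :
    PseudoNat (P.comp F) (Q.comp F) (fun x => F.map (u x)) where
  iso p := F.mapSquare (T.iso p)
  iso_id x := by
    refine (F.mapSquare_hom_heq _).trans ((F.map₂_heq rfl rfl ?_ ?_ (T.iso_id x)).trans
      (heq_of_eq (F.map₂_id _)))
    · rw [Q.map_id, Strict.comp_id]
    · rw [P.map_id, Strict.id_comp]
  iso_comp p q := by
    refine HEq.trans ?_ (F.mapSquare_pasteH (T.iso p) (T.iso q))
    refine F.mapSquare_heq rfl rfl (P.map_comp p q) (Q.map_comp p q) (T.iso_comp p q)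
  natural η := by
    have e := congrArg F.map₂ (T.natural η)
    rw [F.map₂_comp, F.map₂_comp, F.map₂_whisker_left, F.map₂_whisker_right] at e
    have e' := eqToHom (F.map_comp _ _).symm ≫= e =≫ eqToHom (F.map_comp _ _)
    simpa [TwoFunctor.mapSquare] using e'

end Basic

/-! ### Pseudonatural transformations out of the Gray tensor product -/

section Gray

open GrayTensor

variable {A : Type u₁} [Bicategory.{w₁, v₁} A] {B : Type u₂} [Bicategory.{w₂, v₂} B]

/-- The 2-cells `Σ_{-,k}`, as a pseudonatural transformation. -/
def sigmaNat (A : Type u₁) [Bicategory.{w₁, v₁} A] {b b' : B} (k : b ⟶ b') :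
    PseudoNat (leftFunctor A b) (leftFunctor A b') (fun a => right a k) where
  iso f := sigmaIso f k
  iso_id a := sigma_id_left_heq a k
  iso_comp f f' := iso_heq (congrArg (right _ k ≫ ·) (left_comp f f' b'))
    (congrArg (· ≫ right _ k) (left_comp f f' b))
    ((sigma_comp_left_heq f f' k).trans (pasteH_hom_heq (sigmaIso f k) (sigmaIso f' k)).symm)
  natural α := sigma_natural_left α k

variable {D : Type u₃} [Bicategory.{w₃, v₃} D] [Strict D]

/-- A pseudonatural transformation between 2-functors out of `A ⊗ B` is determined by its values
on generating 1-cells. -/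
theorem exists_of_generators {P Q : TwoFunctor (GrayTensor A B) D} {u : ∀ x, P.obj x ⟶ Q.obj x}
    (l : ∀ b, PseudoNat ((leftFunctor A b).comp P) ((leftFunctor A b).comp Q)
      (fun a => u ⟨a, b⟩))
    (r : ∀ a, PseudoNat ((rightFunctor a B).comp P) ((rightFunctor a B).comp Q)
      (fun b => u ⟨a, b⟩))
    (hs : ∀ {a a' : A} {b b' : B} (f : a ⟶ a') (g : b ⟶ b'),
      -- The pasted squares and the squares on the composite 1-cells have propositionally equal
      -- boundaries. Passing `s` and `t` as witnesses lets an application choose representatives for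
      -- which those boundaries agree by definition.
      ∃ (s : u ⟨a, b⟩ ≫ Q.map (left f b ≫ right a' g) ≅
          P.map (left f b ≫ right a' g) ≫ u ⟨a', b'⟩)
        (t : u ⟨a, b⟩ ≫ Q.map (right a g ≫ left f b') ≅
          P.map (right a g ≫ left f b') ≫ u ⟨a', b'⟩),
        HEq s (pasteH ((l b).iso f) ((r a').iso g)) ∧
        HEq t (pasteH ((r a).iso g) ((l b').iso f)) ∧
        u ⟨a, b⟩ ◁ Q.map₂ (sigma f g) ≫ s.hom = t.hom ≫ P.map₂ (sigma f g) ▷ u ⟨a', b'⟩) :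
    ∃ T : PseudoNat P Q u,
      (∀ {a a' : A} (f : a ⟶ a') (b : B), T.iso (left f b) = (l b).iso f) ∧
      (∀ (a : A) {b b' : B} (g : b ⟶ b'), T.iso (right a g) = (r a).iso g) := by
  have one_eq (x : GrayTensor A B) : u x ≫ Q.map (𝟙 x) = P.map (𝟙 x) ≫ u x := by
    rw [Q.map_id, P.map_id, Strict.comp_id, Strict.id_comp]
  have one_heq (x : GrayTensor A B) : HEq (eqToIso (one_eq x)).hom (𝟙 (u x)) :=
    (eqToHom_heq_id_dom _ _ (one_eq x)).trans (id₂_heq_id₂ rfl rfl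
      (heq_of_eq (by rw [Q.map_id, Strict.comp_id])))
  -- The invertible squares over `p` form a family with a unit and an associative multiplication
  -- given by pasting, so values on generators extend to every 1-cell.
  obtain ⟨s, s_id, s_comp, s_l, s_r⟩ := exists_section
    (M := fun {x y} p => (u x ≫ Q.map p ≅ P.map p ≫ u y))
    (fun x => eqToIso (one_eq x)) (fun s t => mulSquare P Q s t)
    (fun m => (mulSquare_heq P Q _ _).trans
      (pasteH_id_left (P.map_id _) (Q.map_id _) (one_heq _) m))
    (fun m => (mulSquare_heq P Q _ _).trans
      (pasteH_id_right (P.map_id _) (Q.map_id _) m (one_heq _)))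
    (fun m n o => by
      refine (mulSquare_heq P Q _ _).trans ((pasteH_heq_pasteH rfl rfl rfl (P.map_comp _ _) rfl
        (Q.map_comp _ _) rfl (mulSquare_heq P Q m n) HEq.rfl).trans ((pasteH_assoc m n o).trans ?_))
      exact ((mulSquare_heq P Q _ _).trans (pasteH_heq_pasteH rfl rfl rfl rfl (P.map_comp _ _) rfl
        (Q.map_comp _ _) HEq.rfl (mulSquare_heq P Q n o))).symm)
    (fun f b => (l b).iso f) (fun a _ _ g => (r a).iso g)
    (fun a b => by
      refine iso_heq ?_ ?_ (((l b).iso_id a).trans (one_heq ⟨a, b⟩).symm)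
      · simp only [leftFunctor, GrayTensor.left_id]
      · simp only [leftFunctor, GrayTensor.left_id])
    (fun f f' b => ((l b).iso_comp f f').trans
      (mulSquare_heq P Q ((l b).iso f) ((l b).iso f')).symm)
    (fun a b => by
      refine iso_heq ?_ ?_ (((r a).iso_id b).trans (one_heq ⟨a, b⟩).symm)
      · simp only [rightFunctor, GrayTensor.right_id]
      · simp only [rightFunctor, GrayTensor.right_id])
    (fun a _ _ _ g g' => ((r a).iso_comp g g').trans
      (mulSquare_heq P Q ((r a).iso g) ((r a).iso g')).symm)
  have natural_sigma {a a' : A} {b b' : B} (f : a ⟶ a') (g : b ⟶ b') :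
      u ⟨a, b⟩ ◁ Q.map₂ (sigma f g) ≫ (s (left f b ≫ right a' g)).hom =
        (s (right a g ≫ left f b')).hom ≫ P.map₂ (sigma f g) ▷ u ⟨a', b'⟩ := by
    obtain ⟨s₁, s₂, h₁, h₂, h⟩ := hs f g
    rw [s_comp, s_comp, s_l, s_r, s_l, s_r]
    obtain rfl := eq_of_heq (h₁.trans (mulSquare_heq P Q ((l b).iso f) ((r a').iso g)).symm)
    obtain rfl := eq_of_heq (h₂.trans (mulSquare_heq P Q ((r a).iso g) ((l b').iso f)).symm)
    exact h
  refine ⟨⟨s, fun x => ?_, fun p q => ?_, fun η => ?_⟩, s_l, s_r⟩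
  · rw [s_id]; exact one_heq x
  · rw [s_comp]; exact mulSquare_heq P Q _ _
  -- Naturality is stable under vertical composition, whiskering and inversion. On the generators
  -- from `A` and `B` it is inherited from `l` and `r`, so `Σ` is the only new condition.
  · induction η using hom₂_induction with
    | left₂ α b => rw [s_l, s_l]; exact (l b).natural α
    | right₂ a β => rw [s_r, s_r]; exact (r a).natural β
    | sigma f g => exact natural_sigma f g
    | sigmaInv f g =>
      refine comp_eq_comp_of_inverse ?_ ?_ (natural_sigma f g)
      · rw [← Bicategory.whiskerLeft_comp, ← Q.map₂_comp, sigmaInv_sigma]; simp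
      · rw [← comp_whiskerRight, ← P.map₂_comp, sigma_sigmaInv]; simp
    | id p => simp
    | vcomp η θ hη hθ => simp [hθ, reassoc_of% hη]
    | whiskerLeft p η h => rw [s_comp, s_comp]; exact mulSquare_whiskerLeft _ h
    | whiskerRight η q h => rw [s_comp, s_comp]; exact mulSquare_whiskerRight _ h

/-- The family `m` is a modification as soon as it is one at generating 1-cells. It will give
naturality of the associator's `Σ_{p,h}` in `h`. -/
theorem whisker_of_generators {P Q : TwoFunctor (GrayTensor A B) D}
    {u u' : ∀ x, P.obj x ⟶ Q.obj x} (T : PseudoNat P Q u) (T' : PseudoNat P Q u')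
    (m : ∀ x, u x ⟶ u' x)
    (hl : ∀ {a a' : A} (f : a ⟶ a') (b : B), m ⟨a, b⟩ ▷ Q.map (left f b) ≫
      (T'.iso (left f b)).hom = (T.iso (left f b)).hom ≫ P.map (left f b) ◁ m ⟨a', b⟩)
    (hr : ∀ (a : A) {b b' : B} (g : b ⟶ b'), m ⟨a, b⟩ ▷ Q.map (right a g) ≫
      (T'.iso (right a g)).hom = (T.iso (right a g)).hom ≫ P.map (right a g) ◁ m ⟨a, b'⟩)
    {x y : GrayTensor A B} (p : x ⟶ y) :
    m x ▷ Q.map p ≫ (T'.iso p).hom = (T.iso p).hom ≫ P.map p ◁ m y := by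
  induction p using hom_induction with
  | left f b => exact hl f b
  | right a g => exact hr a g
  | id x => exact square_id_whisker (P.map_id x) (Q.map_id x) (T.iso_id x) (T'.iso_id x) (m x)
  | comp p q hp hq =>
    exact square_whisker_congr (P.map_comp p q) (Q.map_comp p q) (T.iso_comp p q)
      (T'.iso_comp p q) (pasteH_whisker hp hq)

/-- A pasting of identity squares is an identity square. It will give the associator's value at
`Σ_{p,1}`. -/
theorem hom_heq_id_of_generators {P : TwoFunctor (GrayTensor A B) D}
    {u : ∀ x, P.obj x ⟶ P.obj x} (T : PseudoNat P P u) (hu : ∀ x, u x = 𝟙 _)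
    (hl : ∀ {a a' : A} (f : a ⟶ a') (b : B),
      HEq (T.iso (left f b)).hom (𝟙 (P.map (left f b))))
    (hr : ∀ (a : A) {b b' : B} (g : b ⟶ b'),
      HEq (T.iso (right a g)).hom (𝟙 (P.map (right a g))))
    {x y : GrayTensor A B} (p : x ⟶ y) : HEq (T.iso p).hom (𝟙 (P.map p)) := by
  induction p using hom_induction with
  | left f b => exact hl f b
  | right a g => exact hr a g
  | id x => exact (T.iso_id x).trans (id₂_heq_id₂ rfl rfl (heq_of_eq (by rw [hu, P.map_id])))
  | comp p q hp hq =>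
    refine HEq.trans ?_ ((pasteH_hom_heq_id (hu _) (hu _) (hu _) hp hq).trans
      (id₂_heq_id₂ rfl rfl (heq_of_eq (P.map_comp p q).symm)))
    exact iso_hom_heq (by rw [P.map_comp]) (by rw [P.map_comp]) (T.iso_comp p q)

/-- A pseudonatural transformation that is the vertical composite of two others on generators is so
everywhere; composites of 1-cells are handled by the interchange `pasteH_pasteV`. It will give the
associator's value at `Σ_{p,hh'}`. -/
theorem pasteV_of_generators {P Q R : TwoFunctor (GrayTensor A B) D}
    {u : ∀ x, P.obj x ⟶ Q.obj x} {u' : ∀ x, Q.obj x ⟶ R.obj x} {u'' : ∀ x, P.obj x ⟶ R.obj x}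
    (T : PseudoNat P Q u) (T' : PseudoNat Q R u') (T'' : PseudoNat P R u'')
    (hu : ∀ x, u'' x = u x ≫ u' x)
    (hl : ∀ {a a' : A} (f : a ⟶ a') (b : B), HEq (T''.iso (left f b))
      (pasteV (T.iso (left f b)) (T'.iso (left f b))))
    (hr : ∀ (a : A) {b b' : B} (g : b ⟶ b'), HEq (T''.iso (right a g))
      (pasteV (T.iso (right a g)) (T'.iso (right a g))))
    {x y : GrayTensor A B} (p : x ⟶ y) :
    HEq (T''.iso p) (pasteV (T.iso p) (T'.iso p)) := by
  induction p using hom_induction with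
  | left f b => exact hl f b
  | right a g => exact hr a g
  | id x =>
    refine iso_heq (by rw [hu]) (by rw [hu]) ((T''.iso_id x).trans ?_)
    rw [hu]
    exact (pasteV_id (P.map_id x) (Q.map_id x) (R.map_id x) (T.iso_id x) (T'.iso_id x)).symm
  | comp p q hp hq =>
    refine (T''.iso_comp p q).trans ((pasteH_heq_pasteH (hu _) (hu _) (hu _) rfl rfl rfl rfl hp
      hq).trans ((heq_of_eq (pasteH_pasteV _ _ _ _)).trans (HEq.symm ?_)))
    exact pasteV_heq_pasteV (P.map_comp p q) (Q.map_comp p q) (R.map_comp p q) (T.iso_comp p q)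
      (T'.iso_comp p q)

end Gray

end PseudoNat

/-! ### The associator -/

namespace GrayTensor

variable {A : Type u₁} [Bicategory.{w₁, v₁} A] {B : Type u₂} [Bicategory.{w₂, v₂} B]
  {C : Type u₃} [Bicategory.{w₃, v₃} C]

/-- The 2-functor `A ⊗ (- ⊗ c) : A ⊗ B ⥤ A ⊗ (B ⊗ C)`. -/
abbrev mapLeftFunctor (A : Type u₁) [Bicategory.{w₁, v₁} A] (B : Type u₂)
    [Bicategory.{w₂, v₂} B] (c : C) : TwoFunctor (GrayTensor A B) (GrayTensor A (GrayTensor B C)) :=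
  map (TwoFunctor.id A) (leftFunctor B c)

/-- The image of an invertible square under the 2-functor `a ⊗ -`. -/
def rightSquare (a : A) {x x' y y' : B} {u : x ⟶ y} {u' : x' ⟶ y'} {f : x ⟶ x'} {g : y ⟶ y'}
    (s : u ≫ g ≅ f ≫ u') : right a u ≫ right a g ≅ right a f ≫ right a u' :=
  (rightFunctor a B).mapSquare s

theorem rightSquare_hom (a : A) {x x' y y' : B} {u : x ⟶ y} {u' : x' ⟶ y'} {f : x ⟶ x'}
    {g : y ⟶ y'} (s : u ≫ g ≅ f ≫ u') : (rightSquare a s).hom =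
      eqToHom (right_comp a u g).symm ≫ right₂ a s.hom ≫ eqToHom (right_comp a f u') :=
  rfl

/-- The hexagon relating the two ways to move cells of three factors past one another. It is the
only obstruction to extending the associator's `Σ_{p,h}` from generators to all `p`. -/
theorem sigma_pasteH_sigma {a a' : A} {b b' : B} {c c' : C} (f : a ⟶ a') (g : b ⟶ b')
    (h : c ⟶ c') :
    right a (right b h) ◁ sigma f (left g c') ≫
      (pasteH (sigmaIso f (right b h)) (rightSquare a' (sigmaIso g h))).hom =
    (pasteH (rightSquare a (sigmaIso g h)) (sigmaIso f (right b' h))).hom ≫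
      sigma f (left g c) ▷ right a' (right b' h) := by
  -- Naturality of `Σ_{f,-}` is applied to the 2-cell `Σ_{g,h}` of `B ⊗ C`. Its source and target
  -- are composite 1-cells, so each `Σ` in the equation splits into two and the six sides of the
  -- hexagon appear.
  have e := sigma_natural_right f (sigma g h)
  rw [sigma_comp_right, sigma_comp_right] at e
  have h₁ : right a (right b h) ≫ right a (left g c') ≫ left f (⟨b', c'⟩ : GrayTensor B C) =
      right a (right b h ≫ left g c') ≫ left f (⟨b', c'⟩ : GrayTensor B C) := by
    rw [right_comp, Strict.assoc]
  have h₂ : left f (⟨b, c⟩ : GrayTensor B C) ≫ right a' (left g c ≫ right b' h) =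
      (left f (⟨b, c⟩ : GrayTensor B C) ≫ right a' (left g c)) ≫ right a' (right b' h) := by
    rw [right_comp, Strict.assoc]
  have e' := eqToHom h₁ ≫= e =≫ eqToHom h₂
  simp only [pasteH, Iso.trans_hom, Iso.symm_hom, whiskerLeftIso_hom, whiskerRightIso_hom,
    rightSquare_hom, sigmaIso_hom, Strict.associator_eqToIso, eqToIso.hom, eqToIso.inv]
  simp at e' ⊢
  exact e'.symm

/-- Along `A` the transformation is `Σ_{-,1⊗h}`; along `B` it is the image of `Σ_{-,h}` under `a ⊗
-`. The hexagon says that they fit together. -/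
theorem exists_assocNat (A : Type u₁) [Bicategory.{w₁, v₁} A] (B : Type u₂)
    [Bicategory.{w₂, v₂} B] {c c' : C} (h : c ⟶ c') :
    ∃ T : PseudoNat (mapLeftFunctor A B c) (mapLeftFunctor A B c')
        (fun x => right x.1 (right x.2 h)),
      (∀ {a a' : A} (f : a ⟶ a') (b : B), T.iso (left f b) = sigmaIso f (right b h)) ∧
      (∀ (a : A) {b b' : B} (g : b ⟶ b'), T.iso (right a g) =
        rightSquare a (sigmaIso g h)) :=
  PseudoNat.exists_of_generators (P := mapLeftFunctor A B c) (Q := mapLeftFunctor A B c')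
    (u := fun x => right x.1 (right x.2 h)) (fun b => PseudoNat.sigmaNat A (right b h))
    (fun a => (PseudoNat.sigmaNat B h).map (rightFunctor a (GrayTensor B C)))
    (fun f g => ⟨_, _, HEq.rfl, HEq.rfl, sigma_pasteH_sigma f g h⟩)

theorem sigmaIso_comp_heq {a a' : A} {b b' b'' : B} (f : a ⟶ a') (g : b ⟶ b') (g' : b' ⟶ b'') :
    HEq (sigmaIso f (g ≫ g')) (pasteV (sigmaIso f g) (sigmaIso f g')) :=
  iso_heq (congrArg (· ≫ left f b'') (right_comp a g g'))
    (congrArg (left f b ≫ ·) (right_comp a' g g'))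
    ((sigma_comp_right_heq f g g').trans (pasteV_hom_heq (sigmaIso f g) (sigmaIso f g')).symm)

theorem rightSquare_hom_heq (a : A) {x x' y y' : B} {u : x ⟶ y} {u' : x' ⟶ y'}
    {f : x ⟶ x'} {g : y ⟶ y'} (s : u ≫ g ≅ f ≫ u') :
    HEq (rightSquare a s).hom (right₂ a s.hom) :=
  (rightFunctor a B).mapSquare_hom_heq s

/-- The 2-functor `a ⊗ -` preserves the modification condition, up to the comparison of composites
which `rightSquare` absorbs. -/
theorem rightSquare_whisker (a : A) {x x' y y' : B} {u v : x ⟶ y} {u' v' : x' ⟶ y'}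
    {f : x ⟶ x'} {g : y ⟶ y'} {s : u ≫ g ≅ f ≫ u'} {t : v ≫ g ≅ f ≫ v'} {m : u ⟶ v}
    {m' : u' ⟶ v'} (h : m ▷ g ≫ t.hom = s.hom ≫ f ◁ m') :
    right₂ a m ▷ right a g ≫ (rightSquare a t).hom =
      (rightSquare a s).hom ≫ right a f ◁ right₂ a m' := by
  have e : right₂ a (m ▷ g ≫ t.hom) = right₂ a (s.hom ≫ f ◁ m') := congrArg (right₂ a) h
  have c₁ : right₂ a (m ▷ g ≫ t.hom) = right₂ a (m ▷ g) ≫ right₂ a t.hom :=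
    (rightFunctor a B).map₂_comp _ _
  have c₂ : right₂ a (s.hom ≫ f ◁ m') = right₂ a s.hom ≫ right₂ a (f ◁ m') :=
    (rightFunctor a B).map₂_comp _ _
  have w₁ : right₂ a (m ▷ g) = eqToHom (right_comp a u g) ≫ right₂ a m ▷ right a g ≫
      eqToHom (right_comp a v g).symm := (rightFunctor a B).map₂_whisker_right m g
  have w₂ : right₂ a (f ◁ m') = eqToHom (right_comp a f u') ≫ right a f ◁ right₂ a m' ≫
      eqToHom (right_comp a f v').symm := (rightFunctor a B).map₂_whisker_left f m'
  rw [c₁, c₂, w₁, w₂] at e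
  have e' := eqToHom (right_comp a u g).symm ≫= e =≫ eqToHom (right_comp a f v')
  simpa [rightSquare_hom] using e'

/-- The 2-cells `Σ_{-,h}` of the associator, as a pseudonatural transformation. -/
noncomputable def assocNat (A : Type u₁) [Bicategory.{w₁, v₁} A] (B : Type u₂)
    [Bicategory.{w₂, v₂} B] {c c' : C} (h : c ⟶ c') :
    PseudoNat (mapLeftFunctor A B c) (mapLeftFunctor A B c') (fun x => right x.1 (right x.2 h)) :=
  (exists_assocNat A B h).choose

theorem assocNat_left {c c' : C} (h : c ⟶ c') {a a' : A} (f : a ⟶ a') (b : B) :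
    (assocNat A B h).iso (left f b) = sigmaIso f (right b h) :=
  (exists_assocNat A B h).choose_spec.1 f b

theorem assocNat_right {c c' : C} (h : c ⟶ c') (a : A) {b b' : B} (g : b ⟶ b') :
    (assocNat A B h).iso (right a g) = rightSquare a (sigmaIso g h) :=
  (exists_assocNat A B h).choose_spec.2 a g

theorem assocNat_whisker {c c' : C} {h h' : c ⟶ c'} (γ : h ⟶ h') {x y : GrayTensor A B}
    (p : x ⟶ y) : right₂ x.1 (right₂ x.2 γ) ▷ (mapLeftFunctor A B c').map p ≫
      ((assocNat A B h').iso p).hom =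
    ((assocNat A B h).iso p).hom ≫ (mapLeftFunctor A B c).map p ◁ right₂ y.1 (right₂ y.2 γ) := by
  refine PseudoNat.whisker_of_generators (assocNat A B h) (assocNat A B h')
    (fun x => right₂ x.1 (right₂ x.2 γ)) (fun f b => ?_) (fun a _ _ g => ?_) p
  · rw [assocNat_left, assocNat_left]; exact sigma_natural_right f (right₂ b γ)
  · rw [assocNat_right, assocNat_right]
    exact rightSquare_whisker a (s := sigmaIso g h) (t := sigmaIso g h') (sigma_natural_right g γ)

theorem assocNat_id (c : C) {x y : GrayTensor A B} (p : x ⟶ y) :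
    HEq ((assocNat A B (𝟙 c)).iso p).hom (𝟙 ((mapLeftFunctor A B c).map p)) := by
  refine PseudoNat.hom_heq_id_of_generators (assocNat A B (𝟙 c)) (fun x => ?_) (fun f b => ?_)
    (fun a _ _ g => ?_) p
  · exact (congrArg (right x.1) (right_id x.2 c)).trans (right_id x.1 _)
  · rw [assocNat_left, sigmaIso_hom, right_id]; exact sigma_id_right_heq f _
  · rw [assocNat_right]
    refine (rightSquare_hom_heq a (sigmaIso g (𝟙 c))).trans
      (((rightFunctor a (GrayTensor B C)).map₂_heq rfl rfl ?_ ?_ (sigma_id_right_heq g c)).trans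
        (heq_of_eq ((rightFunctor a (GrayTensor B C)).map₂_id _)))
    · rw [right_id, Strict.id_comp]
    · rw [right_id, Strict.comp_id]

theorem assocNat_comp {c c' c'' : C} (h : c ⟶ c') (h' : c' ⟶ c'') {x y : GrayTensor A B}
    (p : x ⟶ y) : HEq ((assocNat A B (h ≫ h')).iso p)
      (pasteV ((assocNat A B h).iso p) ((assocNat A B h').iso p)) := by
  refine PseudoNat.pasteV_of_generators (assocNat A B h) (assocNat A B h')
    (assocNat A B (h ≫ h')) (fun x => ?_) (fun f b => ?_) (fun a b b' g => ?_) p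
  · exact (congrArg (right x.1) (right_comp x.2 h h')).trans (right_comp x.1 _ _)
  · rw [assocNat_left, assocNat_left, assocNat_left]
    exact (congr_arg_heq (fun k => sigmaIso f k) (right_comp b h h')).trans
      (sigmaIso_comp_heq f (right b h) (right b h'))
  · rw [assocNat_right, assocNat_right, assocNat_right]
    exact ((rightFunctor a (GrayTensor B C)).mapSquare_heq (right_comp b h h')
      (right_comp b' h h') rfl rfl (sigmaIso_comp_heq g h h')).trans
        ((rightFunctor a (GrayTensor B C)).mapSquare_pasteV (sigmaIso g h) (sigmaIso g h'))

/-- The associator `(A ⊗ B) ⊗ C ⥤ A ⊗ (B ⊗ C)` on cells of `A ⊗ B` and `C`. -/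
noncomputable def assocData (A : Type u₁) [Bicategory.{w₁, v₁} A] (B : Type u₂)
    [Bicategory.{w₂, v₂} B] (C : Type u₃) [Bicategory.{w₃, v₃} C] :
    GrayData (GrayTensor A B) C (GrayTensor A (GrayTensor B C)) where
  obj x c := ⟨x.1, ⟨x.2, c⟩⟩
  left p c := (mapLeftFunctor A B c).map p
  right x _ _ h := right x.1 (right x.2 h)
  left₂ η c := (mapLeftFunctor A B c).map₂ η
  right₂ x _ _ _ _ γ := right₂ x.1 (right₂ x.2 γ)
  sigma p h := (assocNat A B h).iso p
  left_id x c := (mapLeftFunctor A B c).map_id x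
  left_comp p q c := (mapLeftFunctor A B c).map_comp p q
  right_id x c := ((rightFunctor x.2 C).comp (rightFunctor x.1 (GrayTensor B C))).map_id c
  right_comp x _ _ _ h h' :=
    ((rightFunctor x.2 C).comp (rightFunctor x.1 (GrayTensor B C))).map_comp h h'
  left₂_id p c := (mapLeftFunctor A B c).map₂_id p
  left₂_comp η θ c := (mapLeftFunctor A B c).map₂_comp η θ
  left₂_whiskerLeft p _ _ η c := (mapLeftFunctor A B c).map₂_whiskerLeft_heq p η
  left₂_whiskerRight η q c := (mapLeftFunctor A B c).map₂_whiskerRight_heq η q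
  right₂_id x _ _ h := ((rightFunctor x.2 C).comp (rightFunctor x.1 (GrayTensor B C))).map₂_id h
  right₂_comp x _ _ _ _ _ γ γ' :=
    ((rightFunctor x.2 C).comp (rightFunctor x.1 (GrayTensor B C))).map₂_comp γ γ'
  right₂_whiskerLeft x _ _ _ h _ _ γ :=
    ((rightFunctor x.2 C).comp (rightFunctor x.1 (GrayTensor B C))).map₂_whiskerLeft_heq h γ
  right₂_whiskerRight x _ _ _ _ _ γ h :=
    ((rightFunctor x.2 C).comp (rightFunctor x.1 (GrayTensor B C))).map₂_whiskerRight_heq γ h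
  sigma_natural_left η h := (assocNat A B h).natural η
  sigma_natural_right p _ _ γ := assocNat_whisker γ p
  sigma_id_left x _ _ h := (assocNat A B h).iso_id x
  sigma_id_right p c := assocNat_id c p
  sigma_comp_left {x y z _ _} p q h := by
    refine HEq.trans (iso_hom_heq ?_ ?_ ((assocNat A B h).iso_comp p q)) (pasteH_hom_heq _ _)
    · exact congrArg (right x.1 (right x.2 h) ≫ ·) ((mapLeftFunctor A B _).map_comp p q)
    · exact congrArg (· ≫ right z.1 (right z.2 h)) ((mapLeftFunctor A B _).map_comp p q)
  sigma_comp_right {x y _ _ _} p h h' := by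
    refine HEq.trans (iso_hom_heq ?_ ?_ (assocNat_comp h h' p)) (pasteV_hom_heq _ _)
    · exact congrArg (· ≫ (mapLeftFunctor A B _).map p)
        (((rightFunctor x.2 C).comp (rightFunctor x.1 (GrayTensor B C))).map_comp h h')
    · exact congrArg ((mapLeftFunctor A B _).map p ≫ ·)
        (((rightFunctor y.2 C).comp (rightFunctor y.1 (GrayTensor B C))).map_comp h h')

/-- The associator `(A ⊗ B) ⊗ C ⥤ A ⊗ (B ⊗ C)`. -/
noncomputable def assoc (A : Type u₁) [Bicategory.{w₁, v₁} A] (B : Type u₂)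
    [Bicategory.{w₂, v₂} B] (C : Type u₃) [Bicategory.{w₃, v₃} C] :
    TwoFunctor (GrayTensor (GrayTensor A B) C) (GrayTensor A (GrayTensor B C)) :=
  (assocData A B C).lift

theorem assoc_map₂_sigma {x y : GrayTensor A B} (p : x ⟶ y) {c c' : C} (h : c ⟶ c') :
    (assoc A B C).map₂ (sigma p h) = ((assocNat A B h).iso p).hom := rfl

theorem isAssociator_assoc : IsAssociator (assoc A B C) where
  obj _ _ _ := rfl
  map_left_left _ _ _ := HEq.rfl
  map_left_right _ _ _ _ _ := HEq.rfl
  map_right _ _ _ _ _ := HEq.rfl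
  map₂_left₂_left₂ _ _ _ := HEq.rfl
  map₂_left₂_right₂ _ _ _ _ _ _ _ := HEq.rfl
  map₂_right₂ _ _ _ _ _ _ _ := HEq.rfl
  map₂_left₂_sigma _ _ _ := HEq.rfl
  -- The squares of `assocNat` come from an existence statement and do not reduce, so the two
  -- remaining values of `Σ` follow from their specification instead of by reflexivity.
  map₂_sigma_left f b c c' h := by
    rw [assoc_map₂_sigma, assocNat_left]; rfl
  map₂_sigma_right a b b' g c c' h := by
    rw [assoc_map₂_sigma, assocNat_right]
    exact rightSquare_hom_heq a (sigmaIso g h)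

end GrayTensor

/-! ### Equality of 2-functors out of iterated Gray tensor products -/

theorem TwoFunctor.map₂_eqToHom_heq {A : Type u₁} [Bicategory.{w₁, v₁} A] {B : Type u₂}
    [Bicategory.{w₂, v₂} B] (F : TwoFunctor A B) {a b : A} {f g : a ⟶ b} (h : f = g) :
    HEq (F.map₂ (eqToHom h)) (𝟙 (F.map f)) := by
  subst h; exact heq_of_eq (F.map₂_id f)

namespace GrayTensor

section Ext

variable {A : Type u₁} [Bicategory.{w₁, v₁} A] {B : Type u₂} [Bicategory.{w₂, v₂} B]
  {C : Type u₃} [Bicategory.{w₃, v₃} C] {D : Type u₄} [Bicategory.{w₄, v₄} D]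

/-- The 2-functors `H` and `H'` agree on `Σ_{p,h}` for all `h`. -/
def SigmaAgree (H H' : TwoFunctor (GrayTensor A B) D) {a a' : A} (p : a ⟶ a') : Prop :=
  ∀ {b b' : B} (h : b ⟶ b'), HEq (H.map₂ (sigma p h)) (H'.map₂ (sigma p h))

/-- With `sigmaAgree_comp`, this shows that the 1-cells `p` for which two 2-functors agree on every
`Σ_{p,h}` are closed under identities and composition. Agreement therefore has to be tested only on
generating `p`. -/
theorem sigmaAgree_id {H H' : TwoFunctor (GrayTensor A B) D} (hobj : ∀ x, H.obj x = H'.obj x)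
    (hmap : ∀ {x y : GrayTensor A B} (p : x ⟶ y), HEq (H.map p) (H'.map p)) (a : A) :
    SigmaAgree H H' (𝟙 a) := by
  intro b b' h
  have e (K : TwoFunctor (GrayTensor A B) D) :
      HEq (K.map₂ (sigma (𝟙 a) h)) (K.map₂ (𝟙 (right a h))) :=
    K.map₂_heq rfl rfl (heq_of_eq (by rw [left_id, Strict.comp_id]))
      (heq_of_eq (by rw [left_id, Strict.id_comp])) (sigma_id_left_heq a h)
  refine (e H).trans (HEq.trans ?_ (e H').symm)
  rw [H.map₂_id, H'.map₂_id]
  exact id₂_heq_id₂ (hobj _) (hobj _) (hmap _)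

theorem sigmaAgree_comp {H H' : TwoFunctor (GrayTensor A B) D} (hobj : ∀ x, H.obj x = H'.obj x)
    (hmap : ∀ {x y : GrayTensor A B} (p : x ⟶ y), HEq (H.map p) (H'.map p))
    {a a' a'' : A} {p : a ⟶ a'} {q : a' ⟶ a''} (hp : SigmaAgree H H' p)
    (hq : SigmaAgree H H' q) : SigmaAgree H H' (p ≫ q) := by
  intro b b' h
  have e (K : TwoFunctor (GrayTensor A B) D) :
      HEq (K.map₂ (sigma (p ≫ q) h)) (K.map₂ (sigma p h ▷ left q b' ≫ (α_ _ _ _).hom ≫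
        left p b ◁ sigma q h)) :=
    K.map₂_heq rfl rfl (heq_of_eq (by rw [left_comp, Strict.assoc]))
      (heq_of_eq (by rw [left_comp, Strict.assoc])) (sigma_comp_left_heq p q h)
  refine (e H).trans (HEq.trans ?_ (e H').symm)
  rw [H.map₂_comp, H.map₂_comp, H'.map₂_comp, H'.map₂_comp]
  refine vcomp_heq_vcomp (hobj _) (hobj _) (hmap _) (hmap _) (hmap _) ?_
    (vcomp_heq_vcomp (hobj _) (hobj _) (hmap _) (hmap _) (hmap _) ?_ ?_)
  · exact (H.map₂_whiskerRight_heq _ _).trans ((whiskerRight_heq_whiskerRight (hobj _) (hobj _)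
      (hobj _) (hmap _) (hmap _) (hmap _) (hp h)).trans (H'.map₂_whiskerRight_heq _ _).symm)
  · simp only [Strict.associator_eqToIso, eqToIso.hom]
    exact (H.map₂_eqToHom_heq _).trans ((id₂_heq_id₂ (hobj _) (hobj _) (hmap _)).trans
      (H'.map₂_eqToHom_heq _).symm)
  · exact (H.map₂_whiskerLeft_heq _ _).trans ((whiskerLeft_heq_whiskerLeft (hobj _) (hobj _)
      (hobj _) (hmap _) (hmap _) (hmap _) (hq h)).trans (H'.map₂_whiskerLeft_heq _ _).symm)

theorem map_heq_of_functors {H H' : TwoFunctor (GrayTensor A B) D}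
    (hl : ∀ b, (leftFunctor A b).comp H = (leftFunctor A b).comp H')
    (hr : ∀ a, (rightFunctor a B).comp H = (rightFunctor a B).comp H')
    {x y : GrayTensor A B} (p : x ⟶ y) : HEq (H.map p) (H'.map p) :=
  map_heq_of_generators (fun x => TwoFunctor.congr_obj (hl x.2) x.1)
    (fun f b => TwoFunctor.congr_map (hl b) f) (fun a _ _ g => TwoFunctor.congr_map (hr a) g) p

/-- The hypotheses run over the generators of a triple tensor product: cells of each factor, and one
kind of `Σ` for each pair of factors. Closure of `SigmaAgree` reduces the outer `Σ_{p,h}` to `p`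
coming from `A` or from `B`. -/
theorem functor_ext₃ {H H' : TwoFunctor (GrayTensor (GrayTensor A B) C) D}
    (h₁ : ∀ b c, (leftFunctor A b).comp ((leftFunctor (GrayTensor A B) c).comp H) =
      (leftFunctor A b).comp ((leftFunctor (GrayTensor A B) c).comp H'))
    (h₂ : ∀ a c, (rightFunctor a B).comp ((leftFunctor (GrayTensor A B) c).comp H) =
      (rightFunctor a B).comp ((leftFunctor (GrayTensor A B) c).comp H'))
    (h₃ : ∀ x, (rightFunctor x C).comp H = (rightFunctor x C).comp H')
    (h₁₂ : ∀ {a a' : A} {b b' : B} (f : a ⟶ a') (g : b ⟶ b') (c : C),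
      HEq (H.map₂ (left₂ (sigma f g) c)) (H'.map₂ (left₂ (sigma f g) c)))
    (h₁₃ : ∀ {a a' : A} (f : a ⟶ a') (b : B) {c c' : C} (h : c ⟶ c'),
      HEq (H.map₂ (sigma (left f b) h)) (H'.map₂ (sigma (left f b) h)))
    (h₂₃ : ∀ (a : A) {b b' : B} (g : b ⟶ b') {c c' : C} (h : c ⟶ c'),
      HEq (H.map₂ (sigma (right a g) h)) (H'.map₂ (sigma (right a g) h))) : H = H' := by
  have hl (c : C) : (leftFunctor (GrayTensor A B) c).comp H =
      (leftFunctor (GrayTensor A B) c).comp H' :=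
    functor_ext (fun b => h₁ b c) (fun a => h₂ a c) (fun f g => h₁₂ f g c)
  have hobj (x) : H.obj x = H'.obj x := TwoFunctor.congr_obj (hl x.2) x.1
  have hmap {x y} (p : x ⟶ y) : HEq (H.map p) (H'.map p) := map_heq_of_functors hl h₃ p
  have key {x y : GrayTensor A B} (p : x ⟶ y) : SigmaAgree H H' p := by
    induction p using hom_induction with
    | left f b => exact fun h => h₁₃ f b h
    | right a g => exact fun h => h₂₃ a g h
    | id x => exact sigmaAgree_id hobj hmap x
    | comp p q hp hq => exact sigmaAgree_comp hobj hmap hp hq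
  exact functor_ext hl h₃ (fun p h => key p h)

end Ext

/-- Agreement on the first three factors is left as a hypothesis, to be supplied by `functor_ext₃`;
what remains are the `Σ` cells pairing one of them with the fourth. -/
theorem functor_ext₄ {A : Type u₁} [Bicategory.{w₁, v₁} A] {B : Type u₂} [Bicategory.{w₂, v₂} B]
    {C : Type u₃} [Bicategory.{w₃, v₃} C] {C' : Type u₄} [Bicategory.{w₄, v₄} C']
    {D : Type u} [Bicategory.{w, v} D]
    {H H' : TwoFunctor (GrayTensor (GrayTensor (GrayTensor A B) C) C') D}
    (hl : ∀ d, (leftFunctor (GrayTensor (GrayTensor A B) C) d).comp H =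
      (leftFunctor (GrayTensor (GrayTensor A B) C) d).comp H')
    (hr : ∀ x, (rightFunctor x C').comp H = (rightFunctor x C').comp H')
    (h₁ : ∀ {a a' : A} (f : a ⟶ a') (b : B) (c : C) {d d' : C'} (k : d ⟶ d'),
      HEq (H.map₂ (sigma (left (left f b) c) k)) (H'.map₂ (sigma (left (left f b) c) k)))
    (h₂ : ∀ (a : A) {b b' : B} (g : b ⟶ b') (c : C) {d d' : C'} (k : d ⟶ d'),
      HEq (H.map₂ (sigma (left (right a g) c) k)) (H'.map₂ (sigma (left (right a g) c) k)))
    (h₃ : ∀ (x : GrayTensor A B) {c c' : C} (h : c ⟶ c') {d d' : C'} (k : d ⟶ d'),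
      HEq (H.map₂ (sigma (right x h) k)) (H'.map₂ (sigma (right x h) k))) : H = H' := by
  have hobj (x) : H.obj x = H'.obj x := TwoFunctor.congr_obj (hl x.2) x.1
  have hmap {x y} (p : x ⟶ y) : HEq (H.map p) (H'.map p) := map_heq_of_functors hl hr p
  have key₁ {x y : GrayTensor A B} (p : x ⟶ y) (c : C) : SigmaAgree H H' (left p c) := by
    induction p using hom_induction with
    | left f b => exact fun k => h₁ f b c k
    | right a g => exact fun k => h₂ a g c k
    | id x => rw [left_id]; exact sigmaAgree_id hobj hmap _
    | comp p q hp hq => rw [left_comp]; exact sigmaAgree_comp hobj hmap hp hq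
  have key {x y : GrayTensor (GrayTensor A B) C} (p : x ⟶ y) : SigmaAgree H H' p := by
    induction p using hom_induction with
    | left p c => exact key₁ p c
    | right x h => exact fun k => h₃ x h k
    | id x => exact sigmaAgree_id hobj hmap x
    | comp p q hp hq => exact sigmaAgree_comp hobj hmap hp hq
  exact functor_ext hl hr (fun p k => key p k)

end GrayTensor

/-! ### Naturality and invertibility of the associator -/

namespace GrayTensor

section Assoc

variable {A : Type u₁} [Bicategory.{w₁, v₁} A] {B : Type u₂} [Bicategory.{w₂, v₂} B]
  {C : Type u₃} [Bicategory.{w₃, v₃} C]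

theorem assoc_map₂_sigma_left {a a' : A} (f : a ⟶ a') (b : B) {c c' : C} (h : c ⟶ c') :
    (assoc A B C).map₂ (sigma (left f b) h) = sigma f (right b h) := by
  rw [assoc_map₂_sigma, assocNat_left]; rfl

theorem assoc_map₂_sigma_right (a : A) {b b' : B} (g : b ⟶ b') {c c' : C} (h : c ⟶ c') :
    HEq ((assoc A B C).map₂ (sigma (right a g) h)) (right₂ a (sigma g h)) :=
  isAssociator_assoc.map₂_sigma_right a g h

theorem assoc_map₂_sigmaInv_left {a a' : A} (f : a ⟶ a') (b : B) {c c' : C} (h : c ⟶ c') :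
    (assoc A B C).map₂ (sigmaInv (left f b) h) = sigmaInv f (right b h) :=
  congrArg Iso.inv (assocNat_left h f b)

/-- The equality is heterogeneous because `1 ⊗ -` of a composite is only propositionally the
composite of the images. Uniqueness of inverses transfers it from `Σ`. -/
theorem assoc_map₂_sigmaInv_right (a : A) {b b' : B} (g : b ⟶ b') {c c' : C} (h : c ⟶ c') :
    HEq ((assoc A B C).map₂ (sigmaInv (right a g) h)) (right₂ a (sigmaInv g h)) := by
  refine inverse_heq_inverse rfl rfl (heq_of_eq ?_) (heq_of_eq ?_) ?_ ?_
    (assoc_map₂_sigma_right a g h)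
  · exact (right_comp a _ _).symm
  · exact (right_comp a _ _).symm
  · exact ((assoc A B C).map₂_comp _ _).symm.trans ((congrArg (assoc A B C).map₂
      (sigmaInv_sigma _ _)).trans ((assoc A B C).map₂_id _))
  · exact ((rightFunctor a (GrayTensor B C)).map₂_comp _ _).symm.trans
      ((congrArg (right₂ a) (sigma_sigmaInv g h)).trans
        ((rightFunctor a (GrayTensor B C)).map₂_id _))

variable (A B C)

/-- The 2-functor `A ⊗ (B ⊗ C) ⥤ (C ⊗ B) ⊗ A` reversing the order of the factors. -/
def reverse : TwoFunctor (GrayTensor A (GrayTensor B C)) (GrayTensor (GrayTensor C B) A) :=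
  (symm A (GrayTensor B C)).comp (map (symm B C) (TwoFunctor.id A))

/-- The 2-functor `(C ⊗ B) ⊗ A ⥤ A ⊗ (B ⊗ C)` reversing the order of the factors. -/
def reverseInv : TwoFunctor (GrayTensor (GrayTensor C B) A) (GrayTensor A (GrayTensor B C)) :=
  (map (symm C B) (TwoFunctor.id A)).comp (symm (GrayTensor B C) A)

theorem reverse_reverseInv : (reverse A B C).comp (reverseInv A B C) = TwoFunctor.id _ := by
  change (symm A (GrayTensor B C)).comp (((map (symm B C) (TwoFunctor.id A)).comp
    (map (symm C B) (TwoFunctor.id A))).comp (symm (GrayTensor B C) A)) = _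
  rw [← map_comp, symm_comp_symm]
  change (symm A (GrayTensor B C)).comp ((map (TwoFunctor.id _) (TwoFunctor.id A)).comp
    (symm (GrayTensor B C) A)) = _
  rw [map_id]
  exact symm_comp_symm _ _

-- Reversal exchanges the outer factors and inverts `Σ`. Following a generator around, `Σ` is
-- inverted twice and re-bracketed back, so it returns to itself. This single identity yields both
-- inverse laws for the associator.
set_option maxHeartbeats 1000000 in
theorem assoc_reverse_assoc_reverse :
    ((assoc A B C).comp (reverse A B C)).comp ((assoc C B A).comp (reverse C B A)) =
      TwoFunctor.id _ := by
  refine functor_ext₃ (fun _ _ => rfl) (fun _ _ => rfl) (fun _ => rfl) (fun f g c => ?_)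
    (fun f b _ _ h => ?_) (fun a _ _ g _ _ h => ?_)
  -- Here `Σ_{f,g} ⊗ 1` has become `Σ_{f,g⊗1}` and then, by reversal, the inverse of `Σ_{1⊗g,f}`,
  -- which the second associator sends to `1 ⊗ Σ_{g,f}⁻¹`.
  · change HEq ((reverse C B A).map₂ ((assoc C B A).map₂ (sigmaInv (right c g) f))) _
    exact (reverse C B A).map₂_heq rfl rfl (heq_of_eq (right_comp c _ _).symm)
      (heq_of_eq (right_comp c _ _).symm) (assoc_map₂_sigmaInv_right c g f)
  · change HEq ((reverse C B A).map₂ ((assoc C B A).map₂ ((reverse A B C).map₂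
      ((assoc A B C).map₂ (sigma (left f b) h))))) _
    rw [assoc_map₂_sigma_left]
    change HEq ((reverse C B A).map₂ ((assoc C B A).map₂ (sigmaInv (left h b) f))) _
    rw [assoc_map₂_sigmaInv_left]
    rfl
  · refine (((reverse A B C).comp ((assoc C B A).comp (reverse C B A))).map₂_heq rfl rfl
      (heq_of_eq (right_comp a _ _).symm) (heq_of_eq (right_comp a _ _).symm)
      (assoc_map₂_sigma_right a g h)).trans ?_
    change HEq ((reverse C B A).map₂ ((assoc C B A).map₂ (left₂ (sigmaInv h g) a))) _
    change HEq ((reverse C B A).map₂ (sigmaInv h (left g a))) _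
    rfl

/-- The inverse of the associator. -/
noncomputable def assocInv :
    TwoFunctor (GrayTensor A (GrayTensor B C)) (GrayTensor (GrayTensor A B) C) :=
  ((reverse A B C).comp (assoc C B A)).comp (reverse C B A)

theorem assoc_assocInv : (assoc A B C).comp (assocInv A B C) = TwoFunctor.id _ :=
  assoc_reverse_assoc_reverse A B C

/-- The previous identity with the roles of `A` and `C` exchanged, conjugated by the reversal;
invertibility of the reversal then cancels the outer copies. -/
theorem assocInv_assoc : (assocInv A B C).comp (assoc A B C) = TwoFunctor.id _ := by
  have e := congrArg (fun K => (reverse A B C).comp (K.comp (reverseInv A B C)))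
    (assoc_reverse_assoc_reverse C B A)
  have e' := congrArg (fun K => ((assocInv A B C).comp (assoc A B C)).comp K)
    (reverse_reverseInv A B C)
  exact e'.symm.trans (e.trans (reverse_reverseInv A B C))

end Assoc

/-- Only `Σ` pairing `C` with `A` or with `B` involves the opaque squares of `assocNat`; on every
other generator the two sides agree by definition. -/
theorem assoc_natural {A : Type u} [Bicategory.{w, v} A] {B : Type u} [Bicategory.{w, v} B]
    {C : Type u} [Bicategory.{w, v} C] {A' : Type u} [Bicategory.{w, v} A'] {B' : Type u}
    [Bicategory.{w, v} B'] {C' : Type u} [Bicategory.{w, v} C'] (F : TwoFunctor A A')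
    (G : TwoFunctor B B') (K : TwoFunctor C C') :
    (map (map F G) K).comp (assoc A' B' C') = (assoc A B C).comp (map F (map G K)) := by
  refine functor_ext₃ (fun _ _ => rfl) (fun _ _ => rfl) (fun _ => rfl) (fun f g c => HEq.rfl)
    (fun f b _ _ h => ?_) (fun a _ _ g _ _ h => ?_)
  · change HEq ((assoc A' B' C').map₂ (sigma (left (F.map f) (G.obj b)) (K.map h)))
      ((map F (map G K)).map₂ ((assoc A B C).map₂ (sigma (left f b) h)))
    rw [assoc_map₂_sigma_left, assoc_map₂_sigma_left]
    rfl
  · refine (assoc_map₂_sigma_right (F.obj a) (G.map g) (K.map h)).trans (HEq.symm ?_)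
    exact (map F (map G K)).map₂_heq rfl rfl (heq_of_eq (right_comp a _ _).symm)
      (heq_of_eq (right_comp a _ _).symm) (assoc_map₂_sigma_right a g h)

/-- Both composites push all brackets to the right. Each `Σ` of two factors becomes the same `Σ`,
suitably tensored with identities; each case traces one such cell along the two routes. -/
theorem assoc_pentagon {A : Type u} [Bicategory.{w, v} A] {B : Type u} [Bicategory.{w, v} B]
    {C : Type u} [Bicategory.{w, v} C] {D : Type u} [Bicategory.{w, v} D] :
    (map (assoc A B C) (TwoFunctor.id D)).comp ((assoc A (GrayTensor B C) D).comp
      (map (TwoFunctor.id A) (assoc B C D))) =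
    (assoc (GrayTensor A B) C D).comp (assoc A B (GrayTensor C D)) := by
  refine functor_ext₄ (fun d => ?_) (fun x => rfl) (fun f b c _ _ k => ?_)
    (fun a _ _ g c _ _ k => ?_) (fun x _ _ h _ _ k => ?_)
  · refine functor_ext₃ (fun _ _ => rfl) (fun _ _ => rfl) (fun _ => rfl) (fun f g c => HEq.rfl)
      (fun f b _ _ h => ?_) (fun a _ _ g _ _ h => ?_)
    · change HEq ((map (TwoFunctor.id A) (assoc B C D)).map₂ ((assoc A (GrayTensor B C) D).map₂
        (left₂ ((assoc A B C).map₂ (sigma (left f b) h)) d)))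
        ((assoc A B (GrayTensor C D)).map₂ (sigma (left f b) (left h d)))
      rw [assoc_map₂_sigma_left, assoc_map₂_sigma_left]
      rfl
    · refine HEq.trans ?_ (assoc_map₂_sigma_right a g (left h d)).symm
      refine (((leftFunctor (GrayTensor A (GrayTensor B C)) d).comp ((assoc A (GrayTensor B C) D).comp
        (map (TwoFunctor.id A) (assoc B C D)))).map₂_heq rfl rfl
        (heq_of_eq (right_comp a _ _).symm) (heq_of_eq (right_comp a _ _).symm)
        (assoc_map₂_sigma_right a g h)).trans ?_
      rfl
  · change HEq ((map (TwoFunctor.id A) (assoc B C D)).map₂ ((assoc A (GrayTensor B C) D).map₂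
        (sigma (left f (⟨b, c⟩ : GrayTensor B C)) k)))
        ((assoc A B (GrayTensor C D)).map₂ ((assoc (GrayTensor A B) C D).map₂
          (sigma (left (left f b) c) k)))
    rw [assoc_map₂_sigma_left, assoc_map₂_sigma_left]
    change HEq (sigma f ((assoc B C D).map (right (⟨b, c⟩ : GrayTensor B C) k)))
      ((assoc A B (GrayTensor C D)).map₂ (sigma (left f b) (right c k)))
    rw [assoc_map₂_sigma_left]
    rfl
  · change HEq ((map (TwoFunctor.id A) (assoc B C D)).map₂ ((assoc A (GrayTensor B C) D).map₂
        (sigma (right a (left g c)) k)))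
        ((assoc A B (GrayTensor C D)).map₂ ((assoc (GrayTensor A B) C D).map₂
          (sigma (left (right a g) c) k)))
    rw [assoc_map₂_sigma_left]
    refine HEq.trans ?_ (assoc_map₂_sigma_right a g (right c k)).symm
    refine ((map (TwoFunctor.id A) (assoc B C D)).map₂_heq rfl rfl
        (heq_of_eq (right_comp a _ _).symm) (heq_of_eq (right_comp a _ _).symm)
        (assoc_map₂_sigma_right a (left g c) k)).trans ?_
    change HEq (right₂ a ((assoc B C D).map₂ (sigma (left g c) k))) _
    rw [assoc_map₂_sigma_left]
    rfl
  · obtain ⟨a, b⟩ := x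
    change HEq ((map (TwoFunctor.id A) (assoc B C D)).map₂ ((assoc A (GrayTensor B C) D).map₂
        (sigma (right a (right b h)) k)))
        ((assoc A B (GrayTensor C D)).map₂ ((assoc (GrayTensor A B) C D).map₂
          (sigma (right (⟨a, b⟩ : GrayTensor A B) h) k)))
    refine ((map (TwoFunctor.id A) (assoc B C D)).map₂_heq rfl rfl
        (heq_of_eq (right_comp a _ _).symm) (heq_of_eq (right_comp a _ _).symm)
        (assoc_map₂_sigma_right a (right b h) k)).trans ?_
    refine HEq.trans ?_ ((assoc A B (GrayTensor C D)).map₂_heq rfl rfl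
        (heq_of_eq (right_comp _ _ _).symm) (heq_of_eq (right_comp _ _ _).symm)
        (assoc_map₂_sigma_right (⟨a, b⟩ : GrayTensor A B) h k)).symm
    -- On both routes the `Σ` pairing the third and fourth factors ends as `1 ⊗ (1 ⊗ Σ_{h,k})`.
    exact (rightFunctor a (GrayTensor B (GrayTensor C D))).map₂_heq rfl rfl
        (heq_of_eq (right_comp _ _ _).symm) (heq_of_eq (right_comp _ _ _).symm)
        (assoc_map₂_sigma_right b h k)

end GrayTensor

/-! ### The unitors -/

namespace GrayTensor

theorem projSnd_map₂_sigma {A : Type u₁} [Bicategory.{w₁, v₁} A] {B : Type u₂}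
    [Bicategory.{w₂, v₂} B] [Strict B] {a a' : A} {b b' : B} (f : a ⟶ a') (g : b ⟶ b') :
    HEq ((projSnd A B).map₂ (sigma f g)) (𝟙 g) := by
  change HEq (eqToHom ((Strict.comp_id g).trans (Strict.id_comp g).symm)) (𝟙 g)
  exact (eqToHom_heq_id_dom _ _ _).trans (id₂_heq_id₂ rfl rfl (heq_of_eq (Strict.comp_id g)))

theorem projSnd_map₂_sigmaInv {A : Type u₁} [Bicategory.{w₁, v₁} A] {B : Type u₂}
    [Bicategory.{w₂, v₂} B] [Strict B] {a a' : A} {b b' : B} (f : a ⟶ a') (g : b ⟶ b') :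
    HEq ((projSnd A B).map₂ (sigmaInv f g)) (𝟙 g) := by
  change HEq (eqToHom ((Strict.comp_id g).trans (Strict.id_comp g).symm).symm) (𝟙 g)
  exact (eqToHom_heq_id_dom _ _ _).trans (id₂_heq_id₂ rfl rfl (heq_of_eq (Strict.id_comp g)))

/-- Cells of `A` become identities; the comparison is not definitional only because `G` preserves
identities propositionally. -/
theorem map_comp_projSnd {A : Type u₁} [Bicategory.{w₁, v₁} A] {A' : Type u₂}
    [Bicategory.{w₂, v₂} A'] {B : Type u₃} [Bicategory.{w₃, v₃} B] [Strict B] {B' : Type u₄}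
    [Bicategory.{w₄, v₄} B'] [Strict B'] (F : TwoFunctor A A') (G : TwoFunctor B B') :
    (map F G).comp (projSnd A' B') = (projSnd A B).comp G := by
  refine functor_ext (fun b => TwoFunctor.ext_heq (fun _ => rfl) (fun f => ?_) (fun α => ?_))
    (fun a => rfl) (fun f g => ?_)
  · exact heq_of_eq (G.map_id b).symm
  · change HEq (𝟙 (𝟙 (G.obj b))) (G.map₂ (𝟙 (𝟙 b)))
    rw [G.map₂_id, G.map_id]
  · refine (projSnd_map₂_sigma (F.map f) (G.map g)).trans (HEq.symm ?_)
    exact (G.map₂_heq rfl rfl (heq_of_eq (Strict.comp_id g)) (heq_of_eq (Strict.id_comp g))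
      (projSnd_map₂_sigma f g)).trans (heq_of_eq (G.map₂_id g))

/-- The terminal 2-category. -/
abbrev Point : Type u := LocallyDiscrete (Discrete PUnit.{u + 1})

/-- The object of the terminal 2-category. -/
abbrev point : Point.{u} := ⟨⟨PUnit.unit⟩⟩

variable (A : Type u₁) [Bicategory.{w₁, v₁} A] [Strict A]

/-- Every cell of the terminal 2-category is an identity, so `f ⊗ 1` and `α ⊗ 1` are identities, and
the relation for `Σ_{1,g}` makes that cell an identity too. -/
theorem projSnd_comp_rightFunctor :
    (projSnd Point.{u} A).comp (rightFunctor point A) = TwoFunctor.id (GrayTensor Point.{u} A) := by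
  refine functor_ext (fun b => TwoFunctor.ext_heq (fun _ => rfl) (fun {a a'} f => ?_)
    (fun {a a'} f f' α => ?_)) (fun a => rfl) (fun {a a' b b'} f g => ?_)
  · obtain ⟨⟨⟨⟩⟩⟩ := a; obtain ⟨⟨⟨⟩⟩⟩ := a'
    obtain rfl : f = 𝟙 _ := rfl
    exact heq_of_eq ((right_id _ _).trans (left_id _ _).symm)
  · obtain ⟨⟨⟨⟩⟩⟩ := a; obtain ⟨⟨⟨⟩⟩⟩ := a'
    obtain rfl : f = 𝟙 _ := rfl
    obtain rfl : f' = 𝟙 _ := rfl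
    obtain rfl : α = 𝟙 _ := rfl
    refine (heq_of_eq ((rightFunctor _ A).map₂_id _)).trans
      (HEq.trans ?_ (heq_of_eq ((leftFunctor _ b).map₂_id _)).symm)
    exact id₂_heq_id₂ rfl rfl (heq_of_eq ((right_id _ _).trans (left_id _ _).symm))
  · obtain ⟨⟨⟨⟩⟩⟩ := a; obtain ⟨⟨⟨⟩⟩⟩ := a'
    obtain rfl : f = 𝟙 _ := rfl
    refine HEq.trans ?_ (sigma_id_left_heq _ g).symm
    exact ((rightFunctor _ A).map₂_heq rfl rfl (heq_of_eq (Strict.comp_id g))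
      (heq_of_eq (Strict.id_comp g)) (projSnd_map₂_sigma _ g)).trans
      (heq_of_eq ((rightFunctor _ A).map₂_id g))

theorem rightFunctor_comp_projSnd :
    (rightFunctor point A).comp (projSnd Point.{u} A) = TwoFunctor.id A := rfl

/-- Terminality of the middle factor plays no role: for any `B` both sides project it away, and
every `Σ` involving `B` becomes an identity on either side. -/
theorem assoc_triangle (A : Type u₁) [Bicategory.{w₁, v₁} A] [Strict A] (B : Type u₂)
    [Bicategory.{w₂, v₂} B] (C : Type u₃) [Bicategory.{w₃, v₃} C] [Strict C] :
    (assoc A B C).comp (map (TwoFunctor.id A) (projSnd B C)) =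
      map ((symm A B).comp (projSnd B A)) (TwoFunctor.id C) := by
  refine functor_ext₃ (fun _ _ => rfl) (fun a c => TwoFunctor.ext_heq (fun _ => rfl)
    (fun g => ?_) (fun β => ?_)) (fun x => rfl) (fun f g c => ?_) (fun f b _ _ h => ?_)
    (fun a _ _ g _ _ h => ?_)
  · exact heq_of_eq ((right_id _ _).trans (left_id _ _).symm)
  · refine (heq_of_eq ((rightFunctor a C).map₂_id _)).trans
      (HEq.trans ?_ (heq_of_eq ((leftFunctor A c).map₂_id _)).symm)
    exact id₂_heq_id₂ rfl rfl (heq_of_eq ((right_id _ _).trans (left_id _ _).symm))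
  · change HEq (sigma f (𝟙 c)) (left₂ ((projSnd B A).map₂ (sigmaInv g f)) c)
    refine (sigma_id_right_heq _ _).trans (HEq.symm ?_)
    exact ((leftFunctor A c).map₂_heq rfl rfl (heq_of_eq (Strict.id_comp f))
      (heq_of_eq (Strict.comp_id f)) (projSnd_map₂_sigmaInv _ f)).trans
      (heq_of_eq ((leftFunctor A c).map₂_id f))
  · change HEq ((map (TwoFunctor.id A) (projSnd B C)).map₂ ((assoc A B C).map₂
      (sigma (left f b) h))) _
    rw [assoc_map₂_sigma_left]
    rfl
  · refine ((map (TwoFunctor.id A) (projSnd B C)).map₂_heq rfl rfl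
      (heq_of_eq (right_comp _ _ _).symm) (heq_of_eq (right_comp _ _ _).symm)
      (assoc_map₂_sigma_right a g h)).trans ?_
    change HEq (right₂ a ((projSnd B C).map₂ (sigma g h))) (sigma (𝟙 a) h)
    refine HEq.trans ?_ (sigma_id_left_heq _ h).symm
    exact ((rightFunctor a C).map₂_heq rfl rfl (heq_of_eq (Strict.comp_id h))
      (heq_of_eq (Strict.id_comp h)) (projSnd_map₂_sigma _ h)).trans
      (heq_of_eq ((rightFunctor a C).map₂_id h))

end GrayTensor

/-! ### Icons between 2-functors out of the Gray tensor product -/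

namespace Icon

section MulCell

variable {C : Type u} [Bicategory.{w, v} C]

/-- The horizontal composite of two icon components. -/
def mulCell {x x' y y' z z' : C} (hx : x' = x) (hy : y' = y) (hz : z' = z) {f : x ⟶ y}
    {f' : x' ⟶ y'} {g : y ⟶ z} {g' : y' ⟶ z'} (a : f ⟶ homCast hx hy f')
    (b : g ⟶ homCast hy hz g') : f ≫ g ⟶ homCast hx hz (f' ≫ g') :=
  (a ▷ g ≫ homCast hx hy f' ◁ b) ≫ eqToHom (homCast_comp hx hy hz f' g').symm

theorem mulCell_heq_mulCell {x x' y y' z z' : C} (hx : x' = x) (hy : y' = y) (hz : z' = z)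
    {f₁ f₂ : x ⟶ y} {f₁' f₂' : x' ⟶ y'} {g₁ g₂ : y ⟶ z} {g₁' g₂' : y' ⟶ z'} (hf : f₁ = f₂)
    (hf' : f₁' = f₂') (hg : g₁ = g₂) (hg' : g₁' = g₂') {a₁ : f₁ ⟶ homCast hx hy f₁'}
    {a₂ : f₂ ⟶ homCast hx hy f₂'} {b₁ : g₁ ⟶ homCast hy hz g₁'} {b₂ : g₂ ⟶ homCast hy hz g₂'}
    (ha : HEq a₁ a₂) (hb : HEq b₁ b₂) : HEq (mulCell hx hy hz a₁ b₁) (mulCell hx hy hz a₂ b₂) := by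
  subst hf hf' hg hg'; cases ha; cases hb; rfl

/-- With `whiskerRight_mulCell`, this propagates naturality of icon components to whiskered 2-cells,
by interchange. -/
theorem whiskerLeft_mulCell {x x' y y' z z' : C} (hx : x' = x) (hy : y' = y) (hz : z' = z)
    {f : x ⟶ y} {f' : x' ⟶ y'} {g₁ g₂ : y ⟶ z} {g₁' g₂' : y' ⟶ z'} (a : f ⟶ homCast hx hy f')
    {b₁ : g₁ ⟶ homCast hy hz g₁'} {b₂ : g₂ ⟶ homCast hy hz g₂'} {θ : g₁ ⟶ g₂} {θ' : g₁' ⟶ g₂'}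
    (h : θ ≫ b₂ = b₁ ≫ homCast₂ hy hz θ') :
    f ◁ θ ≫ mulCell hx hy hz a b₂ = mulCell hx hy hz a b₁ ≫ homCast₂ hx hz (f' ◁ θ') := by
  cases hx; cases hy; cases hz
  simp only [mulCell, eqToHom_refl, Category.comp_id, Category.assoc] at h ⊢
  rw [Bicategory.whisker_exchange_assoc, ← whiskerLeft_comp, h, whiskerLeft_comp]

theorem whiskerRight_mulCell {x x' y y' z z' : C} (hx : x' = x) (hy : y' = y) (hz : z' = z)
    {f₁ f₂ : x ⟶ y} {f₁' f₂' : x' ⟶ y'} {g : y ⟶ z} {g' : y' ⟶ z'}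
    {a₁ : f₁ ⟶ homCast hx hy f₁'} {a₂ : f₂ ⟶ homCast hx hy f₂'} (b : g ⟶ homCast hy hz g')
    {η : f₁ ⟶ f₂} {η' : f₁' ⟶ f₂'} (h : η ≫ a₂ = a₁ ≫ homCast₂ hx hy η') :
    η ▷ g ≫ mulCell hx hy hz a₂ b = mulCell hx hy hz a₁ b ≫ homCast₂ hx hz (η' ▷ g') := by
  cases hx; cases hy; cases hz
  simp only [mulCell, eqToHom_refl, Category.comp_id, Category.assoc] at h ⊢
  rw [← comp_whiskerRight_assoc, h, comp_whiskerRight_assoc]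
  exact congrArg (a₁ ▷ g ≫ ·) (Bicategory.whisker_exchange η' b).symm

variable [Strict C]

theorem one_mulCell_heq {x x' y y' : C} (hx : x' = x) (hy : y' = y) {g : x ⟶ y} {g' : x' ⟶ y'}
    (b : g ⟶ homCast hx hy g') :
    HEq (mulCell hx hx hy (eqToHom (homCast_id hx hx).symm) b) b := by
  cases hx; cases hy
  simp only [mulCell, eqToHom_refl, Category.comp_id, Bicategory.id_whiskerRight,
    Category.id_comp]
  exact id_whiskerLeft_heq b

theorem mulCell_one_heq {x x' y y' : C} (hx : x' = x) (hy : y' = y) {f : x ⟶ y} {f' : x' ⟶ y'}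
    (a : f ⟶ homCast hx hy f') :
    HEq (mulCell hx hy hy a (eqToHom (homCast_id hy hy).symm)) a := by
  cases hx; cases hy
  simp only [mulCell, eqToHom_refl, Category.comp_id, Bicategory.whiskerLeft_id]
  exact whiskerRight_id_heq a

theorem mulCell_assoc_heq {x x' y y' z z' t t' : C} (hx : x' = x) (hy : y' = y) (hz : z' = z)
    (ht : t' = t) {f : x ⟶ y} {f' : x' ⟶ y'} {g : y ⟶ z} {g' : y' ⟶ z'} {k : z ⟶ t} {k' : z' ⟶ t'}
    (a : f ⟶ homCast hx hy f') (b : g ⟶ homCast hy hz g') (c : k ⟶ homCast hz ht k') :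
    HEq (mulCell hx hz ht (mulCell hx hy hz a b) c)
      (mulCell hx hy ht a (mulCell hy hz ht b c)) := by
  cases hx; cases hy; cases hz; cases ht
  simp only [mulCell, eqToHom_refl, Category.comp_id]
  have e : (a ▷ g ≫ f' ◁ b) ▷ k ≫ (f' ≫ g') ◁ c = (α_ f g k).hom ≫
      (a ▷ (g ≫ k) ≫ f' ◁ (b ▷ k ≫ g' ◁ c)) ≫ (α_ f' g' k').inv := by simp
  refine (heq_of_eq e).trans ?_
  simp only [Strict.associator_eqToIso, eqToIso.hom, eqToIso.inv]
  exact eqToHom_conj_heq _ _ _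

end MulCell

theorem app_comp_heq {A : Type u₁} [Bicategory.{w₁, v₁} A] {B : Type u₂} [Bicategory.{w₂, v₂} B]
    {F G : TwoFunctor A B} (α : Icon F G) {a b c : A} (f : a ⟶ b) (g : b ⟶ c) :
    HEq (α.app (f ≫ g)) (mulCell (α.obj_eq a).symm (α.obj_eq b).symm (α.obj_eq c).symm
      (α.app f) (α.app g)) := by
  refine (heq_of_eq ((α.app_comp f g).trans ?_)).trans (eqToHom_conj_heq (F.map_comp f g) _
    (congrArg (homCast (α.obj_eq a).symm (α.obj_eq c).symm) (G.map_comp f g).symm))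
  simp [mulCell]

end Icon

namespace GrayTensor

variable {A : Type u₁} [Bicategory.{w₁, v₁} A] {B : Type u₂} [Bicategory.{w₂, v₂} B]
  {D : Type u₃} [Bicategory.{w₃, v₃} D]

/-- An icon between 2-functors out of the Gray tensor product is determined by its components at
the generating 1-cells. -/
theorem icon_ext {H H' : TwoFunctor (GrayTensor A B) D} {γ γ' : Icon H H'}
    (hl : ∀ {a a' : A} (f : a ⟶ a') (b : B), γ.app (left f b) = γ'.app (left f b))
    (hr : ∀ (a : A) {b b' : B} (g : b ⟶ b'), γ.app (right a g) = γ'.app (right a g)) :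
    γ = γ' := by
  refine Icon.ext fun p => ?_
  induction p using hom_induction with
  | left f b => exact hl f b
  | right a g => exact hr a g
  | id x => rw [γ.app_id, γ'.app_id]
  | comp p q hp hq => rw [γ.app_comp, γ'.app_comp, hp, hq]

/-- Icons between 2-functors out of the Gray tensor product are given by icons in each variable
that are compatible with `Σ`. -/
theorem exists_icon [Strict D] {H H' : TwoFunctor (GrayTensor A B) D}
    (hobj : ∀ x, H'.obj x = H.obj x)
    (L : ∀ b, Icon ((leftFunctor A b).comp H) ((leftFunctor A b).comp H'))
    (R : ∀ a, Icon ((rightFunctor a B).comp H) ((rightFunctor a B).comp H'))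
    (hs : ∀ {a a' : A} {b b' : B} (f : a ⟶ a') (g : b ⟶ b'),
      H.map₂ (sigma f g) ≫ eqToHom (H.map_comp _ _) ≫
          Icon.mulCell (hobj ⟨a, b⟩) (hobj ⟨a', b⟩) (hobj ⟨a', b'⟩) ((L b).app f) ((R a').app g) ≫
          eqToHom (congrArg (homCast (hobj ⟨a, b⟩) (hobj ⟨a', b'⟩)) (H'.map_comp _ _).symm) =
        eqToHom (H.map_comp _ _) ≫
          Icon.mulCell (hobj ⟨a, b⟩) (hobj ⟨a, b'⟩) (hobj ⟨a', b'⟩) ((R a).app g) ((L b').app f) ≫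
          eqToHom (congrArg (homCast (hobj ⟨a, b⟩) (hobj ⟨a', b'⟩)) (H'.map_comp _ _).symm) ≫
          homCast₂ (hobj ⟨a, b⟩) (hobj ⟨a', b'⟩) (H'.map₂ (sigma f g))) :
    ∃ γ : Icon H H', (∀ {a a' : A} (f : a ⟶ a') (b : B), γ.app (left f b) = (L b).app f) ∧
      ∀ (a : A) {b b' : B} (g : b ⟶ b'), γ.app (right a g) = (R a).app g := by
  -- An icon component at `p` is an element of `M p`. Horizontal composition makes `M` a unital
  -- associative family, so components extend from generators to all 1-cells.
  let M {x y : GrayTensor A B} (p : x ⟶ y) : Type w₃ :=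
    H.map p ⟶ homCast (hobj x) (hobj y) (H'.map p)
  let one (x : GrayTensor A B) : M (𝟙 x) :=
    eqToHom (by rw [H.map_id, H'.map_id, homCast_id])
  let mul {x y z : GrayTensor A B} {p : x ⟶ y} {q : y ⟶ z} (m : M p) (n : M q) : M (p ≫ q) :=
    eqToHom (H.map_comp p q) ≫ Icon.mulCell (hobj x) (hobj y) (hobj z) m n ≫
      eqToHom (congrArg (homCast (hobj x) (hobj z)) (H'.map_comp p q).symm)
  have mul_heq {x y z : GrayTensor A B} {p : x ⟶ y} {q : y ⟶ z} (m : M p) (n : M q) :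
      HEq (mul m n) (Icon.mulCell (hobj x) (hobj y) (hobj z) m n) := eqToHom_conj_heq _ _ _
  have one_heq (x : GrayTensor A B) : HEq (one x)
      (eqToHom (homCast_id (hobj x) (hobj x)).symm) :=
    eqToHom_heq_eqToHom rfl rfl _ _ (heq_of_eq (H.map_id x))
  obtain ⟨s, s_id, s_comp, s_left, s_right⟩ := exists_section (M := M) one mul
    (fun m => (mul_heq _ _).trans ((Icon.mulCell_heq_mulCell _ _ _ (H.map_id _) (H'.map_id _) rfl
      rfl (one_heq _) HEq.rfl).trans (Icon.one_mulCell_heq _ _ m)))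
    (fun m => (mul_heq _ _).trans ((Icon.mulCell_heq_mulCell _ _ _ rfl rfl (H.map_id _)
      (H'.map_id _) HEq.rfl (one_heq _)).trans (Icon.mulCell_one_heq _ _ m)))
    (fun m n o => (mul_heq _ _).trans ((Icon.mulCell_heq_mulCell _ _ _ (H.map_comp _ _)
      (H'.map_comp _ _) rfl rfl (mul_heq _ _) HEq.rfl).trans ((Icon.mulCell_assoc_heq _ _ _ _
        m n o).trans ((mul_heq _ _).trans (Icon.mulCell_heq_mulCell _ _ _ rfl rfl (H.map_comp _ _)
          (H'.map_comp _ _) HEq.rfl (mul_heq _ _))).symm)))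
    (fun f b => (L b).app f) (fun a _ _ g => (R a).app g)
    (fun a b => (heq_of_eq ((L b).app_id a)).trans
      (eqToHom_heq_eqToHom rfl rfl _ _ (heq_of_eq (congrArg H.map (left_id a b)))))
    (fun f f' b => ((L b).app_comp_heq f f').trans ((mul_heq _ _).symm))
    (fun a b => (heq_of_eq ((R a).app_id b)).trans
      (eqToHom_heq_eqToHom rfl rfl _ _ (heq_of_eq (congrArg H.map (right_id a b)))))
    (fun a _ _ _ g g' => ((R a).app_comp_heq g g').trans ((mul_heq _ _).symm))
  -- As for pseudonatural transformations, naturality at `Σ` is the only condition not already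
  -- supplied by the icons in the separate variables.
  have natural_sigma {a a' : A} {b b' : B} (f : a ⟶ a') (g : b ⟶ b') :
      H.map₂ (sigma f g) ≫ s (left f b ≫ right a' g) = s (right a g ≫ left f b') ≫
        homCast₂ (hobj ⟨a, b⟩) (hobj ⟨a', b'⟩) (H'.map₂ (sigma f g)) := by
    rw [s_comp, s_comp, s_left, s_right, s_left, s_right]
    simp only [mul, Category.assoc]
    exact hs f g
  have natural {x y : GrayTensor A B} {p q : x ⟶ y} (η : p ⟶ q) :
      H.map₂ η ≫ s q = s p ≫ homCast₂ (hobj x) (hobj y) (H'.map₂ η) := by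
    induction η using hom₂_induction with
    | left₂ α b => rw [s_left, s_left]; exact (L b).naturality α
    | right₂ a β => rw [s_right, s_right]; exact (R a).naturality β
    | sigma f g => exact natural_sigma f g
    | sigmaInv f g =>
      refine comp_eq_comp_of_inverse ?_ ?_ (natural_sigma f g)
      · rw [← H.map₂_comp, sigmaInv_sigma, H.map₂_id]
      · rw [← homCast₂_comp, ← H'.map₂_comp, sigma_sigmaInv, H'.map₂_id, homCast₂_id]
    | id p => rw [H.map₂_id, H'.map₂_id, homCast₂_id, Category.id_comp, Category.comp_id]
    | vcomp η θ hη hθ =>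
      rw [H.map₂_comp, H'.map₂_comp, homCast₂_comp, Category.assoc, hθ, reassoc_of% hη]
    | whiskerLeft p η h =>
      rw [s_comp, s_comp, H.map₂_whisker_left, H'.map₂_whisker_left]
      simp only [mul, Category.assoc, eqToHom_trans_assoc, eqToHom_refl, Category.id_comp,
        homCast₂_comp, homCast₂_eqToHom]
      rw [reassoc_of% Icon.whiskerLeft_mulCell (hobj _) (hobj _) (hobj _) (s p) h]
    | whiskerRight η q h =>
      rw [s_comp, s_comp, H.map₂_whisker_right, H'.map₂_whisker_right]
      simp only [mul, Category.assoc, eqToHom_trans_assoc, eqToHom_refl, Category.id_comp,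
        homCast₂_comp, homCast₂_eqToHom]
      rw [reassoc_of% Icon.whiskerRight_mulCell (hobj _) (hobj _) (hobj _) (s q) h]
  refine ⟨⟨fun x => (hobj x).symm, fun p => s p, fun η => natural η, fun x => s_id x,
    fun p q => ?_⟩, fun f b => s_left f b, fun a _ _ g => s_right a g⟩
  rw [s_comp]
  simp [mul, Icon.mulCell]

end GrayTensor

/-! ### The Gray tensor product of icons -/

namespace Icon

variable {A : Type u₁} [Bicategory.{w₁, v₁} A] {B : Type u₂} [Bicategory.{w₂, v₂} B]
  {C : Type u₃} [Bicategory.{w₃, v₃} C]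

/-- An icon with its target replaced by an equal 2-functor. -/
def castTarget {F G G' : TwoFunctor A B} (α : Icon F G) (h : G = G') : Icon F G' := h ▸ α

theorem castTarget_app_heq {F G G' : TwoFunctor A B} (α : Icon F G) (h : G = G') {a b : A}
    (f : a ⟶ b) : HEq ((α.castTarget h).app f) (α.app f) := by
  subst h; rfl

theorem whiskerRight_app_heq {F G : TwoFunctor A B} (α : Icon F G) (H : TwoFunctor B C) {a b : A}
    (f : a ⟶ b) : HEq ((α.whiskerRight H).app f) (H.map₂ (α.app f)) :=
  comp_eqToHom_heq_self _ _

end Icon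

namespace GrayTensor

variable {A : Type u₁} [Bicategory.{w₁, v₁} A] {B : Type u₂} [Bicategory.{w₂, v₂} B]
  {A' : Type u₃} [Bicategory.{w₃, v₃} A'] {B' : Type u₄} [Bicategory.{w₄, v₄} B']

/-- After the object equalities are eliminated this says that `Σ` commutes with `α ⊗ 1` and `1 ⊗ β`
together: naturality in each variable, plus interchange. The cells `l` and `r` are constrained only
by `HEq` because the target of the tensored icon is indexed by the objects of the second pair of
2-functors. -/
theorem sigma_mulCell {x x' y y' : A'} {z z' t t' : B'} (hx : x' = x) (hy : y' = y) (hz : z' = z)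
    (ht : t' = t) {f : x ⟶ y} {f' : x' ⟶ y'} {g : z ⟶ t} {g' : z' ⟶ t'}
    {α : f ⟶ homCast hx hy f'} {β : g ⟶ homCast hz ht g'}
    (hxz : (⟨x', z'⟩ : GrayTensor A' B') = ⟨x, z⟩) (hyz : (⟨y', z'⟩ : GrayTensor A' B') = ⟨y, z⟩)
    (hxt : (⟨x', t'⟩ : GrayTensor A' B') = ⟨x, t⟩) (hyt : (⟨y', t'⟩ : GrayTensor A' B') = ⟨y, t⟩)
    {l : left f z ⟶ homCast hxz hyz (left f' z')} {l' : left f t ⟶ homCast hxt hyt (left f' t')}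
    {r : right x g ⟶ homCast hxz hxt (right x' g')} {r' : right y g ⟶ homCast hyz hyt (right y' g')}
    (hl : HEq l (left₂ α z)) (hl' : HEq l' (left₂ α t)) (hr : HEq r (right₂ x β))
    (hr' : HEq r' (right₂ y β)) :
    sigma f g ≫ Icon.mulCell hxz hyz hyt l r' =
      Icon.mulCell hxz hxt hyt r l' ≫ homCast₂ hxz hyt (sigma f' g') := by
  cases hx; cases hy; cases hz; cases ht; cases hl; cases hl'; cases hr; cases hr'
  simp only [Icon.mulCell, eqToHom_refl, Category.comp_id, Category.assoc]
  rw [← reassoc_of% sigma_natural_left α g, ← sigma_natural_right f' β,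
    Bicategory.whisker_exchange_assoc]

theorem exists_isIconMap {F F' : TwoFunctor A A'} {G G' : TwoFunctor B B'} (α : Icon F F')
    (β : Icon G G') : ∃ γ : Icon (map F G) (map F' G'), IsIconMap α β γ := by
  have hobj (x : GrayTensor A B) : (map F' G').obj x = (map F G).obj x :=
    congrArg₂ GrayTensor.mk (α.obj_eq x.1).symm (β.obj_eq x.2).symm
  -- Whiskering `α` by `- ⊗ G b` gives an icon ending at `F' - ⊗ G b`, whereas `F' - ⊗ G' b` is
  -- wanted; the two targets are equal because `G` and `G'` agree on objects.
  let L (b : B) : Icon ((leftFunctor A b).comp (map F G)) ((leftFunctor A b).comp (map F' G')) :=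
    (α.whiskerRight (leftFunctor A' (G.obj b))).castTarget
      (congrArg (fun c => F'.comp (leftFunctor A' c)) (β.obj_eq b))
  let R (a : A) : Icon ((rightFunctor a B).comp (map F G)) ((rightFunctor a B).comp (map F' G')) :=
    (β.whiskerRight (rightFunctor (F.obj a) B')).castTarget
      (congrArg (fun c => G'.comp (rightFunctor c B')) (α.obj_eq a))
  have hL {a a' : A} (f : a ⟶ a') (b : B) : HEq ((L b).app f) (left₂ (α.app f) (G.obj b)) :=
    (Icon.castTarget_app_heq _ _ _).trans (Icon.whiskerRight_app_heq _ _ _)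
  have hR (a : A) {b b' : B} (g : b ⟶ b') : HEq ((R a).app g) (right₂ (F.obj a) (β.app g)) :=
    (Icon.castTarget_app_heq _ _ _).trans (Icon.whiskerRight_app_heq _ _ _)
  obtain ⟨γ, hl, hr⟩ := exists_icon hobj L R fun {a a' b b'} f g => by
    have key := sigma_mulCell (α.obj_eq a).symm (α.obj_eq a').symm (β.obj_eq b).symm
      (β.obj_eq b').symm (hobj ⟨a, b⟩) (hobj ⟨a', b⟩) (hobj ⟨a, b'⟩) (hobj ⟨a', b'⟩)
      (hL f b) (hL f b') (hR a g) (hR a' g)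
    refine Eq.trans ?_ (key.trans ?_)
    · exact congrArg (sigma (F.map f) (G.map g) ≫ ·)
        ((Category.id_comp _).trans (Category.comp_id _))
    · exact ((Category.id_comp _).trans (congrArg (_ ≫ ·) (Category.id_comp _))).symm
  exact ⟨γ, fun f b => (heq_of_eq (hl f b)).trans (hL f b),
    fun a _ _ g => (heq_of_eq (hr a g)).trans (hR a g)⟩

/-- The icon `α ⊗ β`. -/
noncomputable def iconMap {F F' : TwoFunctor A A'} {G G' : TwoFunctor B B'} (α : Icon F F')
    (β : Icon G G') : Icon (map F G) (map F' G') :=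
  (exists_isIconMap α β).choose

theorem isIconMap_iconMap {F F' : TwoFunctor A A'} {G G' : TwoFunctor B B'} (α : Icon F F')
    (β : Icon G G') : IsIconMap α β (iconMap α β) :=
  (exists_isIconMap α β).choose_spec

end GrayTensor

/-! ### Compatibilities of the Gray tensor product of icons -/

namespace Icon

variable {A : Type u₁} [Bicategory.{w₁, v₁} A] {B : Type u₂} [Bicategory.{w₂, v₂} B]

/-- The 2-functors `P` and `P'` will be `- ⊗ G b` and `- ⊗ G' b`, or their counterparts in the other
variable, which are equal only through the object equality of an icon. -/
theorem homCast_map_heq {P P' : TwoFunctor A B} (hP : P' = P) {x x' y y' : A} (hx : x' = x)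
    (hy : y' = y) (hPx : P'.obj x' = P.obj x) (hPy : P'.obj y' = P.obj y) (f : x' ⟶ y') :
    HEq (homCast hPx hPy (P'.map f)) (P.map (homCast hx hy f)) := by
  cases hP; cases hx; cases hy; rfl

theorem map₂_vcomp_heq {P P' P'' : TwoFunctor A B} (hP : P' = P) (hP' : P'' = P')
    {x x' x'' y y' y'' : A} (hx : x' = x) (hx' : x'' = x') (hy : y' = y) (hy' : y'' = y')
    (hPx : P'.obj x' = P.obj x) (hPx' : P''.obj x'' = P'.obj x') (hPy : P'.obj y' = P.obj y)
    (hPy' : P''.obj y'' = P'.obj y') {f : x ⟶ y} {f' : x' ⟶ y'} {f'' : x'' ⟶ y''}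
    {α : f ⟶ homCast hx hy f'} {α' : f' ⟶ homCast hx' hy' f''}
    {l : P.map f ⟶ homCast hPx hPy (P'.map f')} {l' : P'.map f' ⟶ homCast hPx' hPy' (P''.map f'')}
    (hl : HEq l (P.map₂ α)) (hl' : HEq l' (P'.map₂ α')) :
    HEq (P.map₂ (α ≫ homCast₂ hx hy α' ≫ eqToHom (homCast_trans hx' hx hy' hy f'')))
      (l ≫ homCast₂ hPx hPy l' ≫ eqToHom (homCast_trans hPx' hPx hPy' hPy (P''.map f''))) := by
  cases hP; cases hP'; cases hx; cases hx'; cases hy; cases hy'; cases hl; cases hl'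
  simp

end Icon

namespace GrayTensor

section

variable {A : Type u₁} [Bicategory.{w₁, v₁} A] {B : Type u₂} [Bicategory.{w₂, v₂} B]
  {C : Type u₅} [Bicategory.{w₅, v₅} C] {D : Type u₃} [Bicategory.{w₃, v₃} D]

theorem icon_heq {H H' K K' : TwoFunctor (GrayTensor A B) D} (hH : H = H') (hK : K = K')
    {γ : Icon H K} {γ' : Icon H' K'}
    (hl : ∀ {a a' : A} (f : a ⟶ a') (b : B), HEq (γ.app (left f b)) (γ'.app (left f b)))
    (hr : ∀ (a : A) {b b' : B} (g : b ⟶ b'), HEq (γ.app (right a g)) (γ'.app (right a g))) :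
    HEq γ γ' := by
  subst hH hK
  exact heq_of_eq (icon_ext (fun f b => eq_of_heq (hl f b)) (fun a _ _ g => eq_of_heq (hr a g)))

theorem icon_heq₃ {H H' K K' : TwoFunctor (GrayTensor (GrayTensor A B) C) D} (hH : H = H')
    (hK : K = K') {γ : Icon H K} {γ' : Icon H' K'}
    (h₁ : ∀ {a a' : A} (f : a ⟶ a') (b : B) (c : C),
      HEq (γ.app (left (left f b) c)) (γ'.app (left (left f b) c)))
    (h₂ : ∀ (a : A) {b b' : B} (g : b ⟶ b') (c : C),
      HEq (γ.app (left (right a g) c)) (γ'.app (left (right a g) c)))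
    (h₃ : ∀ (a : A) (b : B) {c c' : C} (h : c ⟶ c'),
      HEq (γ.app (right ⟨a, b⟩ h)) (γ'.app (right ⟨a, b⟩ h))) :
    HEq γ γ' := by
  subst hH hK
  refine heq_of_eq (icon_ext (fun p c => ?_) (fun x _ _ h => eq_of_heq (h₃ x.1 x.2 h)))
  -- For fixed `c`, whiskering with `- ⊗ c` gives icons out of `A ⊗ B`, so agreement on its
  -- generators extends to every 1-cell `p`.
  have e : Icon.whiskerLeft (leftFunctor (GrayTensor A B) c) γ =
      Icon.whiskerLeft (leftFunctor (GrayTensor A B) c) γ' :=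
    icon_ext (fun f b => eq_of_heq (h₁ f b c)) (fun a _ _ g => eq_of_heq (h₂ a g c))
  change (Icon.whiskerLeft (leftFunctor (GrayTensor A B) c) γ).app p =
    (Icon.whiskerLeft (leftFunctor (GrayTensor A B) c) γ').app p
  rw [e]

end

section

variable {A : Type u₁} [Bicategory.{w₁, v₁} A] {B : Type u₂} [Bicategory.{w₂, v₂} B]
  {A' : Type u₃} [Bicategory.{w₃, v₃} A'] {B' : Type u₄} [Bicategory.{w₄, v₄} B']
  {F F' F'' : TwoFunctor A A'} {G G' G'' : TwoFunctor B B'}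

theorem map₂_iconMap_left {D : Type u₅} [Bicategory.{w₅, v₅} D] (α : Icon F F') (β : Icon G G')
    (K : TwoFunctor (GrayTensor A' B') D) {a a' : A} (f : a ⟶ a') (b : B) :
    HEq (K.map₂ ((iconMap α β).app (left f b))) (K.map₂ (left₂ (α.app f) (G.obj b))) :=
  K.map₂_heq rfl rfl HEq.rfl
    (Icon.homCast_map_heq (P := leftFunctor A' (G.obj b)) (P' := leftFunctor A' (G'.obj b))
      (by rw [β.obj_eq]) _ _ _ _ _) ((isIconMap_iconMap α β).app_left f b)

theorem map₂_iconMap_right {D : Type u₅} [Bicategory.{w₅, v₅} D] (α : Icon F F') (β : Icon G G')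
    (K : TwoFunctor (GrayTensor A' B') D) (a : A) {b b' : B} (g : b ⟶ b') :
    HEq (K.map₂ ((iconMap α β).app (right a g))) (K.map₂ (right₂ (F.obj a) (β.app g))) :=
  K.map₂_heq rfl rfl HEq.rfl
    (Icon.homCast_map_heq (P := rightFunctor (F.obj a) B') (P' := rightFunctor (F'.obj a) B')
      (by rw [α.obj_eq]) _ _ _ _ _) ((isIconMap_iconMap α β).app_right a g)

theorem iconMap_id (F : TwoFunctor A A') (G : TwoFunctor B B') :
    iconMap (Icon.id F) (Icon.id G) = Icon.id (map F G) :=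
  icon_ext
    (fun f b => eq_of_heq (((isIconMap_iconMap _ _).app_left f b).trans
      (heq_of_eq ((leftFunctor A' (G.obj b)).map₂_id (F.map f)))))
    (fun a _ _ g => eq_of_heq (((isIconMap_iconMap _ _).app_right a g).trans
      (heq_of_eq ((rightFunctor (F.obj a) B').map₂_id (G.map g)))))

theorem iconMap_vcomp (α : Icon F F') (α' : Icon F' F'') (β : Icon G G') (β' : Icon G' G'') :
    iconMap (α.vcomp α') (β.vcomp β') = (iconMap α β).vcomp (iconMap α' β') := by
  refine icon_ext (fun {a a'} f b => ?_) (fun a {b b'} g => ?_)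
  · exact eq_of_heq (((isIconMap_iconMap _ _).app_left f b).trans
      (Icon.map₂_vcomp_heq (P := leftFunctor A' (G.obj b)) (P' := leftFunctor A' (G'.obj b))
        (P'' := leftFunctor A' (G''.obj b)) (by rw [β.obj_eq]) (by rw [β'.obj_eq]) _ _ _ _ _ _ _ _
        ((isIconMap_iconMap α β).app_left f b) ((isIconMap_iconMap α' β').app_left f b)))
  · exact eq_of_heq (((isIconMap_iconMap _ _).app_right a g).trans
      (Icon.map₂_vcomp_heq (P := rightFunctor (F.obj a) B') (P' := rightFunctor (F'.obj a) B')
        (P'' := rightFunctor (F''.obj a) B') (by rw [α.obj_eq]) (by rw [α'.obj_eq]) _ _ _ _ _ _ _ _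
        ((isIconMap_iconMap α β).app_right a g) ((isIconMap_iconMap α' β').app_right a g)))

end

section

variable {A : Type u₁} [Bicategory.{w₁, v₁} A] {B : Type u₂} [Bicategory.{w₂, v₂} B]
  {A' : Type u₃} [Bicategory.{w₃, v₃} A'] {B' : Type u₄} [Bicategory.{w₄, v₄} B']
  {A'' : Type u₅} [Bicategory.{w₅, v₅} A''] {B'' : Type u₆} [Bicategory.{w₆, v₆} B'']

theorem iconMap_whiskerLeft (F : TwoFunctor A A') (G : TwoFunctor B B') {H H' : TwoFunctor A' A''}
    {K K' : TwoFunctor B' B''} (α : Icon H H') (β : Icon K K') :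
    HEq (iconMap (Icon.whiskerLeft F α) (Icon.whiskerLeft G β))
      (Icon.whiskerLeft (map F G) (iconMap α β)) :=
  icon_heq (map_comp F H G K) (map_comp F H' G K')
    (fun f b => ((isIconMap_iconMap _ _).app_left f b).trans
      ((isIconMap_iconMap α β).app_left (F.map f) (G.obj b)).symm)
    (fun a _ _ g => ((isIconMap_iconMap _ _).app_right a g).trans
      ((isIconMap_iconMap α β).app_right (F.obj a) (G.map g)).symm)

theorem iconMap_whiskerRight {F F' : TwoFunctor A A'} {G G' : TwoFunctor B B'} (α : Icon F F')
    (β : Icon G G') (H : TwoFunctor A' A'') (K : TwoFunctor B' B'') :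
    HEq (iconMap (α.whiskerRight H) (β.whiskerRight K)) ((iconMap α β).whiskerRight (map H K)) := by
  refine icon_heq (map_comp F H G K) (map_comp F' H G' K) (fun f b => ?_) (fun a _ _ g => ?_)
  · refine ((isIconMap_iconMap _ _).app_left f b).trans (HEq.trans ?_
      ((Icon.whiskerRight_app_heq _ _ _).trans (map₂_iconMap_left α β (map H K) f b)).symm)
    exact (leftFunctor A'' (K.obj (G.obj b))).map₂_heq rfl rfl HEq.rfl
      (heq_of_eq (H.map_homCast _ _ _).symm) (α.whiskerRight_app_heq H f)
  · refine ((isIconMap_iconMap _ _).app_right a g).trans (HEq.trans ?_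
      ((Icon.whiskerRight_app_heq _ _ _).trans (map₂_iconMap_right α β (map H K) a g)).symm)
    exact (rightFunctor (H.obj (F.obj a)) B'').map₂_heq rfl rfl HEq.rfl
      (heq_of_eq (K.map_homCast _ _ _).symm) (β.whiskerRight_app_heq K g)

end

/-- An icon is determined on generating 1-cells, and a generator of a triple product comes from one
factor. On it both sides are the component of the corresponding icon among `α`, `β` and `γ`,
tensored with identities. -/
theorem iconMap_iconMap_whiskerRight_assoc {A : Type u} [Bicategory.{w, v} A] {B : Type u}
    [Bicategory.{w, v} B] {C : Type u} [Bicategory.{w, v} C] {A' : Type u} [Bicategory.{w, v} A']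
    {B' : Type u} [Bicategory.{w, v} B'] {C' : Type u} [Bicategory.{w, v} C']
    {F F' : TwoFunctor A A'} {G G' : TwoFunctor B B'} {K K' : TwoFunctor C C'} (α : Icon F F')
    (β : Icon G G') (γ : Icon K K') :
    HEq ((iconMap (iconMap α β) γ).whiskerRight (assoc A' B' C'))
      (Icon.whiskerLeft (assoc A B C) (iconMap α (iconMap β γ))) := by
  refine icon_heq₃ (assoc_natural F G K) (assoc_natural F' G' K') (fun f b c => ?_)
    (fun a _ _ g c => ?_) (fun a b _ _ h => ?_)
  · refine (Icon.whiskerRight_app_heq _ _ _).trans ((map₂_iconMap_left _ _ _ _ _).trans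
      ((map₂_iconMap_left α β ((leftFunctor _ (K.obj c)).comp (assoc A' B' C')) f b).trans ?_))
    exact ((isIconMap_iconMap α (iconMap β γ)).app_left f ⟨b, c⟩).symm
  · refine (Icon.whiskerRight_app_heq _ _ _).trans ((map₂_iconMap_left _ _ _ _ _).trans
      ((map₂_iconMap_right α β ((leftFunctor _ (K.obj c)).comp (assoc A' B' C')) a g).trans ?_))
    exact (((isIconMap_iconMap α (iconMap β γ)).app_right a (left g c)).trans
      (map₂_iconMap_left β γ (rightFunctor (F.obj a) (GrayTensor B' C')) g c)).symm
  · refine (Icon.whiskerRight_app_heq _ _ _).trans ((map₂_iconMap_right _ _ _ _ _).trans ?_)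
    exact (((isIconMap_iconMap α (iconMap β γ)).app_right a (right b h)).trans
      (map₂_iconMap_right β γ (rightFunctor (F.obj a) (GrayTensor B' C')) b h)).symm

/-! ### Projections and the unitor axioms -/

section

/-- The first projection `A ⊗ B ⥤ A`. -/
def projFst (A : Type u₁) [Bicategory.{w₁, v₁} A] [Strict A] (B : Type u₂)
    [Bicategory.{w₂, v₂} B] : TwoFunctor (GrayTensor A B) A :=
  (symm A B).comp (projSnd B A)

variable {A : Type u₁} [Bicategory.{w₁, v₁} A] {A' : Type u₂} [Bicategory.{w₂, v₂} A']
  {B : Type u₃} [Bicategory.{w₃, v₃} B] [Strict B] {B' : Type u₄} [Bicategory.{w₄, v₄} B']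
  [Strict B']

/-- On `1 ⊗ g` both sides are `β_g`; on `f ⊗ 1` both are identities, on the right because an icon
has identity components at identity 1-cells. -/
theorem iconMap_whiskerRight_projSnd (F : TwoFunctor A A') {G G' : TwoFunctor B B'}
    (β : Icon G G') :
    HEq ((iconMap (Icon.id F) β).whiskerRight (projSnd A' B'))
      (Icon.whiskerLeft (projSnd A B) β) := by
  refine icon_heq (map_comp_projSnd F G) (map_comp_projSnd F G') (fun f b => ?_)
    (fun a _ _ g => ?_)
  · refine (Icon.whiskerRight_app_heq _ _ _).trans ((map₂_iconMap_left _ _ _ _ _).trans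
      (HEq.trans ?_ (heq_of_eq (β.app_id b)).symm))
    change HEq (𝟙 (𝟙 (G.obj b))) _
    exact ((eqToHom_heq_id_dom _ _ _).trans (id₂_heq_id₂ rfl rfl (heq_of_eq (G.map_id b)))).symm
  · exact (Icon.whiskerRight_app_heq _ _ _).trans (map₂_iconMap_right _ _ _ _ _)

theorem map_comp_projFst (F : TwoFunctor A A') (G : TwoFunctor B B') :
    (map G F).comp (projFst B' A') = (projFst B A).comp G := by
  have e₁ := congrArg (fun K => K.comp (projSnd A' B')) (map_comp_symm G F)
  exact e₁.trans (congrArg (symm B A).comp (map_comp_projSnd F G))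

theorem iconMap_whiskerRight_projFst (F : TwoFunctor A A') {G G' : TwoFunctor B B'}
    (β : Icon G G') :
    HEq ((iconMap β (Icon.id F)).whiskerRight (projFst B' A'))
      (Icon.whiskerLeft (projFst B A) β) := by
  refine icon_heq (map_comp_projFst F G) (map_comp_projFst F G') (fun f b => ?_)
    (fun a _ _ g => ?_)
  · exact (Icon.whiskerRight_app_heq _ _ _).trans (map₂_iconMap_left _ _ _ _ _)
  · refine (Icon.whiskerRight_app_heq _ _ _).trans ((map₂_iconMap_right _ _ _ _ _).trans
      (HEq.trans ?_ (heq_of_eq (β.app_id a)).symm))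
    change HEq (𝟙 (𝟙 (G.obj a))) _
    exact ((eqToHom_heq_id_dom _ _ _).trans (id₂_heq_id₂ rfl rfl (heq_of_eq (G.map_id a)))).symm

variable (B)

theorem isLeftUnitor_projSnd : IsLeftUnitor (projSnd A B) where
  obj _ _ := rfl
  map_left _ _ := HEq.rfl
  map_right _ _ _ _ := HEq.rfl
  map₂_right₂ _ _ _ _ _ _ := HEq.rfl

theorem isRightUnitor_projFst : IsRightUnitor (projFst B A) where
  obj _ _ := rfl
  map_left _ _ := HEq.rfl
  map_right _ _ _ _ := HEq.rfl
  map₂_left₂ _ _ := HEq.rfl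

/-- The inverse `B ⥤ B ⊗ 1` of the right unitor. -/
def projFstInv : TwoFunctor B (GrayTensor B Point.{u}) :=
  (rightFunctor point B).comp (symm Point.{u} B)

/-- The left unit law conjugated by the symmetry, whose square is the identity. -/
theorem projFst_comp_projFstInv :
    (projFst B Point.{u}).comp (projFstInv B) = TwoFunctor.id (GrayTensor B Point.{u}) := by
  have e := congrArg (fun K => (symm B Point.{u}).comp (K.comp (symm Point.{u} B)))
    (projSnd_comp_rightFunctor B)
  exact e.trans (symm_comp_symm B Point.{u})

theorem projFstInv_comp_projFst :
    (projFstInv B).comp (projFst B Point.{u}) = TwoFunctor.id B := by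
  exact congrArg (fun K => (rightFunctor point B).comp (K.comp (projSnd Point.{u} B)))
    (symm_comp_symm Point.{u} B)

end

end GrayTensor

/-! ### The strongly monoidal structure -/

namespace GrayIcon

theorem eq_conj_of_heq (X Y : GrayIcon.{u}) {F F' G G' : X ⟶ Y} (h : F = F') (h' : G' = G)
    {α : F ⟶ G} {β : F' ⟶ G'} (e : HEq α β) : α = eqToHom h ≫ β ≫ eqToHom h' :=
  eq_eqToHom_conj_of_heq h h' e

/-- The Gray monoidal structure on `Gray_icon`. -/
noncomputable def stronglyMonoidal :
    StronglyMonoidal GrayIcon.{u} GrayIcon.tensor GrayIcon.unit where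
  tensorHom F G := GrayTensor.map F G
  tensorHom₂ α β := GrayTensor.iconMap α β
  tensorHom_id X Y := GrayTensor.map_id X.carrier Y.carrier
  tensorHom_comp F F' G G' := GrayTensor.map_comp F F' G G'
  tensorHom₂_id F G := GrayTensor.iconMap_id F G
  tensorHom₂_comp α α' β β' := GrayTensor.iconMap_vcomp α α' β β'
  tensorHom₂_whiskerLeft {X _ X'' Y _ Y''} F G _ _ _ _ α β :=
    eq_conj_of_heq (tensor X Y) (tensor X'' Y'') _ _ (GrayTensor.iconMap_whiskerLeft F G α β)
  tensorHom₂_whiskerRight {X _ X'' Y _ Y'' _ _ _ _} α β H K :=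
    eq_conj_of_heq (tensor X Y) (tensor X'' Y'') _ _ (GrayTensor.iconMap_whiskerRight α β H K)
  assoc X Y Z := GrayTensor.assoc X.carrier Y.carrier Z.carrier
  assocInv X Y Z := GrayTensor.assocInv X.carrier Y.carrier Z.carrier
  assoc_assocInv X Y Z := GrayTensor.assoc_assocInv X.carrier Y.carrier Z.carrier
  assocInv_assoc X Y Z := GrayTensor.assocInv_assoc X.carrier Y.carrier Z.carrier
  assoc_naturality F G K := GrayTensor.assoc_natural F G K
  assoc_naturality₂ α β γ :=
    eq_eqToHom_conj_of_heq _ _ (GrayTensor.iconMap_iconMap_whiskerRight_assoc α β γ)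
  leftUnit X := GrayTensor.projSnd GrayTensor.Point X.carrier
  leftUnitInv X := GrayTensor.rightFunctor GrayTensor.point X.carrier
  leftUnit_leftUnitInv X := GrayTensor.projSnd_comp_rightFunctor X.carrier
  leftUnitInv_leftUnit X := GrayTensor.rightFunctor_comp_projSnd X.carrier
  leftUnit_naturality F := GrayTensor.map_comp_projSnd (TwoFunctor.id GrayTensor.Point) F
  leftUnit_naturality₂ α := eq_eqToHom_conj_of_heq _ _
    (GrayTensor.iconMap_whiskerRight_projSnd (TwoFunctor.id GrayTensor.Point) α)
  rightUnit X := GrayTensor.projFst X.carrier GrayTensor.Point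
  rightUnitInv X := GrayTensor.projFstInv X.carrier
  rightUnit_rightUnitInv X := GrayTensor.projFst_comp_projFstInv X.carrier
  rightUnitInv_rightUnit X := GrayTensor.projFstInv_comp_projFst X.carrier
  rightUnit_naturality F := GrayTensor.map_comp_projFst (TwoFunctor.id GrayTensor.Point) F
  rightUnit_naturality₂ α := eq_eqToHom_conj_of_heq _ _
    (GrayTensor.iconMap_whiskerRight_projFst (TwoFunctor.id GrayTensor.Point) α)
  pentagon W X Y Z := GrayTensor.assoc_pentagon
    (A := W.carrier) (B := X.carrier) (C := Y.carrier) (D := Z.carrier)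
  triangle X Y := GrayTensor.assoc_triangle X.carrier GrayTensor.Point Y.carrier

end GrayIcon

/-- The Gray tensor product makes the 2-category `Gray_icon` of 2-categories, 2-functors and icons
into a strongly monoidal 2-category. -/
theorem proposition3p7 :
    ∃ M : StronglyMonoidal GrayIcon.{u} GrayIcon.tensor GrayIcon.unit,
      (∀ {A A' B B' : GrayIcon.{u}} (F : A ⟶ A') (G : B ⟶ B'),
        GrayTensor.IsMap F G (M.tensorHom F G)) ∧
      (∀ {A A' B B' : GrayIcon.{u}} {F F' : A ⟶ A'} {G G' : B ⟶ B'} (α : F ⟶ F') (β : G ⟶ G'),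
        GrayTensor.IsIconMap α β (M.tensorHom₂ α β)) ∧
      (∀ A B C : GrayIcon.{u}, GrayTensor.IsAssociator (M.assoc A B C)) ∧
      (∀ A : GrayIcon.{u}, GrayTensor.IsLeftUnitor (M.leftUnit A)) ∧
      (∀ A : GrayIcon.{u}, GrayTensor.IsRightUnitor (M.rightUnit A)) := by
  exact ⟨GrayIcon.stronglyMonoidal, fun F G => GrayTensor.isMap_map F G,
    fun α β => GrayTensor.isIconMap_iconMap α β,
    fun A B C => GrayTensor.isAssociator_assoc,
    fun A => GrayTensor.isLeftUnitor_projSnd A.carrier,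
    fun A => GrayTensor.isRightUnitor_projFst A.carrier⟩
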